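/- **Setting.** Alice and Bob hold pairs of qubits; $\Phi$ is the projector on the Bell state $2^{-1/2}\sum_{x\in\{0,1\}}|x\rangle_A|x\rangle_B$. *Box.* For $1\le k\le n$, $n\ge 2$, a single attempt of the passive random bilocal Clifford protocol $n\to k$ acts on an arbitrary $2n$-qubit state $\rho_{A^nB^n}$ as follows. An $n$-qubit Clifford unitary $C$ is sampled uniformly from a fixed finite family that is an exact unitary 2-design; Alice applies $C$, Bob applies the complex conjugate $C^*$; both measure their first $n-k$ qubits in the computational basis; the attempt is accepted if and only if all their outcomes agree, and then outputs the remaining $k$ pairs. Each $C$ is given by a circuit of gates $H,S,S^\dagger,\mathrm{CNOT}$, which may use ancilla qubits that start and end in $|0\rangle$; the depth of the circuit is its number of time steps, gates of one step acting on disjoint qubits. Gate counts are those of Alice and Bob together, and gate counts and depths are worst cases over the family. *Concatenation.* A concatenated protocol has $L\ge 1$ layers, layer $\ell$ consisting of boxes $n_\ell\to k_\ell$ (with its own family of circuits), where $n_{\ell+1}=c_{\ell+1}k_\ell$ for an integer $c_{\ell+1}$. A box of layer $1$ acts on a fresh block of $n_1$ noisy input pairs, a box of layer $\ell+1$ on the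 outputs of $c_{\ell+1}$ boxes of layer $\ell$. Every box is repeated until it accepts, and after a rejection all its inputs are produced anew. There is one box in layer $L$, which outputs $k=k_L$ pairs. The boxes of a layer are run in parallel: the memory is the number $n_1c_2\cdots c_L$ of pairs held at any time, and the depth is the duration of the run in circuit time steps, reruns included. An *attempt* of the concatenated protocol is one run which is aborted (a detected failure) when it would exceed a prescribed budget of input pairs, gates or depth; reruns of boxes count towards the budget. The whole protocol makes a bounded number of successive attempts, until one of them succeeds. *Noise.* The protocol has *initial infidelity $\varepsilon_0$* if the blocks of $n_1$ input pairs are independent of one another and each is in an arbitrary (possibly correlated within the block) state $\rho$ with $\operatorname{Tr}(\Phi^{\otimes n_1}\rho)\ge(1-\varepsilon_0)^{n_1}$; different blocks may be in different states. **Theorem.** There are absolute constants $C>0$ and $a\in\mathbb N$ such that for all $0<\varepsilon_f<\varepsilon_0\le 0.0006$ there are a concatenated passive random bilocal Clifford protocol, with output size $k$, and budgets of gates and depth per attempt, with the following properties for every $0<\delta\le 1/2$. There are a number $A\le\lceil\log_2(1/\delta)\rceil$ of attempts and a budget of input pairs per attempt such that, for all inputs of initial infidelity $\varepsilon_0$,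 the protocol succeeds with probability at least $1-\delta$, and the output state $\bar\rho$, conditioned on success, satisfies $\operatorname{Tr}(\Phi^{\otimes k}\bar\rho)\ge(1-\varepsilon_f)^k$. Moreover: 1. the overhead, i.e. the total number of input pairs used in all attempts divided by $k$, is at most $411\log_2(1/\delta)$; 2. the total number of input pairs used is at most $411\,(\log_2(1/\varepsilon_f))^{3/2}\log_2(1/\delta)$; 3. Alice and Bob hold at most $(\log_2(1/\varepsilon_f))^{3/2}$ pairs in memory at any time; 4. the number of layers satisfies $L\le C\log_2^*(1/\varepsilon_f)$, where $\log_2^*x$ is the least $j\ge0$ such that $j$ applications of $\log_2$ to $x$ give a number $\le 1$; 5. each attempt, including all reruns in it, uses at most $C(\log_2(1/\varepsilon_f))^a$ gates, which run in depth at most $C(\log_2\log_2(1/\varepsilon_f))^a$. -/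

import Mathlib

open scoped Kronecker Matrix ComplexOrder
open MeasureTheory

noncomputable section

namespace Distill

/-! ### Qubit registers and Bell pairs -/

/-- Computational basis labels of `n` qubits. -/
abbrev Bits (n : ℕ) := Fin n → Bool

/-- Basis labels of `n` qubit pairs: Alice's `n` bits and Bob's `n` bits. -/
abbrev Reg (n : ℕ) := Bits n × Bits n

/-- Operators on `n` qubit pairs. -/
abbrev Op (n : ℕ) := Matrix (Reg n) (Reg n) ℂ

/-- The projector on `n` perfect Bell pairs, i.e. on `2^(-n/2) ∑ₓ |x⟩_A |x⟩_B`. -/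
def bell (n : ℕ) : Op n := fun p q => if p.1 = p.2 ∧ q.1 = q.2 then ((2 : ℂ) ^ n)⁻¹ else 0

/-- The overlap `Tr(Φ^{⊗n} σ)` of a (possibly unnormalised) state with `n` perfect Bell pairs. -/
def bellOverlap {n : ℕ} (σ : Op n) : ℝ := (Matrix.trace (bell n * σ)).re

/-- Density operators. -/
def IsState {n : ℕ} (ρ : Op n) : Prop := ρ.PosSemidef ∧ ρ.trace = 1

/-- The tensor product of `c` operators, each on `k` pairs, as an operator on `c * k` pairs. -/
def blockTensor {c k : ℕ} (σ : Fin c → Op k) : Op (c * k) := fun p q =>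
  ∏ j : Fin c, σ j
    (fun i => p.1 (finProdFinEquiv (j, i)), fun i => p.2 (finProdFinEquiv (j, i)))
    (fun i => q.1 (finProdFinEquiv (j, i)), fun i => q.2 (finProdFinEquiv (j, i)))

/-! ### Clifford circuits -/

/-- A generating set of the Clifford group on `q` qubits. -/
inductive Gate (q : ℕ) : Type
  | had (i : Fin q) : Gate q
  | phase (i : Fin q) : Gate q
  | phaseInv (i : Fin q) : Gate q
  | cnot (control target : Fin q) (h : control ≠ target) : Gate q

/-- The qubits on which a gate acts. -/
def Gate.support {q : ℕ} : Gate q → Finset (Fin q)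
  | .had i => {i}
  | .phase i => {i}
  | .phaseInv i => {i}
  | .cnot i j _ => {i, j}

/-- The unitary matrix of a gate. -/
def Gate.mat {q : ℕ} : Gate q → Matrix (Bits q) (Bits q) ℂ
  | .had i => fun y x =>
      if ∀ j, j ≠ i → y j = x j then
        (if x i = true ∧ y i = true then -1 else 1) * ((Real.sqrt 2 : ℝ) : ℂ)⁻¹
      else 0
  | .phase i => Matrix.diagonal fun x => if x i = true then Complex.I else 1
  | .phaseInv i => Matrix.diagonal fun x => if x i = true then -Complex.I else 1
  | .cnot i j _ => fun y x => if y = Function.update x j (xor (x j) (x i)) then 1 else 0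

/-- The unitary of a sequence of gates; the head of the list is applied first. -/
def gatesMat {q : ℕ} (gs : List (Gate q)) : Matrix (Bits q) (Bits q) ℂ :=
  gs.foldl (fun U g => g.mat * U) 1

/-- Append `a` ancilla qubits in the state `|0⟩`. -/
def withZeros {n : ℕ} (a : ℕ) (x : Bits n) : Bits (n + a) := Fin.append x fun _ => false

/-- A Clifford circuit on `n` qubits and `anc` ancilla qubits, organised in time steps: the gates of
one step act on disjoint sets of qubits. The ancillas start in `|0⟩` and are returned to `|0⟩`. -/
structure CliffordCircuit (n : ℕ) where
  anc : ℕ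
  steps : List (List (Gate (n + anc)))
  disjoint : ∀ s ∈ steps, s.Pairwise fun g h => Disjoint g.support h.support
  clean : ∀ (x : Bits n) (z : Bits (n + anc)), (∀ y : Bits n, z ≠ withZeros anc y) →
    gatesMat steps.flatten z (withZeros anc x) = 0

/-- The `n`-qubit unitary that the circuit implements. -/
def CliffordCircuit.toMatrix {n : ℕ} (U : CliffordCircuit n) : Matrix (Bits n) (Bits n) ℂ :=
  fun y x => gatesMat U.steps.flatten (withZeros U.anc y) (withZeros U.anc x)

/-- Number of gates. -/
def CliffordCircuit.size {n : ℕ} (U : CliffordCircuit n) : ℕ := U.steps.flatten.length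

/-- Number of time steps. -/
def CliffordCircuit.depth {n : ℕ} (U : CliffordCircuit n) : ℕ := U.steps.length

/-! ### Unitary 2-designs -/

section Haar

instance compactUnitary (d : Type) [Fintype d] [DecidableEq d] :
    CompactSpace (Matrix.unitaryGroup d ℂ) := by
  refine isCompact_iff_compactSpace.mp ?_
  have hK : IsCompact
      (Set.univ.pi fun _ : d => Set.univ.pi fun _ : d => Metric.closedBall (0 : ℂ) 1) :=
    isCompact_univ_pi fun _ => isCompact_univ_pi fun _ => isCompact_closedBall _ _
  refine hK.of_isClosed_subset ?_ ?_
  · have h : ((Matrix.unitaryGroup d ℂ : Submonoid (Matrix d d ℂ)) : Set (Matrix d d ℂ)) =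
        {U : Matrix d d ℂ | star U * U = 1} := by
      ext U
      exact Matrix.mem_unitaryGroup_iff'
    rw [h]
    exact isClosed_eq (by fun_prop) continuous_const
  · intro U hU i _ j _
    simpa using entry_norm_bound_of_unitary hU i j

instance unitaryMeasurableSpace (d : Type) [Fintype d] [DecidableEq d] :
    MeasurableSpace (Matrix.unitaryGroup d ℂ) := borel _

instance unitaryBorelSpace (d : Type) [Fintype d] [DecidableEq d] :
    BorelSpace (Matrix.unitaryGroup d ℂ) := ⟨rfl⟩

/-- The Haar probability measure on the unitary group. -/
def unitaryHaar (d : Type) [Fintype d] [DecidableEq d] : Measure (Matrix.unitaryGroup d ℂ) :=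
  Measure.haarMeasure ⊤

/-- The uniform distribution on `C 0, …, C (N-1)` is an exact unitary 2-design: averaging
`X ↦ (U ⊗ U) X (U ⊗ U)†` over it gives the same channel as averaging over Haar measure. -/
def IsTwoDesign {d : Type} [Fintype d] [DecidableEq d] {N : ℕ} (C : Fin N → Matrix d d ℂ) : Prop :=
  0 < N ∧ (∀ i, C i ∈ Matrix.unitaryGroup d ℂ) ∧
  ∀ (X : Matrix (d × d) (d × d) ℂ) (p q : d × d),
    (N : ℂ)⁻¹ * ∑ i, ((C i ⊗ₖ C i) * X * (C i ⊗ₖ C i)ᴴ) p q =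
      ∫ U : Matrix.unitaryGroup d ℂ,
        (((U : Matrix d d ℂ) ⊗ₖ (U : Matrix d d ℂ)) * X *
          ((U : Matrix d d ℂ) ⊗ₖ (U : Matrix d d ℂ))ᴴ) p q ∂(unitaryHaar d)

end Haar

/-! ### One box: a single attempt of the passive random bilocal Clifford protocol -/

/-- The data of the passive random bilocal Clifford protocol from `n` pairs to `k` pairs: a
2-design of Clifford unitaries, each given by a circuit. -/
structure Box (n k : ℕ) where
  two_le : 2 ≤ n
  one_le : 1 ≤ k
  le : k ≤ n
  N : ℕ
  circ : Fin N → CliffordCircuit n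
  design : IsTwoDesign fun i => (circ i).toMatrix

/-- `E_C [(C ⊗ C^*) X (C ⊗ C^*)†]`: Alice applies the sampled `C`, Bob its complex conjugate. -/
def Box.twirl {n k : ℕ} (B : Box n k) (X : Op n) : Op n :=
  (B.N : ℂ)⁻¹ • ∑ i,
    ((B.circ i).toMatrix ⊗ₖ (B.circ i).toMatrix.map (starRingEnd ℂ)) * X *
      ((B.circ i).toMatrix ⊗ₖ (B.circ i).toMatrix.map (starRingEnd ℂ))ᴴ

/-- Concatenate the bits `s` of the first `n - k` qubits with the bits `x` of the last `k`. -/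
def glue {n k : ℕ} (h : k ≤ n) (s : Bits (n - k)) (x : Bits k) : Bits n := fun i =>
  if hi : (i : ℕ) < n - k then s ⟨i, hi⟩ else x ⟨(i : ℕ) - (n - k), by omega⟩

/-- The unnormalised state of the last `k` pairs on acceptance, i.e. when the outcomes of Alice's
and Bob's measurements of their first `n - k` qubits in the computational basis agree. Its trace is
the probability of acceptance. -/
def Box.accept {n k : ℕ} (B : Box n k) (X : Op n) : Op k := fun p q =>
  ∑ s : Bits (n - k), B.twirl X
    (glue B.le s p.1, glue B.le s p.2) (glue B.le s q.1, glue B.le s q.2)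

/-- The probability of rejection, i.e. that the two strings of outcomes differ. -/
def Box.reject {n k : ℕ} (B : Box n k) (X : Op n) : ℝ :=
  ∑ p : Reg n, if ∃ i : Fin n, (i : ℕ) < n - k ∧ p.1 i ≠ p.2 i then (B.twirl X p p).re else 0

/-- Gates applied by Alice and Bob together in one attempt (worst case over the sampled `C`). -/
def Box.gates {n k : ℕ} (B : Box n k) : ℕ := 2 * Finset.univ.sup fun i => (B.circ i).size

/-- Depth of one attempt (worst case over the sampled `C`); Alice and Bob act in parallel. -/
def Box.depth {n k : ℕ} (B : Box n k) : ℕ := Finset.univ.sup fun i => (B.circ i).depth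

/-! ### Concatenation -/

/-- A concatenated protocol that consumes blocks of `b` noisy pairs and delivers `k` pairs.
A box of the first layer takes a block of `n₁ = b` noisy pairs. A box of a later layer takes the
outputs of `c` boxes of the layer below, `n = c * k` pairs in all. -/
inductive Scheme (b : ℕ) : ℕ → Type
  | first {k : ℕ} (B : Box b k) : Scheme b k
  | next {k k' : ℕ} (S : Scheme b k) (c : ℕ) (B : Box (c * k) k') : Scheme b k'

namespace Scheme

variable {b : ℕ}

/-- Number of layers. -/
def layers : {k : ℕ} → Scheme b k → ℕ
  | _, .first _ => 1
  | _, .next S _ _ => S.layers + 1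

/-- Maximal number of pairs held at any time when all boxes of a layer are run in parallel. A box of
the first layer holds one block of `b` pairs at a time. The `c` sub-protocols that feed a box of a
later layer work side by side; the box itself acts on their outputs, which are no more pairs. -/
def memory : {k : ℕ} → Scheme b k → ℕ
  | _, .first _ => b
  | _, .next S c _ => c * S.memory

/-- The possible histories of a repeat-until-success run of the top box. In the first layer: the
number of rejected attempts before the accepted one. In a later layer: the list of the rejected
attempts, and the accepted attempt, where an attempt has `c` runs of the layer below as inputs
(so that a rejection makes all the inputs of the box be produced anew). -/
def Run : {k : ℕ} → Scheme b k → Type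
  | _, .first _ => ℕ
  | _, .next S c _ => List (Fin c → S.Run) × (Fin c → S.Run)

/-- Total number of noisy input pairs that are consumed in a run, rejected attempts included. -/
def pairs : {k : ℕ} → (S : Scheme b k) → S.Run → ℕ
  | _, .first _ => fun r : ℕ => (r + 1) * b
  | _, .next S c _ => fun h : List (Fin c → S.Run) × (Fin c → S.Run) =>
      (h.1.map fun a => ∑ j, S.pairs (a j)).sum + ∑ j, S.pairs (h.2 j)

/-- Total number of gates in a run, rejected attempts included. -/
def gates : {k : ℕ} → (S : Scheme b k) → S.Run → ℕ
  | _, .first B => fun r : ℕ => (r + 1) * B.gates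
  | _, .next S c B => fun h : List (Fin c → S.Run) × (Fin c → S.Run) =>
      (h.1.map fun a => (∑ j, S.gates (a j)) + B.gates).sum + ((∑ j, S.gates (h.2 j)) + B.gates)

/-- Depth of a run: the attempts of a box follow one another, whereas the runs that produce the
inputs of an attempt take place in parallel. -/
def depth : {k : ℕ} → (S : Scheme b k) → S.Run → ℕ
  | _, .first B => fun r : ℕ => (r + 1) * B.depth
  | _, .next S c B => fun h : List (Fin c → S.Run) × (Fin c → S.Run) =>
      (h.1.map fun a => (Finset.univ.sup fun j => S.depth (a j)) + B.depth).sum +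
        ((Finset.univ.sup fun j => S.depth (h.2 j)) + B.depth)

/-- The unnormalised output state of a run: its trace is the probability of the history. All blocks
of noisy pairs are independent of one another; the state of the block that is used by the `i`-th
attempt of the first-layer box with address `w` is `ρ (i :: w)`, where an address lists the
positions and attempt numbers on the way from the top box to the box in question. -/
def outState (ρ : List ℕ → Op b) : {k : ℕ} → (S : Scheme b k) → List ℕ → S.Run → Op k
  | _, .first B => fun w (r : ℕ) =>
      ((∏ i ∈ Finset.range r, B.reject (ρ (i :: w)) : ℝ) : ℂ) • B.accept (ρ (r :: w))
  | _, .next S c B => fun w (h : List (Fin c → S.Run) × (Fin c → S.Run)) =>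
      ((∏ i : Fin h.1.length,
          B.reject (blockTensor fun j => outState ρ S (j :: i :: w) (h.1.get i j)) : ℝ) : ℂ) •
        B.accept (blockTensor fun j => outState ρ S (j :: h.1.length :: w) (h.2 j))

open Classical in
/-- The event that a run stays within a budget of `P` input pairs, `G` gates and depth `D`, weighted
by the functional `f` of the output state. An attempt of the whole protocol is aborted, and counts
as a detected failure, when it would exceed its budget. -/
def budgeted (ρ : List ℕ → Op b) {k : ℕ} (S : Scheme b k) (P G D : ℕ) (f : Op k → ℝ)
    (w : List ℕ) : ℝ :=
  ∑' r : S.Run,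
    if S.pairs r ≤ P ∧ S.gates r ≤ G ∧ S.depth r ≤ D then f (S.outState ρ w r) else 0

/-- The probability that the `t`-th attempt succeeds within its budget. -/
def attemptProb (ρ : List ℕ → Op b) {k : ℕ} (S : Scheme b k) (P G D t : ℕ) : ℝ :=
  S.budgeted ρ P G D (fun σ => σ.trace.re) [t]

/-- The probability that the `t`-th attempt succeeds within its budget and that its output is found
to be `k` perfect Bell pairs. -/
def attemptBellProb (ρ : List ℕ → Op b) {k : ℕ} (S : Scheme b k) (P G D t : ℕ) : ℝ :=
  S.budgeted ρ P G D bellOverlap [t]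

/-- The probability that one of at most `A` successive budgeted attempts succeeds. -/
def successProb (ρ : List ℕ → Op b) {k : ℕ} (S : Scheme b k) (A P G D : ℕ) : ℝ :=
  ∑ t ∈ Finset.range A,
    (∏ u ∈ Finset.range t, (1 - S.attemptProb ρ P G D u)) * S.attemptProb ρ P G D t

/-- The joint probability of success and of finding the output to be `k` perfect Bell pairs, so that
`successBellProb / successProb` is the fidelity of the output state conditioned on success. -/
def successBellProb (ρ : List ℕ → Op b) {k : ℕ} (S : Scheme b k) (A P G D : ℕ) : ℝ :=
  ∑ t ∈ Finset.range A,
    (∏ u ∈ Finset.range t, (1 - S.attemptProb ρ P G D u)) * S.attemptBellProb ρ P G D t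

end Scheme

/-- The binary iterated logarithm: how often `log₂` has to be applied to `x` until the result is at
most `1`. -/
def logStar (x : ℝ) : ℕ := sInf {j : ℕ | (Real.logb 2)^[j] x ≤ 1}

end Distill

end

/-! One box. A bilocal twirl over a 2-design maps every operator to a combination of the identity
and the Bell projector, with coefficients determined by its trace `t` and Bell overlap `f`
(`Box.twirl_eq`). Everything about acceptance then depends on `t` and `f` alone: a box rejects with
weight at most `t - f`, and a box that measures `s = n - k` pairs leaves relative infidelity at most
`2 ^ (-s)`, whatever the input infidelity below `1/2` was (`Regular.accept`, `Regular.reject_le`).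
These bounds hold for each history separately, so aborting runs that exceed a budget cannot spoil
the output.

The 2-design. Random quadratic phases, a Hadamard layer, more phases and a multiplication in the
field with `2 ^ n` elements reduce a second-moment operator to the span of the identity, the flip
and the diagonal projector. A further phase-Hadamard layer, applied with probability `2 ^ n / (2 ^ n
+ 1)`, removes the diagonal projector (`sum_conjTwo_designMat`). All factors reduce to adding a
linear function of one register to another, which fan-out and parity trees of CNOT gates do in depth
`O(log n)` (`exists_designFamily`). All 2-designs have the same twirl, so the explicit family also
determines the twirl of an arbitrary box.

Repetition. Rerunning a box obeys renewal inequalities: if an attempt costs `H` on average and is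
rejected with probability at most `q`, any `K` with `H + q * K ≤ K` bounds the expected total. The
same scheme handles `E[x ^ depth]`. There the maximum over the parallel inputs is bounded by the sum
of their moments, so a fan-in of `c` costs only about `log c` box depths, and Markov's inequality
gives polylogarithmic budgets (`Bounds.next`, `Bounds.success`).

Sizes. A box of layer `j` measures `syndrome j` pairs, so its output infidelity is `2 ^ (-syndrome
j)`, and exponentially many (`2 ^ (syndrome j / 8)` up to a factor) such outputs can feed one box of
the next layer. Hence `syndrome` grows like a tower, which gives `log*` layers. Layer `j + 1`
measures only a fraction `2 ^ (-(j + 3))` of its pairs, so the rates, the memory per output and the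
expected inputs per output stay bounded by constants. A last layer measures `⌈log₂ (1/ε_f)⌉` pairs
and takes about twice as many inputs or more (`exists_scheme`). Each budgeted attempt succeeds with
probability at least `1/2`, so `⌈log₂ (1/δ)⌉` of them suffice. -/

namespace Distill

/-! ### Second-moment twirls -/

section Twirl

variable {d : Type}

section

variable [Fintype d]

/-- Conjugation by `V ⊗ V`. -/
def conjTwo (V : Matrix d d ℂ) (X : Matrix (d × d) (d × d) ℂ) : Matrix (d × d) (d × d) ℂ :=
  (V ⊗ₖ V) * X * (V ⊗ₖ V)ᴴ

lemma conjTwo_mul (V W : Matrix d d ℂ) (X : Matrix (d × d) (d × d) ℂ) :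
    conjTwo (V * W) X = conjTwo V (conjTwo W X) := by
  simp only [conjTwo, Matrix.mul_kronecker_mul, Matrix.conjTranspose_mul, Matrix.mul_assoc]

lemma conjTwo_add (V : Matrix d d ℂ) (X Y : Matrix (d × d) (d × d) ℂ) :
    conjTwo V (X + Y) = conjTwo V X + conjTwo V Y := by
  simp only [conjTwo, Matrix.mul_add, Matrix.add_mul]

lemma conjTwo_smul (V : Matrix d d ℂ) (c : ℂ) (X : Matrix (d × d) (d × d) ℂ) :
    conjTwo V (c • X) = c • conjTwo V X := by
  simp only [conjTwo, Matrix.mul_smul, Matrix.smul_mul]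

lemma conjTwo_sum {ι : Type*} (s : Finset ι) (V : Matrix d d ℂ)
    (X : ι → Matrix (d × d) (d × d) ℂ) :
    conjTwo V (∑ i ∈ s, X i) = ∑ i ∈ s, conjTwo V (X i) := by
  simp only [conjTwo, Matrix.mul_sum, Matrix.sum_mul]

lemma conjTwo_apply (V : Matrix d d ℂ) (X : Matrix (d × d) (d × d) ℂ) (p q : d × d) :
    conjTwo V X p q =
      ∑ r, ∑ s, V p.1 r.1 * V p.2 r.2 * X r s * star (V q.1 s.1 * V q.2 s.2) := by
  simp only [conjTwo, Matrix.mul_apply, Matrix.conjTranspose_apply, Matrix.kroneckerMap_apply,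
    Finset.sum_mul]
  exact Finset.sum_comm

end

/-- The operator exchanging the two tensor factors. -/
def flipMat (d : Type) [DecidableEq d] : Matrix (d × d) (d × d) ℂ :=
  fun p q => if q = p.swap then 1 else 0

/-- The diagonal projector onto pairs of equal labels. -/
def diagMat (d : Type) [DecidableEq d] : Matrix (d × d) (d × d) ℂ :=
  fun p q => if q = p ∧ p.1 = p.2 then 1 else 0

variable [Fintype d] [DecidableEq d]

lemma conjTwo_one (X : Matrix (d × d) (d × d) ℂ) : conjTwo 1 X = X := by
  simp [conjTwo]

lemma kronecker_mul_flipMat (V : Matrix d d ℂ) :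
    (V ⊗ₖ V) * flipMat d = flipMat d * (V ⊗ₖ V) := by
  ext p q
  have h : ∀ r : d × d, (q = r.swap) = (r = q.swap) := fun r => by
    rw [eq_iff_iff, ← Prod.swap_inj, Prod.swap_swap, eq_comm]
  simp [Matrix.mul_apply, flipMat, h, mul_comm]

lemma kronecker_mul_conjTranspose {V : Matrix d d ℂ} (hV : V ∈ Matrix.unitaryGroup d ℂ) :
    (V ⊗ₖ V) * (V ⊗ₖ V)ᴴ = 1 := by
  rw [Matrix.conjTranspose_kronecker, ← Matrix.mul_kronecker_mul, ← Matrix.star_eq_conjTranspose,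
    Matrix.mem_unitaryGroup_iff.1 hV, Matrix.one_kronecker_one]

lemma conjTwo_unitary_one {V : Matrix d d ℂ} (hV : V ∈ Matrix.unitaryGroup d ℂ) :
    conjTwo V 1 = 1 := by
  rw [conjTwo, Matrix.mul_one, kronecker_mul_conjTranspose hV]

lemma conjTwo_unitary_flipMat {V : Matrix d d ℂ} (hV : V ∈ Matrix.unitaryGroup d ℂ) :
    conjTwo V (flipMat d) = flipMat d := by
  rw [conjTwo, kronecker_mul_flipMat, Matrix.mul_assoc, kronecker_mul_conjTranspose hV,
    Matrix.mul_one]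

instance haar_isProbabilityMeasure : IsProbabilityMeasure (unitaryHaar d) :=
  ⟨by simpa [unitaryHaar] using Measure.haarMeasure_self (K₀ := (⊤ : TopologicalSpace.PositiveCompacts
    (Matrix.unitaryGroup d ℂ)))⟩

instance haar_isHaarMeasure : (unitaryHaar d).IsHaarMeasure := by
  unfold unitaryHaar; infer_instance

/-- A right translate of the Haar probability measure is again a Haar probability measure, and on a
compact group there is only one. -/
instance haar_isMulRightInvariant : (unitaryHaar d).IsMulRightInvariant := by
  refine ⟨fun g => ?_⟩
  have : IsProbabilityMeasure ((unitaryHaar d).map (· * g)) :=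
    Measure.isProbabilityMeasure_map (by fun_prop)
  exact Measure.isHaarMeasure_eq_of_isProbabilityMeasure _ _

lemma continuous_conjTwo (X : Matrix (d × d) (d × d) ℂ) (p q : d × d) :
    Continuous fun U : Matrix.unitaryGroup d ℂ => conjTwo (U : Matrix d d ℂ) X p q := by
  have h : ∀ i j, Continuous fun U : Matrix.unitaryGroup d ℂ => (U : Matrix d d ℂ) i j :=
    fun i j => (continuous_subtype_val.matrix_elem i j)
  simp only [conjTwo_apply]
  exact continuous_finsetSum _ fun r _ => continuous_finsetSum _ fun s _ =>
    (((h _ _).mul (h _ _)).mul continuous_const).mul ((h _ _).mul (h _ _)).star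

lemma integrable_conjTwo (X : Matrix (d × d) (d × d) ℂ) (p q : d × d) :
    Integrable (fun U : Matrix.unitaryGroup d ℂ => conjTwo (U : Matrix d d ℂ) X p q)
      (unitaryHaar d) :=
  (continuous_conjTwo X p q).integrable_of_hasCompactSupport (HasCompactSupport.of_compactSpace _)

/-- A family of unitaries whose second-moment twirl maps into the span of the identity and the
flip is a 2-design. -/
theorem isTwoDesign_of_twirl_mem {N : ℕ} {C : Fin N → Matrix d d ℂ} (hN : 0 < N)
    (hC : ∀ i, C i ∈ Matrix.unitaryGroup d ℂ)
    (h : ∀ X, ∃ α β : ℂ, (N : ℂ)⁻¹ • ∑ i, conjTwo (C i) X = α • 1 + β • flipMat d) :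
    IsTwoDesign C := by
  refine ⟨hN, hC, fun X p q => ?_⟩
  obtain ⟨α, β, hX⟩ := h X
  -- The identity and the flip commute with `U ⊗ U`, so the twirled operator is fixed by a further
  -- conjugation. Averaging this over `U` and absorbing each `C i` by right invariance produces the
  -- Haar average.
  have key : ∀ U : Matrix.unitaryGroup d ℂ,
      (N : ℂ)⁻¹ * ∑ i, conjTwo ((U : Matrix d d ℂ) * C i) X p q =
        (N : ℂ)⁻¹ * ∑ i, conjTwo (C i) X p q := by
    intro U
    have h1 : conjTwo (U : Matrix d d ℂ) ((N : ℂ)⁻¹ • ∑ i, conjTwo (C i) X) =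
        (N : ℂ)⁻¹ • ∑ i, conjTwo (C i) X := by
      rw [hX, conjTwo_add, conjTwo_smul, conjTwo_smul, conjTwo_unitary_one U.2,
        conjTwo_unitary_flipMat U.2]
    rw [conjTwo_smul, conjTwo_sum] at h1
    simpa [Matrix.sum_apply, conjTwo_mul] using congrFun (congrFun h1 p) q
  have hint : ∀ i, Integrable (fun U : Matrix.unitaryGroup d ℂ =>
      conjTwo ((U : Matrix d d ℂ) * C i) X p q) (unitaryHaar d) := fun i => by
    simp only [conjTwo_mul]
    exact integrable_conjTwo _ p q
  have hinv : ∀ i, ∫ U : Matrix.unitaryGroup d ℂ, conjTwo ((U : Matrix d d ℂ) * C i) X p q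
      ∂(unitaryHaar d) = ∫ U : Matrix.unitaryGroup d ℂ, conjTwo (U : Matrix d d ℂ) X p q
      ∂(unitaryHaar d) := fun i =>
    integral_mul_right_eq_self (μ := unitaryHaar d)
      (fun U : Matrix.unitaryGroup d ℂ => conjTwo (U : Matrix d d ℂ) X p q) ⟨C i, hC i⟩
  have hN' : (N : ℂ) ≠ 0 := by exact_mod_cast hN.ne'
  calc (N : ℂ)⁻¹ * ∑ i, conjTwo (C i) X p q
      = ∫ U : Matrix.unitaryGroup d ℂ,
          (N : ℂ)⁻¹ * ∑ i, conjTwo ((U : Matrix d d ℂ) * C i) X p q ∂(unitaryHaar d) := by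
        simp only [key, integral_const, probReal_univ, one_smul]
    _ = (N : ℂ)⁻¹ * ∑ i, ∫ U : Matrix.unitaryGroup d ℂ,
          conjTwo ((U : Matrix d d ℂ) * C i) X p q ∂(unitaryHaar d) := by
        rw [integral_const_mul, integral_finsetSum _ fun i _ => hint i]
    _ = ∫ U : Matrix.unitaryGroup d ℂ, conjTwo (U : Matrix d d ℂ) X p q ∂(unitaryHaar d) := by
        simp only [hinv, Finset.sum_const, Finset.card_univ, Fintype.card_fin, nsmul_eq_mul]
        field_simp

/-- Both averages equal the Haar average. The form of the twirl, computed for one explicit family,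
therefore carries over to any 2-design without computing the Haar integral. -/
lemma IsTwoDesign.twirl_mem_of {N N' : ℕ} {C : Fin N → Matrix d d ℂ} {C' : Fin N' → Matrix d d ℂ}
    (hC : IsTwoDesign C) (hC' : IsTwoDesign C')
    (h : ∀ X, ∃ α β : ℂ, (N : ℂ)⁻¹ • ∑ i, conjTwo (C i) X = α • 1 + β • flipMat d)
    (X : Matrix (d × d) (d × d) ℂ) :
    ∃ α β : ℂ, (N' : ℂ)⁻¹ • ∑ i, conjTwo (C' i) X = α • 1 + β • flipMat d := by
  obtain ⟨α, β, hX⟩ := h X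
  refine ⟨α, β, ?_⟩
  rw [← hX]
  ext p q
  simp only [Matrix.smul_apply, Matrix.sum_apply, smul_eq_mul]
  exact (hC'.2.2 X p q).trans (hC.2.2 X p q).symm

end Twirl

end Distill

namespace Distill

/-! ### Bits, signs and the building blocks of the 2-design -/

/-- Bits as elements of the field with two elements. -/
def boolZ : Bool ≃ ZMod 2 where
  toFun b := if b then 1 else 0
  invFun z := decide (z = 1)
  left_inv := by decide
  right_inv := by decide

lemma boolZ_xor (a b : Bool) : boolZ (xor a b) = boolZ a + boolZ b := by
  revert a b; decide

lemma boolZ_and (a b : Bool) : boolZ (a && b) = boolZ a * boolZ b := by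
  revert a b; decide

/-- Bit strings as vectors over the field with two elements. -/
def bitsZ {n : ℕ} : Bits n ≃ (Fin n → ZMod 2) := Equiv.piCongrRight fun _ => boolZ

@[simp] lemma bitsZ_apply {n : ℕ} (x : Bits n) (i : Fin n) : bitsZ x i = boolZ (x i) := rfl

/-- Bitwise sum. -/
def xorBits {n : ℕ} (x y : Bits n) : Bits n := fun i => xor (x i) (y i)

lemma bitsZ_xorBits {n : ℕ} (x y : Bits n) : bitsZ (xorBits x y) = bitsZ x + bitsZ y := by
  ext i; simp [xorBits, boolZ_xor]

/-- The nontrivial character of the field with two elements. -/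
def signZ (z : ZMod 2) : ℂ := if z = 0 then 1 else -1

lemma signZ_add (a b : ZMod 2) : signZ (a + b) = signZ a * signZ b := by
  have h : ∀ a b : ZMod 2, (a + b = 0) = (a = b) := by decide
  have h2 : ∀ a : ZMod 2, a = 0 ∨ a = 1 := by decide
  rcases h2 a with rfl | rfl <;> rcases h2 b with rfl | rfl <;> simp [signZ, h]

lemma signZ_sum {ι : Type*} (s : Finset ι) (f : ι → ZMod 2) :
    signZ (∑ i ∈ s, f i) = ∏ i ∈ s, signZ (f i) := by
  classical
  induction s using Finset.induction_on with
  | empty => simp [signZ]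
  | insert a s ha ih => rw [Finset.sum_insert ha, Finset.prod_insert ha, signZ_add, ih]

lemma star_signZ (a : ZMod 2) : star (signZ a) = signZ a := by
  unfold signZ; split_ifs <;> simp

lemma signZ_mul_self (a : ZMod 2) : signZ a * signZ a = 1 := by
  unfold signZ; split_ifs <;> simp

/-- Coefficients of a quadratic phase function. -/
abbrev Quad (n : ℕ) := (Fin n → ZMod 4) × Matrix (Fin n) (Fin n) (ZMod 2)

/-- The quadratic phase `∏ᵢ i^(sᵢ xᵢ) ∏ᵢⱼ (-1)^(Bᵢⱼ xᵢ xⱼ)`. -/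
def quadPhase {n : ℕ} (Q : Quad n) (x : Bits n) : ℂ :=
  (∏ i, if x i then Complex.I ^ (Q.1 i).val else 1) * signZ (bitsZ x ⬝ᵥ (Q.2 *ᵥ bitsZ x))

lemma I_pow_val_add (a b : ZMod 4) :
    Complex.I ^ (a + b).val = Complex.I ^ a.val * Complex.I ^ b.val := by
  rw [ZMod.val_add, ← pow_add, ← Complex.I_pow_eq_pow_mod]

lemma quadPhase_add {n : ℕ} (Q R : Quad n) (x : Bits n) :
    quadPhase (Q + R) x = quadPhase Q x * quadPhase R x := by
  simp only [quadPhase, Prod.fst_add, Prod.snd_add, Matrix.add_mulVec, dotProduct_add, signZ_add,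
    Pi.add_apply, I_pow_val_add]
  rw [show (∏ i, if x i = true then Complex.I ^ (Q.1 i).val * Complex.I ^ (R.1 i).val else 1) =
    (∏ i, if x i = true then Complex.I ^ (Q.1 i).val else 1) *
    (∏ i, if x i = true then Complex.I ^ (R.1 i).val else 1) by
      rw [← Finset.prod_mul_distrib]
      exact Finset.prod_congr rfl fun i _ => by split_ifs <;> simp]
  ring

lemma quadPhase_mul_star {n : ℕ} (Q : Quad n) (x : Bits n) :
    quadPhase Q x * star (quadPhase Q x) = 1 := by
  have h : (∏ i, if x i = true then Complex.I ^ (Q.1 i).val else 1) *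
      star (∏ i, if x i = true then Complex.I ^ (Q.1 i).val else 1) = 1 := by
    rw [star_prod, ← Finset.prod_mul_distrib]
    refine Finset.prod_eq_one fun i _ => ?_
    split_ifs
    · rw [star_pow, ← mul_pow]; simp
    · simp
  rw [quadPhase, star_mul', star_signZ, mul_mul_mul_comm, h, signZ_mul_self, one_mul]

/-- The diagonal unitary of a quadratic phase. -/
def quadMat {n : ℕ} (Q : Quad n) : Matrix (Bits n) (Bits n) ℂ := Matrix.diagonal (quadPhase Q)

/-- The product of the four phases that a matrix entry acquires under `conjTwo`. -/
def quadRatio {n : ℕ} (p q : Reg n) (Q : Quad n) : ℂ :=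
  quadPhase Q p.1 * quadPhase Q p.2 * star (quadPhase Q q.1 * quadPhase Q q.2)

lemma quadRatio_add {n : ℕ} (p q : Reg n) (Q R : Quad n) :
    quadRatio p q (Q + R) = quadRatio p q Q * quadRatio p q R := by
  simp only [quadRatio, quadPhase_add, star_mul']; ring

lemma conjTwo_quadMat {n : ℕ} (Q : Quad n) (X : Matrix (Reg n) (Reg n) ℂ) (p q : Reg n) :
    conjTwo (quadMat Q) X p q = quadRatio p q Q * X p q := by
  rw [conjTwo_apply, Finset.sum_eq_single p, Finset.sum_eq_single q]
  · simp [quadMat, quadRatio]; ring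
  · rintro ⟨s1, s2⟩ - hs
    have : q.1 ≠ s1 ∨ q.2 ≠ s2 := by
      by_contra! h; exact hs (Prod.ext h.1.symm h.2.symm)
    rcases this with h | h <;> simp [quadMat, Matrix.diagonal_apply_ne _ h]
  · simp
  · rintro ⟨s1, s2⟩ - hs
    have : p.1 ≠ s1 ∨ p.2 ≠ s2 := by
      by_contra! h; exact hs (Prod.ext h.1.symm h.2.symm)
    rcases this with h | h <;> simp [quadMat, Matrix.diagonal_apply_ne _ h]
  · simp

/-- By `quadRatio_add` the ratio is a character of the finite additive group of coefficients; a
nontrivial character sums to zero. -/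
lemma sum_quadRatio_eq_zero {n : ℕ} {p q : Reg n} (R : Quad n) (hR : quadRatio p q R ≠ 1) :
    ∑ Q : Quad n, quadRatio p q Q = 0 := by
  have h : ∑ Q : Quad n, quadRatio p q Q = quadRatio p q R * ∑ Q : Quad n, quadRatio p q Q := by
    conv_lhs => rw [← Equiv.sum_comp (Equiv.addLeft R)]
    simp [quadRatio_add, Finset.mul_sum]
  have h' : (quadRatio p q R - 1) * ∑ Q : Quad n, quadRatio p q Q = 0 := by
    rw [sub_mul, ← h, one_mul, sub_self]
  exact (mul_eq_zero.1 h').resolve_left (sub_ne_zero.2 hR)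

lemma quadRatio_single_left {n : ℕ} (p q : Reg n) (i : Fin n) :
    quadRatio p q (Pi.single i 1, 0) =
      (if p.1 i then Complex.I else 1) * (if p.2 i then Complex.I else 1) *
        star ((if q.1 i then Complex.I else 1) * (if q.2 i then Complex.I else 1)) := by
  have h : ∀ x : Bits n, quadPhase (Pi.single i 1, 0) x = if x i then Complex.I else 1 := by
    intro x
    rw [quadPhase, Finset.prod_eq_single i]
    · simp [signZ, ZMod.val_one'']
    · intro j _ hj; simp [hj]
    · simp
  simp only [quadRatio, h]

lemma quadRatio_single_right {n : ℕ} (p q : Reg n) (i j : Fin n) :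
    quadRatio p q (0, Matrix.single i j 1) =
      signZ (boolZ (p.1 i) * boolZ (p.1 j) + boolZ (p.2 i) * boolZ (p.2 j) +
        boolZ (q.1 i) * boolZ (q.1 j) + boolZ (q.2 i) * boolZ (q.2 j)) := by
  have h : ∀ x : Bits n, quadPhase (0, Matrix.single i j 1) x =
      signZ (boolZ (x i) * boolZ (x j)) := by
    intro x
    simp [quadPhase, Matrix.single_mulVec, dotProduct, Function.update_apply]
  simp only [quadRatio, h, star_mul', star_signZ, signZ_add]; ring

lemma quadRatio_self {n : ℕ} (p : Reg n) (Q : Quad n) : quadRatio p p Q = 1 := by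
  rw [quadRatio, star_mul', mul_mul_mul_comm, quadPhase_mul_star, quadPhase_mul_star, one_mul]

lemma quadRatio_swap {n : ℕ} (p : Reg n) (Q : Quad n) : quadRatio p p.swap Q = 1 := by
  rw [← quadRatio_self p Q]
  simp only [quadRatio, Prod.fst_swap, Prod.snd_swap, star_mul']; ring

/-- If every quadratic phase leaves a matrix entry invariant then the entry relates a pair of labels
to itself or to the swapped pair. -/
lemma eq_or_eq_swap_of_quadRatio {n : ℕ} {p q : Reg n} (h : ∀ Q : Quad n, quadRatio p q Q = 1) :
    q = p ∨ q = p.swap := by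
  -- A single phase gate on qubit `i` contributes `i` to the power `p₁ + p₂ - q₁ - q₂`, which lies
  -- between -2 and 2, so the pair of bits at `i` is preserved up to order.
  have h1 : ∀ i, (q.1 i = p.1 i ∧ q.2 i = p.2 i) ∨ (q.1 i = p.2 i ∧ q.2 i = p.1 i) := by
    intro i
    have := h (Pi.single i 1, 0)
    rw [quadRatio_single_left] at this
    have hI : Complex.I ≠ 1 := fun e => by simpa using congrArg Complex.im e
    have hI' : -Complex.I ≠ 1 := fun e => by simpa using congrArg Complex.im e
    have h3 : (-1 : ℂ) ≠ 1 := by norm_num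
    revert this
    cases p.1 i <;> cases p.2 i <;> cases q.1 i <;> cases q.2 i <;> simp [hI, hI', h3]
  -- The mixed phases link two coordinates, to exclude that some coordinates are swapped and others
  -- are not.
  have h2 : ∀ i j, boolZ (p.1 i) * boolZ (p.1 j) + boolZ (p.2 i) * boolZ (p.2 j) +
      boolZ (q.1 i) * boolZ (q.1 j) + boolZ (q.2 i) * boolZ (q.2 j) = 0 := by
    intro i j
    have := h (0, Matrix.single i j 1)
    rw [quadRatio_single_right, signZ] at this
    by_contra h'
    rw [if_neg h'] at this
    norm_num at this
  by_cases hq : q = p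
  · exact Or.inl hq
  right
  obtain ⟨i, hi⟩ : ∃ i, ¬(q.1 i = p.1 i ∧ q.2 i = p.2 i) := by
    by_contra! h'
    exact hq (Prod.ext (funext fun i => (h' i).1) (funext fun i => (h' i).2))
  -- Once coordinate `i` is properly swapped, every other one must be swapped too; this is a finite
  -- check on the eight bits at `i` and `j`.
  have h3 : ∀ j, q.1 j = p.2 j ∧ q.2 j = p.1 j := by
    intro j
    have hi' := h1 i
    have hj' := h1 j
    have hij := h2 i j
    revert hi hi' hj' hij
    generalize p.1 i = a; generalize p.2 i = b; generalize q.1 i = c; generalize q.2 i = d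
    generalize p.1 j = a'; generalize p.2 j = b'; generalize q.1 j = c'; generalize q.2 j = d'
    revert a b c d a' b' c' d'
    decide
  exact Prod.ext (funext fun i => (h3 i).1) (funext fun i => (h3 i).2)

/-- The part of an operator that relates pairs of labels to themselves or to the swapped pairs. -/
def pairMask {d : Type} [DecidableEq d] (X : Matrix (d × d) (d × d) ℂ) :
    Matrix (d × d) (d × d) ℂ :=
  fun p q => if q = p ∨ q = p.swap then X p q else 0

lemma sum_conjTwo_quadMat {n : ℕ} (X : Matrix (Reg n) (Reg n) ℂ) :
    ∑ Q : Quad n, conjTwo (quadMat Q) X = (Fintype.card (Quad n) : ℂ) • pairMask X := by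
  ext p q
  simp only [Matrix.sum_apply, conjTwo_quadMat, ← Finset.sum_mul, Matrix.smul_apply, pairMask,
    smul_eq_mul]
  split_ifs with h
  · have : ∀ Q : Quad n, quadRatio p q Q = 1 := fun Q => by
      rcases h with rfl | rfl
      · exact quadRatio_self _ _
      · exact quadRatio_swap _ _
    simp [this]
  · have : ∃ R : Quad n, quadRatio p q R ≠ 1 := by
      by_contra! h'; exact h (eq_or_eq_swap_of_quadRatio h')
    obtain ⟨R, hR⟩ := this
    rw [sum_quadRatio_eq_zero R hR]; simp

lemma quadMat_mem_unitaryGroup {n : ℕ} (Q : Quad n) :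
    quadMat Q ∈ Matrix.unitaryGroup (Bits n) ℂ := by
  rw [Matrix.mem_unitaryGroup_iff, Matrix.star_eq_conjTranspose, quadMat,
    Matrix.diagonal_conjTranspose, Matrix.diagonal_mul_diagonal, ← Matrix.diagonal_one]
  congr 1
  ext x
  exact quadPhase_mul_star Q x

end Distill

namespace Distill

/-! ### The Hadamard layer -/

/-- The entries of the Hadamard matrix. -/
noncomputable def hadEntry (y x : Bool) : ℂ :=
  (if x = true ∧ y = true then -1 else 1) * ((Real.sqrt 2 : ℝ) : ℂ)⁻¹

/-- The Hadamard gate on every qubit. -/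
noncomputable def hadMat (n : ℕ) : Matrix (Bits n) (Bits n) ℂ :=
  fun y x => ∏ i, hadEntry (y i) (x i)

lemma inv_sqrt_two_mul_self : ((Real.sqrt 2 : ℝ) : ℂ)⁻¹ * ((Real.sqrt 2 : ℝ) : ℂ)⁻¹ = 2⁻¹ := by
  rw [← mul_inv, ← Complex.ofReal_mul, Real.mul_self_sqrt (by norm_num)]; simp

lemma star_hadEntry (y x : Bool) : star (hadEntry y x) = hadEntry y x := by
  unfold hadEntry
  cases x <;> cases y <;> simp

lemma hadEntry_mul_self (y x : Bool) : hadEntry y x * hadEntry y x = 2⁻¹ := by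
  unfold hadEntry
  rw [mul_mul_mul_comm, inv_sqrt_two_mul_self]
  split_ifs <;> simp

lemma star_hadMat {n : ℕ} (y x : Bits n) : star (hadMat n y x) = hadMat n y x := by
  simp only [hadMat, star_prod, star_hadEntry]

lemma hadMat_mul_self_apply {n : ℕ} (y x : Bits n) :
    hadMat n y x * hadMat n y x = ((2 : ℂ) ^ n)⁻¹ := by
  simp [hadMat, ← Finset.prod_mul_distrib, hadEntry_mul_self]

lemma sum_hadEntry (a b : Bool) :
    ∑ c, hadEntry a c * hadEntry b c = if a = b then 1 else 0 := by
  rw [Fintype.sum_bool]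
  rcases eq_or_ne a b with rfl | h
  · rw [hadEntry_mul_self, hadEntry_mul_self]; norm_num
  · revert h; cases a <;> cases b <;> simp [hadEntry]

lemma hadMat_mem_unitaryGroup (n : ℕ) : hadMat n ∈ Matrix.unitaryGroup (Bits n) ℂ := by
  rw [Matrix.mem_unitaryGroup_iff]
  ext y x
  simp only [Matrix.mul_apply, Matrix.star_apply, star_hadMat]
  simp only [hadMat, ← Finset.prod_mul_distrib]
  rw [← Fintype.prod_sum fun i c => hadEntry (y i) c * hadEntry (x i) c]
  simp only [sum_hadEntry, Matrix.one_apply, Finset.prod_ite_zero, Finset.prod_const_one,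
    Finset.mem_univ, true_imp_iff, funext_iff]

lemma hadEntry_xor (y b x : Bool) :
    hadEntry (xor y b) x = signZ (boolZ b * boolZ x) * hadEntry y x := by
  cases y <;> cases b <;> cases x <;> simp [hadEntry, signZ, boolZ]

lemma hadMat_xorBits {n : ℕ} (y b x : Bits n) :
    hadMat n (xorBits y b) x = signZ (bitsZ b ⬝ᵥ bitsZ x) * hadMat n y x := by
  rw [dotProduct, signZ_sum, hadMat, hadMat, ← Finset.prod_mul_distrib]
  exact Finset.prod_congr rfl fun i _ => hadEntry_xor _ _ _

/-- A shift by `b` multiplies the Hadamard entries by signs `(-1)^(b·r)`. On masked entries the four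
labels coincide in pairs, so the signs cancel. -/
lemma conjTwo_hadMat_xorBits {n : ℕ} (X : Matrix (Reg n) (Reg n) ℂ) (b : Bits n) (p q : Reg n) :
    conjTwo (hadMat n) (pairMask X) (xorBits p.1 b, xorBits p.2 b) (xorBits q.1 b, xorBits q.2 b) =
      conjTwo (hadMat n) (pairMask X) p q := by
  simp only [conjTwo_apply]
  refine Finset.sum_congr rfl fun r _ => Finset.sum_congr rfl fun s _ => ?_
  simp only [hadMat_xorBits, star_mul', star_signZ]
  by_cases h : s = r ∨ s = r.swap
  · have hs : signZ (bitsZ b ⬝ᵥ bitsZ r.1) * signZ (bitsZ b ⬝ᵥ bitsZ r.2) *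
        (signZ (bitsZ b ⬝ᵥ bitsZ s.1) * signZ (bitsZ b ⬝ᵥ bitsZ s.2)) = 1 := by
      have h1 := signZ_mul_self (bitsZ b ⬝ᵥ bitsZ r.1)
      have h2 := signZ_mul_self (bitsZ b ⬝ᵥ bitsZ r.2)
      rcases h with rfl | rfl
      · linear_combination signZ (bitsZ b ⬝ᵥ bitsZ s.2) * signZ (bitsZ b ⬝ᵥ bitsZ s.2) * h1 + h2
      · simp only [Prod.fst_swap, Prod.snd_swap]
        linear_combination signZ (bitsZ b ⬝ᵥ bitsZ r.2) * signZ (bitsZ b ⬝ᵥ bitsZ r.2) * h1 + h2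
    linear_combination (hadMat n p.1 r.1 * hadMat n p.2 r.2 * pairMask X r s *
      (star (hadMat n q.1 s.1) * star (hadMat n q.2 s.2))) * hs
  · simp [pairMask, h]

lemma pairMask_add {d : Type} [DecidableEq d] (X Y : Matrix (d × d) (d × d) ℂ) :
    pairMask (X + Y) = pairMask X + pairMask Y := by
  ext p q; simp only [pairMask, Matrix.add_apply]; split_ifs <;> simp

lemma pairMask_smul {d : Type} [DecidableEq d] (c : ℂ) (X : Matrix (d × d) (d × d) ℂ) :
    pairMask (c • X) = c • pairMask X := by
  ext p q; simp only [pairMask, Matrix.smul_apply]; split_ifs <;> simp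

lemma pairMask_one {d : Type} [DecidableEq d] :
    pairMask (1 : Matrix (d × d) (d × d) ℂ) = 1 := by
  ext p q
  simp only [pairMask, Matrix.one_apply]
  grind

lemma pairMask_flipMat {d : Type} [DecidableEq d] : pairMask (flipMat d) = flipMat d := by
  ext p q
  simp only [pairMask, flipMat]
  grind

/-- Hadamard entries are `±2^(-n/2)`. At retained positions their signs pair up, so `2^n` terms
equal to `2^(-2n)` add up to `2^(-n)`. The set of retained positions is that of the identity and the
flip, which overlap in the diagonal projector. -/
lemma pairMask_conjTwo_hadMat_diagMat (n : ℕ) :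
    pairMask (conjTwo (hadMat n) (diagMat (Bits n))) =
      ((2 : ℂ) ^ n)⁻¹ • (1 + flipMat (Bits n) - diagMat (Bits n)) := by
  have key : ∀ p q : Reg n, conjTwo (hadMat n) (diagMat (Bits n)) p q =
      ∑ x, hadMat n p.1 x * hadMat n p.2 x * (hadMat n q.1 x * hadMat n q.2 x) := by
    intro p q
    simp only [conjTwo_apply, diagMat, star_mul', star_hadMat]
    rw [Fintype.sum_prod_type]
    refine Finset.sum_congr rfl fun x _ => ?_
    rw [Finset.sum_eq_single x, Finset.sum_eq_single (x, x)]
    · simp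
    · intro b _ hb; simp [hb]
    · simp
    · intro y _ hy
      refine Finset.sum_eq_zero fun s _ => ?_
      simp [hy.symm]
    · simp
  have hc : (Fintype.card (Bits n) : ℂ) = 2 ^ n := by simp
  have hval : ∀ p q : Reg n, q = p ∨ q = p.swap →
      conjTwo (hadMat n) (diagMat (Bits n)) p q = ((2 : ℂ) ^ n)⁻¹ := by
    intro p q h
    rw [key]
    have : ∀ x, hadMat n p.1 x * hadMat n p.2 x * (hadMat n q.1 x * hadMat n q.2 x) =
        ((2 : ℂ) ^ n)⁻¹ * ((2 : ℂ) ^ n)⁻¹ := by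
      intro x
      have e1 := hadMat_mul_self_apply p.1 x
      have e2 := hadMat_mul_self_apply p.2 x
      have e3 : hadMat n q.1 x * hadMat n q.2 x = hadMat n p.1 x * hadMat n p.2 x := by
        rcases h with rfl | rfl
        · rfl
        · exact mul_comm _ _
      rw [e3]
      linear_combination hadMat n p.2 x * hadMat n p.2 x * e1 + ((2 : ℂ) ^ n)⁻¹ * e2
    simp only [this, Finset.sum_const, Finset.card_univ, nsmul_eq_mul, hc]
    field_simp
  ext p q
  simp only [pairMask, Matrix.smul_apply, Matrix.sub_apply, Matrix.add_apply, Matrix.one_apply,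
    flipMat, diagMat, smul_eq_mul]
  have hsw : p = p.swap ↔ p.1 = p.2 :=
    ⟨fun h => congrArg Prod.fst h, fun h => Prod.ext h h.symm⟩
  by_cases h1 : q = p
  · subst h1
    rw [if_pos (Or.inl rfl), hval _ _ (Or.inl rfl)]
    simp only [hsw, true_and, if_true]
    ring
  · by_cases h2 : q = p.swap
    · rw [if_pos (Or.inr h2), hval _ _ (Or.inr h2)]
      have h3 : ¬ p.1 = p.2 := fun h => h1 (h2.trans (hsw.2 h).symm)
      simp [h2, h3, hsw]
    · simp [h1, h2, Ne.symm h1]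

/-! ### Permutation layers -/

/-- The unitary of a permutation of labels. -/
def permMat {d : Type} [DecidableEq d] (g : Equiv.Perm d) : Matrix d d ℂ :=
  fun y x => if y = g x then 1 else 0

lemma conjTwo_permMat {d : Type} [Fintype d] [DecidableEq d] (g : Equiv.Perm d)
    (X : Matrix (d × d) (d × d) ℂ) (p q : d × d) :
    conjTwo (permMat g) X p q = X (g.symm p.1, g.symm p.2) (g.symm q.1, g.symm q.2) := by
  have h : ∀ y x, permMat g y x = if x = g.symm y then 1 else 0 := by
    intro y x; simp only [permMat, Equiv.eq_symm_apply, eq_comm]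
  rw [conjTwo_apply, Finset.sum_eq_single (g.symm p.1, g.symm p.2),
    Finset.sum_eq_single (g.symm q.1, g.symm q.2)]
  · simp [h]
  · rintro ⟨s1, s2⟩ - hs
    rw [Ne, Prod.mk.injEq, not_and_or] at hs
    rcases hs with hs | hs <;> simp [h, hs]
  · simp
  · rintro ⟨s1, s2⟩ - hs
    rw [Ne, Prod.mk.injEq, not_and_or] at hs
    rcases hs with hs | hs <;> simp [h, hs]
  · simp

lemma permMat_mem_unitaryGroup {d : Type} [Fintype d] [DecidableEq d] (g : Equiv.Perm d) :
    permMat g ∈ Matrix.unitaryGroup d ℂ := by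
  rw [Matrix.mem_unitaryGroup_iff']
  ext y x
  simp [Matrix.mul_apply, permMat, Matrix.star_apply, Matrix.one_apply, eq_comm]

end Distill

namespace Distill

/-! ### Multiplications of a field with `2 ^ n` elements -/

/-- A permutation of bit strings given by an invertible matrix over the field with two elements. -/
def IsLinearPerm {n : ℕ} (g : Equiv.Perm (Bits n)) : Prop :=
  ∃ M M' : Matrix (Fin n) (Fin n) (ZMod 2), M' * M = 1 ∧ ∀ x, bitsZ (g x) = M *ᵥ bitsZ x

lemma IsLinearPerm.symm_xorBits {n : ℕ} {g : Equiv.Perm (Bits n)} (hg : IsLinearPerm g)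
    (x y : Bits n) : g.symm (xorBits x y) = xorBits (g.symm x) (g.symm y) := by
  obtain ⟨M, M', -, h⟩ := hg
  rw [Equiv.symm_apply_eq]
  apply bitsZ.injective
  rw [h, bitsZ_xorBits, bitsZ_xorBits, Matrix.mulVec_add, ← h, ← h, Equiv.apply_symm_apply,
    Equiv.apply_symm_apply]

/-- The bit string of zeros. -/
def zeroBits (n : ℕ) : Bits n := fun _ => false

lemma bitsZ_eq_zero_iff {n : ℕ} (x : Bits n) : bitsZ x = 0 ↔ x = zeroBits n := by
  rw [show (0 : Fin n → ZMod 2) = bitsZ (zeroBits n) from rfl, bitsZ.injective.eq_iff]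

/-- Multiplication by a nonzero element of the field with `2^n` elements is linear over the prime
field, and these maps act simply transitively on the nonzero vectors. -/
lemma exists_uniform_linearPerm {n : ℕ} (hn : n ≠ 0) :
    ∃ (K : Type) (_ : Fintype K) (_ : Nonempty K) (g : K → Equiv.Perm (Bits n)),
      (∀ k, IsLinearPerm (g k)) ∧
      ∀ (φ : Bits n → ℂ) (z z' : Bits n), z ≠ zeroBits n → z' ≠ zeroBits n →
        ∑ k, φ ((g k).symm z) = ∑ k, φ ((g k).symm z') := by
  classical
  let F := GaloisField 2 n
  have : Fintype F := Fintype.ofFinite F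
  have e : F ≃ₗ[ZMod 2] (Fin n → ZMod 2) :=
    (Module.finBasisOfFinrankEq (ZMod 2) F (GaloisField.finrank 2 hn)).equivFun
  let E : Bits n ≃ F := bitsZ.trans e.symm.toEquiv
  have hE : ∀ x, E x = 0 ↔ x = zeroBits n := fun x => by
    rw [← bitsZ_eq_zero_iff]; simp [E]
  let T : F → (Fin n → ZMod 2) →ₗ[ZMod 2] (Fin n → ZMod 2) := fun α =>
    e.toLinearMap ∘ₗ LinearMap.mulLeft (ZMod 2) α ∘ₗ e.symm.toLinearMap
  refine ⟨Fˣ, inferInstance, inferInstance, fun α => (E.trans (Units.mulLeft α)).trans E.symm,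
    fun α => ⟨LinearMap.toMatrix' (T α), LinearMap.toMatrix' (T (α⁻¹ : Fˣ)), ?_, ?_⟩, ?_⟩
  · rw [← LinearMap.toMatrix'_comp, ← LinearMap.toMatrix'_id]
    congr 1
    refine LinearMap.ext fun x => ?_
    simp [T]
  · intro x
    rw [← Matrix.toLin'_apply, Matrix.toLin'_toMatrix']
    simp [E, T]
  · intro φ z z' hz hz'
    have h0 : E z ≠ 0 := fun h => hz ((hE z).1 h)
    have h0' : E z' ≠ 0 := fun h => hz' ((hE z').1 h)
    -- Replacing `α` by `γ * α` with `γ = z / z'` turns the sum for `z` into the one for `z'`.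
    let γ : Fˣ := Units.mk0 _ h0 * (Units.mk0 _ h0')⁻¹
    rw [← Equiv.sum_comp (Equiv.mulLeft γ)]
    refine Finset.sum_congr rfl fun α _ => ?_
    congr 1
    simp only [Equiv.symm_trans_apply, Equiv.symm_symm, Equiv.coe_mulLeft]
    congr 1
    have h1 : E z ≠ 0 := h0
    simp only [γ, Units.val_mul, Units.val_inv_eq_inv_val, mul_inv_rev, mul_assoc, Units.val_mk0,
      Units.val_inv_eq_inv_val, Units.mulLeft_symm, Units.mulLeft_apply, inv_inv, inv_mul_cancel₀ h1]
    simp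

/-! ### The 2-design -/

/-- Averaging a masked, translation invariant operator over a uniform family of linear permutations
leaves only three parameters. -/
lemma sum_conjTwo_permMat {n : ℕ} {K : Type} [Fintype K] [Nonempty K]
    {g : K → Equiv.Perm (Bits n)} (hg : ∀ k, IsLinearPerm (g k))
    (hu : ∀ (φ : Bits n → ℂ) (z z' : Bits n), z ≠ zeroBits n → z' ≠ zeroBits n →
        ∑ k, φ ((g k).symm z) = ∑ k, φ ((g k).symm z'))
    (Y : Matrix (Reg n) (Reg n) ℂ) (hm : pairMask Y = Y)
    (ht : ∀ b p q, Y (xorBits p.1 b, xorBits p.2 b) (xorBits q.1 b, xorBits q.2 b) = Y p q) :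
    ∃ a b c : ℂ, ∑ k, conjTwo (permMat (g k)) Y =
      a • diagMat (Bits n) + b • 1 + c • flipMat (Bits n) := by
  set o := zeroBits n
  have hxor : ∀ x y : Bits n, xorBits (xorBits x y) x = y := fun x y => by
    ext i
    simp only [xorBits]
    cases x i <;> cases y i <;> rfl
  have hself : ∀ x : Bits n, xorBits x x = o := fun x => by
    ext i; simp [xorBits, o, zeroBits]
  have hg0 : ∀ k, (g k).symm o = o := fun k => by
    rw [← hself o, (hg k).symm_xorBits, hself, hself]
  have hne : ∀ x y : Bits n, x ≠ y → xorBits y x ≠ o := fun x y h h' => h <| by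
    have := hxor y x
    ext i
    have := congrFun h' i
    simp [xorBits, o, zeroBits] at this
    exact this.symm
  -- Translation by `p.1` leaves only the difference of the two labels, on which the linear
  -- permutations act transitively away from zero.
  have hd : ∀ p : Reg n, Y p p = Y (o, xorBits p.2 p.1) (o, xorBits p.2 p.1) := fun p => by
    rw [← ht p.1 p p, hself]
  have hc : ∀ p : Reg n, Y p p.swap = Y (o, xorBits p.2 p.1) (xorBits p.2 p.1, o) := fun p => by
    rw [← ht p.1 p p.swap, hself, Prod.fst_swap, Prod.snd_swap, hself]
  have hout : ∀ p q : Reg n, ¬ (q = p ∨ q = p.swap) → Y p q = 0 := fun p q h => by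
    rw [← hm]; simp [pairMask, h]
  have hsw : ∀ p : Reg n, p = p.swap ↔ p.1 = p.2 := fun p =>
    ⟨fun h => congrArg Prod.fst h, fun h => Prod.ext h h.symm⟩
  obtain ⟨b, hb⟩ : ∃ b, ∀ z, z ≠ o → ∑ k, Y (o, (g k).symm z) (o, (g k).symm z) = b := by
    by_cases h : ∃ z, z ≠ o
    · obtain ⟨z, hz⟩ := h
      exact ⟨_, fun z' hz' => hu (fun z => Y (o, z) (o, z)) z' z hz' hz⟩
    · push Not at h
      exact ⟨0, fun z hz => absurd (h z) hz⟩
  obtain ⟨c, hcc⟩ : ∃ c, ∀ z, z ≠ o → ∑ k, Y (o, (g k).symm z) ((g k).symm z, o) = c := by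
    by_cases h : ∃ z, z ≠ o
    · obtain ⟨z, hz⟩ := h
      exact ⟨_, fun z' hz' => hu (fun z => Y (o, z) (z, o)) z' z hz' hz⟩
    · push Not at h
      exact ⟨0, fun z hz => absurd (h z) hz⟩
  -- Where the two labels agree, the identity and the flip contribute as well; their coefficients
  -- are subtracted from that of the diagonal projector.
  refine ⟨∑ _k : K, Y (o, o) (o, o) - b - c, b, c, ?_⟩
  ext ⟨p1, p2⟩ q
  simp only [Matrix.sum_apply, conjTwo_permMat, Matrix.add_apply, Matrix.smul_apply, diagMat,
    Matrix.one_apply, flipMat, smul_eq_mul]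
  by_cases h1 : q = (p1, p2)
  · subst h1
    have := fun k => hd ((g k).symm p1, (g k).symm p2)
    simp only [← (hg _).symm_xorBits] at this
    simp only [this]
    by_cases h2 : p1 = p2
    · subst h2
      simp [hself, hg0]
      ring
    · rw [hb _ (hne _ _ h2)]
      simp [h2]
  · by_cases h2 : q = (p2, p1)
    · subst h2
      have h3 : p1 ≠ p2 := fun h => h1 (by rw [h])
      have := fun k => hc ((g k).symm p1, (g k).symm p2)
      simp only [Prod.swap_prod_mk, ← (hg _).symm_xorBits] at this
      simp only [this, hcc _ (hne _ _ h3)]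
      simp [h3]
    · rw [Finset.sum_eq_zero]
      · simp [h1, h2, Ne.symm h1]
      · intro k _
        refine hout _ _ ?_
        rintro (h | h)
        · exact h1 (Prod.ext (by simpa using congrArg Prod.fst h)
            (by simpa using congrArg Prod.snd h))
        · exact h2 (Prod.ext (by simpa using congrArg Prod.fst h)
            (by simpa using congrArg Prod.snd h))

/-- The unitaries of the 2-design. -/
noncomputable def designMat {n : ℕ} (i : Fin (2 ^ n + 1)) (R : Quad n) (g : Equiv.Perm (Bits n))
    (Q Q' : Quad n) : Matrix (Bits n) (Bits n) ℂ :=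
  (if i = 0 then 1 else quadMat R * hadMat n) *
    (permMat g * (quadMat Q * (hadMat n * quadMat Q')))

lemma designMat_mem_unitaryGroup {n : ℕ} (i : Fin (2 ^ n + 1)) (R : Quad n)
    (g : Equiv.Perm (Bits n)) (Q Q' : Quad n) :
    designMat i R g Q Q' ∈ Matrix.unitaryGroup (Bits n) ℂ := by
  refine mul_mem ?_ (mul_mem (permMat_mem_unitaryGroup g) (mul_mem (quadMat_mem_unitaryGroup _)
    (mul_mem (hadMat_mem_unitaryGroup n) (quadMat_mem_unitaryGroup _))))
  split_ifs
  · exact one_mem _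
  · exact mul_mem (quadMat_mem_unitaryGroup _) (hadMat_mem_unitaryGroup n)

/-- The product acts from the right: `Q'` masks, the Hadamard layer yields translation invariance,
`Q` masks again and the permutations leave `Z = x • diag + y • 1 + z • flip`. Index `i = 0` keeps
`Z`, while each of the other `2^n` indices turns `diag` into `2^(-n) • (1 + flip - diag)`. Their sum
is free of `diag`, which explains the number `2^n + 1`. -/
lemma sum_conjTwo_designMat {n : ℕ} {K : Type} [Fintype K] [Nonempty K]
    {g : K → Equiv.Perm (Bits n)} (hg : ∀ k, IsLinearPerm (g k))
    (hu : ∀ (φ : Bits n → ℂ) (z z' : Bits n), z ≠ zeroBits n → z' ≠ zeroBits n →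
        ∑ k, φ ((g k).symm z) = ∑ k, φ ((g k).symm z'))
    (X : Matrix (Reg n) (Reg n) ℂ) :
    ∃ α β : ℂ, ∑ i, ∑ R, ∑ k, ∑ Q, ∑ Q', conjTwo (designMat i R (g k) Q Q') X =
      α • 1 + β • flipMat (Bits n) := by
  set c : ℂ := (Fintype.card (Quad n) : ℂ)
  set Y := pairMask (conjTwo (hadMat n) (pairMask X))
  have hY : pairMask Y = Y := by
    ext p q; simp only [Y, pairMask]; split_ifs <;> rfl
  obtain ⟨x, y, z, hxyz⟩ := sum_conjTwo_permMat hg hu Y hY (by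
    intro b p q
    have hinj : Function.Injective fun x => xorBits x b := fun x y h => by
      ext i; simpa [xorBits] using congrFun h i
    have e1 : ((xorBits q.1 b, xorBits q.2 b) = (xorBits p.1 b, xorBits p.2 b)) = (q = p) := by
      rw [Prod.mk.injEq, hinj.eq_iff, hinj.eq_iff, Prod.ext_iff]
    have e2 : ((xorBits q.1 b, xorBits q.2 b) = (xorBits p.1 b, xorBits p.2 b).swap) =
        (q = p.swap) := by
      rw [Prod.swap_prod_mk, Prod.mk.injEq, hinj.eq_iff, hinj.eq_iff, Prod.ext_iff]
      rfl
    simp only [Y, pairMask.eq_1 (conjTwo _ _), e1, e2, conjTwo_hadMat_xorBits])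
  set Z := x • diagMat (Bits n) + y • 1 + z • flipMat (Bits n)
  have inner : ∀ V : Matrix (Bits n) (Bits n) ℂ,
      ∑ k, ∑ Q, ∑ Q', conjTwo (V * (permMat (g k) * (quadMat Q * (hadMat n * quadMat Q')))) X =
        (c * c) • conjTwo V Z := by
    intro V
    rw [← hxyz, conjTwo_sum, Finset.smul_sum]
    refine Finset.sum_congr rfl fun k _ => ?_
    simp only [conjTwo_mul, ← conjTwo_sum, sum_conjTwo_quadMat]
    simp only [conjTwo_smul, pairMask_smul, smul_smul, Y, c]
  have outer : ∑ R, conjTwo (quadMat R * hadMat n) Z =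
      c • (x • ((2 : ℂ) ^ n)⁻¹ • (1 + flipMat (Bits n) - diagMat (Bits n)) + y • 1 +
        z • flipMat (Bits n)) := by
    have hH := hadMat_mem_unitaryGroup n
    simp only [conjTwo_mul, sum_conjTwo_quadMat]
    simp only [Z, conjTwo_add, conjTwo_smul,
      conjTwo_unitary_one hH, conjTwo_unitary_flipMat hH, pairMask_add, pairMask_smul,
      pairMask_conjTwo_hadMat_diagMat, pairMask_one, pairMask_flipMat, c]
  -- Two factors `c` come from `Q` and `Q'`, the third from `R`, which is summed over even for `i =
  -- 0` where it is idle.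
  refine ⟨c * c * c * (x + (2 ^ n + 1) * y), c * c * c * (x + (2 ^ n + 1) * z), ?_⟩
  simp only [designMat, inner, ← Finset.smul_sum]
  rw [Fin.sum_univ_succ]
  simp only [if_true, Fin.succ_ne_zero, if_false, outer, conjTwo_one, Finset.sum_const,
    Finset.card_univ, Fintype.card_fin]
  have h2 : ((2 : ℂ) ^ n) * ((2 : ℂ) ^ n)⁻¹ = 1 := mul_inv_cancel₀ (by positivity)
  ext p q
  simp only [Z, Matrix.add_apply, Matrix.smul_apply, Matrix.sub_apply, smul_eq_mul,
    ← Nat.cast_smul_eq_nsmul ℂ, Nat.cast_pow, Nat.cast_ofNat]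
  simp only [show (Fintype.card (Quad n) : ℂ) = c from rfl]
  linear_combination (c * c * c * x * ((1 : Matrix (Reg n) (Reg n) ℂ) p q +
    flipMat (Bits n) p q - diagMat (Bits n) p q)) * h2

end Distill

namespace Distill

/-! ### Circuits on registers -/

/-- Computational basis vectors. -/
def ket {q : ℕ} (x : Bits q) : Bits q → ℂ := Pi.single x 1

lemma foldl_gates {q : ℕ} (l : List (Gate q)) (U : Matrix (Bits q) (Bits q) ℂ) :
    l.foldl (fun U g => g.mat * U) U = gatesMat l * U := by
  induction l using List.reverseRecOn with
  | nil => simp [gatesMat]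
  | append_singleton l g ih => simp [gatesMat, List.foldl_append, ih, Matrix.mul_assoc]

@[simp] lemma gatesMat_nil {q : ℕ} : gatesMat ([] : List (Gate q)) = 1 := rfl

lemma gatesMat_cons {q : ℕ} (g : Gate q) (l : List (Gate q)) :
    gatesMat (g :: l) = gatesMat l * g.mat := by
  rw [gatesMat, List.foldl_cons, Matrix.mul_one, foldl_gates]

lemma gatesMat_append {q : ℕ} (l l' : List (Gate q)) :
    gatesMat (l ++ l') = gatesMat l' * gatesMat l := by
  rw [gatesMat, List.foldl_append, foldl_gates]; rfl

lemma cnot_mulVec_ket {q : ℕ} (i j : Fin q) (h : i ≠ j) (x : Bits q) :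
    (Gate.cnot i j h).mat *ᵥ ket x = ket (Function.update x j (xor (x j) (x i))) := by
  ext y
  rw [ket, Matrix.mulVec_single_one, Matrix.col_apply]
  simp [Gate.mat, ket, Pi.single_apply]

lemma diagonal_mulVec_ket {q : ℕ} (v : Bits q → ℂ) (x : Bits q) :
    Matrix.diagonal v *ᵥ ket x = v x • ket x := by
  ext y
  rw [Matrix.mulVec_diagonal]
  by_cases h : y = x
  · subst h; simp [ket]
  · simp [ket, h]

variable {ι : Type} {q : ℕ}

/-- A sequence of time steps in which gates of one step act on disjoint qubits. -/
def StepsDisjoint (steps : List (List (Gate q))) : Prop :=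
  ∀ s ∈ steps, s.Pairwise fun g h => Disjoint g.support h.support

lemma StepsDisjoint.append {l l' : List (List (Gate q))} (h : StepsDisjoint l)
    (h' : StepsDisjoint l') : StepsDisjoint (l ++ l') := fun s hs =>
  (List.mem_append.1 hs).elim (h s) (h' s)

/-- A circuit of depth `d` on a register maps the basis state `x` to `ph x` times the basis state
`F x`. -/
def Implements (e : ι ≃ Fin q) (d : ℕ) (F : (ι → Bool) → ι → Bool) (ph : (ι → Bool) → ℂ) : Prop :=
  ∃ steps : List (List (Gate q)), steps.length = d ∧ StepsDisjoint steps ∧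
    ∀ x, gatesMat steps.flatten *ᵥ ket (x ∘ e.symm) = ph x • ket (F x ∘ e.symm)

lemma Implements.comp {e : ι ≃ Fin q} {d d' : ℕ} {F F' : (ι → Bool) → ι → Bool}
    {ph ph' : (ι → Bool) → ℂ} (h' : Implements e d' F' ph') (h : Implements e d F ph) :
    Implements e (d + d') (F' ∘ F) (fun x => ph x * ph' (F x)) := by
  obtain ⟨l, hl, hd, h⟩ := h
  obtain ⟨l', hl', hd', h'⟩ := h'
  refine ⟨l ++ l', by simp [hl, hl'], hd.append hd', fun x => ?_⟩
  rw [List.flatten_append, gatesMat_append, ← Matrix.mulVec_mulVec, h, Matrix.mulVec_smul, h',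
    smul_smul, Function.comp_apply]

lemma implements_id (e : ι ≃ Fin q) : Implements e 0 id fun _ => 1 :=
  ⟨[], rfl, fun s hs => by simp at hs, fun x => by simp⟩

/-- Injectivity of `Sum.elim src tgt` says that controls and targets are all distinct. The gates
then fit in one time step, and no control is altered, so they may be applied in any order. -/
lemma implements_cnotLayer (e : ι ≃ Fin q) {K : Type} [Fintype K] (src tgt : K → ι)
    (hinj : Function.Injective (Sum.elim src tgt)) (F : (ι → Bool) → ι → Bool)
    (hF : ∀ x k, F x (tgt k) = xor (x (tgt k)) (x (src k)))
    (hF' : ∀ x i, (∀ k, tgt k ≠ i) → F x i = x i) :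
    Implements e 1 F fun _ => 1 := by
  classical
  have hst : ∀ k k', src k ≠ tgt k' := fun k k' h => by
    simpa using hinj (a₁ := Sum.inl k) (a₂ := Sum.inr k') h
  have htt : ∀ k k', tgt k = tgt k' → k = k' := fun k k' h => by
    simpa using hinj (a₁ := Sum.inr k) (a₂ := Sum.inr k') h
  have hss : ∀ k k', src k = src k' → k = k' := fun k k' h => by
    simpa using hinj (a₁ := Sum.inl k) (a₂ := Sum.inl k') h
  let gate : K → Gate q := fun k => .cnot (e (src k)) (e (tgt k)) (by simpa using hst k k)
  have main : ∀ (l : List K), l.Nodup → ∀ x y : ι → Bool,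
      (∀ k ∈ l, y (tgt k) = xor (x (tgt k)) (x (src k))) →
      (∀ i, (∀ k ∈ l, tgt k ≠ i) → y i = x i) →
      gatesMat (l.map gate) *ᵥ ket (x ∘ e.symm) = ket (y ∘ e.symm) := by
    intro l
    induction l with
    | nil =>
      intro _ x y _ h
      have : y = x := funext fun i => h i (by simp)
      simp [this]
    | cons k l ih =>
      intro hl x y h1 h2
      rw [List.nodup_cons] at hl
      rw [List.map_cons, gatesMat_cons, ← Matrix.mulVec_mulVec, cnot_mulVec_ket]
      have hupd : Function.update (x ∘ e.symm) (e (tgt k))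
          (xor ((x ∘ e.symm) (e (tgt k))) ((x ∘ e.symm) (e (src k)))) =
          Function.update x (tgt k) (xor (x (tgt k)) (x (src k))) ∘ e.symm := by
        funext j
        obtain ⟨i, rfl⟩ := e.surjective j
        by_cases hi : i = tgt k
        · subst hi; simp
        · simp [hi]
      rw [hupd]
      refine ih hl.2 _ _ (fun k' hk' => ?_) (fun i hi => ?_)
      · have hne : tgt k' ≠ tgt k := fun h => hl.1 (htt _ _ h ▸ hk')
        rw [Function.update_of_ne hne, Function.update_of_ne (hst k' k), h1 k' (by simp [hk'])]
      · by_cases hik : i = tgt k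
        · subst hik
          rw [Function.update_self, h1 k (by simp)]
        · rw [Function.update_of_ne hik]
          refine h2 i fun k' hk' => ?_
          rcases List.mem_cons.1 hk' with rfl | hk'
          · exact fun h => hik h.symm
          · exact hi k' hk'
  refine ⟨[Finset.univ.toList.map gate], rfl, ?_, fun x => ?_⟩
  · intro s hs
    rw [List.mem_singleton] at hs
    subst hs
    rw [List.pairwise_map]
    refine (Finset.nodup_toList _).imp fun {k k'} hkk => ?_
    have h1 := hst k k'
    have h2 := hst k' k
    have h3 : src k ≠ src k' := fun h => hkk (hss _ _ h)
    have h4 : tgt k ≠ tgt k' := fun h => hkk (htt _ _ h)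
    simp [gate, Gate.support, h1.symm, h2, h3.symm, h4.symm]
  · rw [List.flatten_singleton, one_smul]
    exact main _ (Finset.nodup_toList _) x _ (fun k _ => hF x k)
      (fun i hi => hF' x i fun k => hi k (by simp))

lemma implements_phaseLayer (e : ι ≃ Fin q) {K : Type} [Fintype K] (pos : K → ι)
    (hinj : Function.Injective pos) (c : ℂ) (gate : Fin q → Gate q)
    (hs : ∀ i, (gate i).support = {i})
    (hm : ∀ i, (gate i).mat = Matrix.diagonal fun x => if x i = true then c else 1) :
    Implements e 1 id fun x => ∏ k, if x (pos k) = true then c else 1 := by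
  have main : ∀ (l : List K) (x : ι → Bool),
      gatesMat (l.map fun k => gate (e (pos k))) *ᵥ ket (x ∘ e.symm) =
        (l.map fun k => if x (pos k) = true then c else 1).prod • ket (x ∘ e.symm) := by
    intro l x
    induction l with
    | nil => simp
    | cons k l ih =>
      rw [List.map_cons, gatesMat_cons, ← Matrix.mulVec_mulVec, hm, diagonal_mulVec_ket,
        Matrix.mulVec_smul, ih, smul_smul]
      simp
  refine ⟨[Finset.univ.toList.map fun k => gate (e (pos k))], rfl, ?_, fun x => ?_⟩
  · intro s hs'
    rw [List.mem_singleton] at hs'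
    subst hs'
    rw [List.pairwise_map]
    refine (Finset.nodup_toList _).imp fun {k k'} hkk => ?_
    simp [hs, hinj.ne hkk]
  · rw [List.flatten_singleton, main, Finset.prod_map_toList]
    rfl

/-- A circuit of depth `d` maps the encoded state `emb x` to the encoding of `V x`. -/
def Acts {n : ℕ} (e : ι ≃ Fin q) (emb : Bits n → ι → Bool) (d : ℕ)
    (V : Matrix (Bits n) (Bits n) ℂ) : Prop :=
  ∃ steps : List (List (Gate q)), steps.length = d ∧ StepsDisjoint steps ∧
    ∀ x, gatesMat steps.flatten *ᵥ ket (emb x ∘ e.symm) = ∑ y, V y x • ket (emb y ∘ e.symm)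

lemma Acts.mul {n : ℕ} {e : ι ≃ Fin q} {emb : Bits n → ι → Bool} {d d' : ℕ}
    {V V' : Matrix (Bits n) (Bits n) ℂ} (h' : Acts e emb d' V') (h : Acts e emb d V) :
    Acts e emb (d + d') (V' * V) := by
  obtain ⟨l, hl, hd, h⟩ := h
  obtain ⟨l', hl', hd', h'⟩ := h'
  refine ⟨l ++ l', by simp [hl, hl'], hd.append hd', fun x => ?_⟩
  rw [List.flatten_append, gatesMat_append, ← Matrix.mulVec_mulVec, h, Matrix.mulVec_sum]
  simp only [Matrix.mulVec_smul, h', Finset.smul_sum, smul_smul, Matrix.mul_apply, Finset.sum_smul]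
  rw [Finset.sum_comm]
  simp only [mul_comm]

lemma acts_one {n : ℕ} (e : ι ≃ Fin q) (emb : Bits n → ι → Bool) : Acts e emb 0 1 :=
  ⟨[], rfl, fun s hs => by simp at hs, fun x => by simp [Matrix.one_apply]⟩

lemma Implements.acts_permMat {n : ℕ} {e : ι ≃ Fin q} {emb : Bits n → ι → Bool} {d : ℕ}
    {F : (ι → Bool) → ι → Bool} (h : Implements e d F fun _ => 1) (g : Equiv.Perm (Bits n))
    (hg : ∀ x, F (emb x) = emb (g x)) : Acts e emb d (permMat g) := by
  obtain ⟨l, hl, hd, h⟩ := h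
  exact ⟨l, hl, hd, fun x => by simp [h, hg, permMat]⟩

lemma Implements.acts_diagonal {n : ℕ} {e : ι ≃ Fin q} {emb : Bits n → ι → Bool} {d : ℕ}
    {F : (ι → Bool) → ι → Bool} {ph : (ι → Bool) → ℂ} (h : Implements e d F ph) (v : Bits n → ℂ)
    (hF : ∀ x, F (emb x) = emb x) (hv : ∀ x, ph (emb x) = v x) :
    Acts e emb d (Matrix.diagonal v) := by
  obtain ⟨l, hl, hd, h⟩ := h
  exact ⟨l, hl, hd, fun x => by simp [h, hF, hv, Matrix.diagonal_apply]⟩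

lemma gatesMat_had_apply (l : List (Fin q)) (hl : l.Nodup) (z x : Bits q) :
    gatesMat (l.map Gate.had) z x =
      if ∀ i, i ∉ l → z i = x i then (l.map fun i => hadEntry (z i) (x i)).prod else 0 := by
  induction l generalizing x with
  | nil => simp [Matrix.one_apply, funext_iff]
  | cons i l ih =>
    rw [List.nodup_cons] at hl
    rw [List.map_cons, gatesMat_cons, Matrix.mul_apply]
    -- The remaining gates do not touch qubit `i`, so only the intermediate state that already has
    -- its final bit there contributes.
    rw [Finset.sum_eq_single (Function.update x i (z i))]
    · rw [ih hl.2]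
      have h1 : (Gate.had i).mat (Function.update x i (z i)) x = hadEntry (z i) (x i) := by
        simp +contextual [Gate.mat, hadEntry]
      have h2 : (∀ j, j ∉ l → z j = Function.update x i (z i) j) ↔
          ∀ j, j ∉ i :: l → z j = x j := by
        refine forall_congr' fun j => ?_
        by_cases hj : j = i
        · subst hj; simp
        · simp [hj]
      have h3 : (l.map fun j => hadEntry (z j) (Function.update x i (z i) j)) =
          l.map fun j => hadEntry (z j) (x j) := by
        refine List.map_congr_left fun j hj => ?_
        have : j ≠ i := fun h => hl.1 (h ▸ hj)
        rw [Function.update_of_ne this]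
      rw [h1, h3]
      simp only [h2, List.map_cons, List.prod_cons]
      split_ifs
      · exact mul_comm _ _
      · exact zero_mul _
    · intro w _ hw
      by_cases h : ∀ j, j ≠ i → w j = x j
      · rw [ih hl.2, if_neg, zero_mul]
        intro h'
        refine hw (funext fun j => ?_)
        by_cases hj : j = i
        · subst hj; rw [Function.update_self, h' j hl.1]
        · rw [Function.update_of_ne hj, h j hj]
      · simp [Gate.mat, h]
    · simp

lemma acts_hadMat {n : ℕ} (e : ι ≃ Fin q) (emb : Bits n → ι → Bool) (pos : Fin n → ι)
    (hinj : Function.Injective pos) (hpos : ∀ x i, emb x (pos i) = x i)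
    (hemb : ∀ x y j, (∀ i, pos i ≠ j) → emb x j = emb y j) : Acts e emb 1 (hadMat n) := by
  refine ⟨[(Finset.univ.toList.map fun i => e (pos i)).map Gate.had], rfl, ?_, fun x => ?_⟩
  · intro s hs
    rw [List.mem_singleton] at hs
    subst hs
    rw [List.pairwise_map, List.pairwise_map]
    refine (Finset.nodup_toList _).imp fun {k k'} hkk => ?_
    simp [Gate.support, hinj.ne hkk]
  · ext z
    have hnd : (Finset.univ.toList.map fun i => e (pos i)).Nodup :=
      (Finset.nodup_toList _).map (e.injective.comp hinj)
    rw [List.flatten_singleton, ket, Matrix.mulVec_single_one, Matrix.col_apply,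
      gatesMat_had_apply _ hnd]
    simp only [List.map_map, Finset.prod_map_toList, Finset.sum_apply, Pi.smul_apply, smul_eq_mul]
    rw [Finset.sum_eq_single fun i => z (e (pos i))]
    · have hcond : (∀ j, j ∉ Finset.univ.toList.map (fun i => e (pos i)) →
          z j = (emb x ∘ e.symm) j) ↔ z = emb (fun i => z (e (pos i))) ∘ e.symm := by
        constructor
        · intro h
          funext j
          obtain ⟨j, rfl⟩ := e.surjective j
          by_cases hj : ∃ i, pos i = j
          · obtain ⟨i, rfl⟩ := hj
            simp [hpos]
          · push Not at hj
            rw [h (e j) (by simpa using hj)]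
            simpa using hemb _ _ j hj
        · intro h j hj
          obtain ⟨j, rfl⟩ := e.surjective j
          rw [h]
          simpa using hemb _ _ j (by simpa using hj)
      rw [if_congr hcond rfl rfl]
      simp only [ket, Pi.single_apply, hadMat, Function.comp_apply, Equiv.symm_apply_apply,
        hpos, mul_ite, mul_one, mul_zero]
    · intro y _ hy
      rw [ket, Pi.single_apply, if_neg, mul_zero]
      rintro rfl
      exact hy (funext fun i => by simp [hpos])
    · simp

/-- An upper bound for the number of gates in terms of depth and width. -/
lemma StepsDisjoint.length_flatten_le {steps : List (List (Gate q))} (h : StepsDisjoint steps) :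
    steps.flatten.length ≤ steps.length * q := by
  have hne : ∀ g : Gate q, g.support.Nonempty := fun g => by
    cases g <;> simp [Gate.support]
  have h1 : ∀ s ∈ steps, s.length ≤ q := by
    intro s hs
    -- One qubit chosen from each support: disjoint supports make them distinct, so a step has at
    -- most `q` gates.
    have : (s.map fun g => (hne g).choose).Nodup := by
      rw [List.Nodup, List.pairwise_map]
      refine (h s hs).imp fun {a b} hab => ?_
      exact fun hc => Finset.disjoint_left.1 hab (hne a).choose_spec (hc ▸ (hne b).choose_spec)
    simpa using this.length_le_card
  rw [List.length_flatten]
  simpa using List.sum_le_card_nsmul (steps.map List.length) q (by simpa using h1)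

lemma Acts.exists_circuit {n anc : ℕ} {e : ι ≃ Fin (n + anc)} {emb : Bits n → ι → Bool} {d : ℕ}
    {V : Matrix (Bits n) (Bits n) ℂ} (h : Acts e emb d V)
    (he : ∀ x, emb x ∘ e.symm = withZeros anc x) :
    ∃ U : CliffordCircuit n, U.toMatrix = V ∧ U.depth = d ∧ U.size ≤ d * (n + anc) := by
  obtain ⟨l, hl, hd, h⟩ := h
  have hinj : Function.Injective (withZeros anc : Bits n → Bits (n + anc)) := fun x y hxy => by
    ext i
    simpa [withZeros] using congrFun hxy (Fin.castAdd anc i)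
  have hcol : ∀ (z : Bits (n + anc)) (x : Bits n), gatesMat l.flatten z (withZeros anc x) =
      ∑ y, V y x * ket (withZeros anc y) z := by
    intro z x
    have := congrFun (h x) z
    simpa [he, ket, Matrix.mulVec_single_one] using this
  refine ⟨⟨anc, l, hd, fun x z hz => ?_⟩, ?_, hl, ?_⟩
  · rw [hcol]
    exact Finset.sum_eq_zero fun y _ => by simp [ket, hz y]
  · ext y x
    rw [CliffordCircuit.toMatrix, hcol, Finset.sum_eq_single y]
    · simp [ket]
    · intro y' _ hy'
      simp [ket, hinj.ne_iff, hy'.symm]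
    · simp
  · exact hl ▸ StepsDisjoint.length_flatten_le hd

end Distill

namespace Distill

/-! ### Adding a linear function of one register to another in logarithmic depth -/

/-- A square array of bits, indexed by pairs of bit strings. -/
abbrev BitArray (t : ℕ) := Bits t × Bits t → Bool

/-- Index set of two registers of `n` qubits and two square arrays of ancillas. -/
abbrev WorkIdx (n t : ℕ) := Fin n ⊕ (Fin n ⊕ ((Bits t × Bits t) ⊕ (Bits t × Bits t)))

/-- The basis state with the given contents. -/
def workState {n t : ℕ} (x y : Bits n) (c : BitArray t × BitArray t) : WorkIdx n t → Bool :=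
  Sum.elim x (Sum.elim y (Sum.elim c.1 c.2))

variable {n t q : ℕ}

/-- The map that acts on the ancillas, controlled by the first register. -/
def liftWork (w : Bits n → BitArray t × BitArray t → BitArray t × BitArray t)
    (s : WorkIdx n t → Bool) : WorkIdx n t → Bool :=
  workState (fun i => s (.inl i)) (fun i => s (.inr (.inl i)))
    (w (fun i => s (.inl i)) (fun p => s (.inr (.inr (.inl p))), fun p => s (.inr (.inr (.inr p)))))

@[simp] lemma liftWork_workState (w : Bits n → BitArray t × BitArray t → BitArray t × BitArray t)
    (x y : Bits n) (c : BitArray t × BitArray t) :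
    liftWork w (workState x y c) = workState x y (w x c) := rfl

/-- A map of the ancillas, controlled by the first register, that a circuit of CNOT gates of depth
`d` computes and another one uncomputes. -/
def Computes (e : WorkIdx n t ≃ Fin q) (d : ℕ)
    (w : Bits n → BitArray t × BitArray t → BitArray t × BitArray t) : Prop :=
  ∃ w' : Bits n → BitArray t × BitArray t → BitArray t × BitArray t, (∀ x c, w' x (w x c) = c) ∧
    Implements e d (liftWork w) (fun _ => 1) ∧ Implements e d (liftWork w') fun _ => 1

lemma Computes.comp {e : WorkIdx n t ≃ Fin q} {d d' : ℕ}
    {w v : Bits n → BitArray t × BitArray t → BitArray t × BitArray t}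
    (hv : Computes e d' v) (hw : Computes e d w) :
    Computes e (d + d') fun x c => v x (w x c) := by
  obtain ⟨w', h1, h2, h3⟩ := hw
  obtain ⟨v', g1, g2, g3⟩ := hv
  refine ⟨fun x c => w' x (v' x c), fun x c => by simp [g1, h1], ?_, ?_⟩
  · simpa using! g2.comp h2
  · rw [add_comm]
    simpa using! h3.comp g3

lemma computes_of_involutive {e : WorkIdx n t ≃ Fin q}
    {w : Bits n → BitArray t × BitArray t → BitArray t × BitArray t}
    (hw : ∀ x c, w x (w x c) = c) (h : Implements e 1 (liftWork w) fun _ => 1) :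
    Computes e 1 w := ⟨w, hw, h, h⟩

lemma xor_cancel_right (a b : Bool) : xor (xor a b) b = a := by cases a <;> cases b <;> rfl

/-- Copy the first register into the first row of the first array. -/
noncomputable def loadRow (enc : Fin n ↪ Bits t) (x : Bits n) (c : BitArray t × BitArray t) :
    BitArray t × BitArray t :=
  (fun p => if p.1 = zeroBits t then xor (c.1 p) (Function.extend enc x (fun _ => false) p.2)
    else c.1 p, c.2)

lemma computes_loadRow (e : WorkIdx n t ≃ Fin q) (enc : Fin n ↪ Bits t) :
    Computes e 1 (loadRow enc) := by
  refine computes_of_involutive (fun x c => ?_) ?_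
  · refine Prod.ext (funext fun p => ?_) rfl
    simp only [loadRow]
    split_ifs
    · exact xor_cancel_right _ _
    · rfl
  · refine implements_cnotLayer e (fun j : Fin n => .inl j)
      (fun j => .inr (.inr (.inl (zeroBits t, enc j)))) ?_ _ (fun s k => ?_) (fun s i hi => ?_)
    · rintro (a | a) (b | b) <;> simp
    · simp [liftWork, workState, loadRow, enc.injective.extend_apply]
    · rcases i with i | i | ⟨v, w⟩ | i <;> simp [liftWork, workState, loadRow]
      rintro rfl
      rw [Function.extend_apply' _ _ _ fun ⟨j, hj⟩ => hi j (by simp [hj]), Bool.xor_false]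

/-- One doubling step along a coordinate of the row index of the first array. -/
def spreadStep (r : Fin t) (a : BitArray t) : BitArray t := fun p =>
  if p.1 r = true then xor (a p) (a (Function.update p.1 r false, p.2)) else a p

/-- Rows with bit `r` equal to `false` are only read, the others only written, so the gates are
disjoint and the step is its own inverse. -/
lemma computes_spreadStep (e : WorkIdx n t ≃ Fin q) (r : Fin t) :
    Computes e 1 fun _ c => (spreadStep r c.1, c.2) := by
  refine computes_of_involutive (fun x c => ?_) ?_
  · refine Prod.ext (funext fun p => ?_) rfl
    simp only [spreadStep, Function.update_self, Bool.false_eq_true, if_false]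
    split_ifs
    · exact xor_cancel_right _ _
    · rfl
  · refine implements_cnotLayer e (fun p : {p : Bits t × Bits t // p.1 r = false} =>
        .inr (.inr (.inl p.1)))
      (fun p => .inr (.inr (.inl (Function.update p.1.1 r true, p.1.2)))) ?_ _
      (fun s k => ?_) (fun s i hi => ?_)
    · rintro (⟨⟨a, a'⟩, ha⟩ | ⟨⟨a, a'⟩, ha⟩) (⟨⟨b, b'⟩, hb⟩ | ⟨⟨b, b'⟩, hb⟩)
      · simp
      · intro h
        simp only [Sum.elim_inl, Sum.elim_inr, Sum.inr.injEq, Sum.inl.injEq, Prod.mk.injEq] at h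
        simp [h.1] at ha
      · intro h
        simp only [Sum.elim_inl, Sum.elim_inr, Sum.inr.injEq, Sum.inl.injEq, Prod.mk.injEq] at h
        simp [← h.1] at hb
      · intro h
        simp only [Sum.elim_inr, Sum.inr.injEq, Sum.inl.injEq, Prod.mk.injEq] at h
        simp only [Sum.inr.injEq, Subtype.mk.injEq, Prod.mk.injEq]
        refine ⟨funext fun j => ?_, h.2⟩
        by_cases hj : j = r
        · subst hj; exact ha.trans hb.symm
        · simpa [hj] using congrFun h.1 j
    · obtain ⟨⟨k, k'⟩, hk⟩ := k
      have : Function.update k r false = k := by rw [← hk]; exact Function.update_eq_self _ _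
      simp [liftWork, workState, spreadStep, this]
    · rcases i with i | i | ⟨v, w⟩ | i <;> simp [liftWork, workState, spreadStep]
      intro hv
      refine absurd ?_ (hi ⟨(Function.update v r false, w), by simp⟩)
      simp [← hv]

/-- Add the masked first array to the second one. -/
def addMasked (m : BitArray t) (c : BitArray t × BitArray t) : BitArray t × BitArray t :=
  (c.1, fun p => xor (c.2 p) (m p && c.1 p))

lemma computes_addMasked (e : WorkIdx n t ≃ Fin q) (m : BitArray t) :
    Computes e 1 fun _ c => addMasked m c := by
  refine computes_of_involutive (fun x c => ?_) ?_
  · exact Prod.ext rfl (funext fun p => xor_cancel_right _ _)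
  · refine implements_cnotLayer e (fun p : {p : Bits t × Bits t // m p = true} =>
        .inr (.inr (.inl p.1))) (fun p => .inr (.inr (.inr p.1))) ?_ _
      (fun s k => ?_) (fun s i hi => ?_)
    · rintro (⟨a, ha⟩ | ⟨a, ha⟩) (⟨b, hb⟩ | ⟨b, hb⟩) <;> simp
    · simp [liftWork, workState, addMasked, k.2]
    · rcases i with i | i | i | i <;> simp [liftWork, workState, addMasked]
      have : m i = false := by
        by_contra h
        exact hi ⟨i, by simpa using h⟩ rfl
      simp [this]

/-- One step of summation along a coordinate of the column index of the second array. -/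
def gatherStep (r : Fin t) (b : BitArray t) : BitArray t := fun p =>
  if p.2 r = true then b p else xor (b p) (b (p.1, Function.update p.2 r true))

lemma computes_gatherStep (e : WorkIdx n t ≃ Fin q) (r : Fin t) :
    Computes e 1 fun _ c => (c.1, gatherStep r c.2) := by
  refine computes_of_involutive (fun x c => ?_) ?_
  · refine Prod.ext rfl (funext fun p => ?_)
    simp only [gatherStep, Function.update_self, if_true]
    split_ifs
    · rfl
    · exact xor_cancel_right _ _
  · refine implements_cnotLayer e (fun p : {p : Bits t × Bits t // p.2 r = false} =>
        .inr (.inr (.inr (p.1.1, Function.update p.1.2 r true))))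
      (fun p => .inr (.inr (.inr p.1))) ?_ _ (fun s k => ?_) (fun s i hi => ?_)
    · rintro (⟨⟨a, a'⟩, ha⟩ | ⟨⟨a, a'⟩, ha⟩) (⟨⟨b, b'⟩, hb⟩ | ⟨⟨b, b'⟩, hb⟩)
      · intro h
        simp only [Sum.elim_inl, Sum.inr.injEq, Prod.mk.injEq] at h
        simp only [Sum.inl.injEq, Subtype.mk.injEq, Prod.mk.injEq]
        refine ⟨h.1, funext fun j => ?_⟩
        by_cases hj : j = r
        · subst hj; exact ha.trans hb.symm
        · simpa [hj] using congrFun h.2 j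
      · intro h
        simp only [Sum.elim_inl, Sum.elim_inr, Sum.inr.injEq, Prod.mk.injEq] at h
        simp [← h.2] at hb
      · intro h
        simp only [Sum.elim_inl, Sum.elim_inr, Sum.inr.injEq, Prod.mk.injEq] at h
        simp [h.2] at ha
      · simp
    · obtain ⟨⟨k, k'⟩, hk⟩ := k
      simp [liftWork, workState, gatherStep, show k' r = false from hk]
    · rcases i with i | i | i | ⟨v, w⟩ <;> simp [liftWork, workState, gatherStep]
      intro hv
      exact absurd rfl (hi ⟨(v, w), hv⟩)

lemma computes_foldl {e : WorkIdx n t ≃ Fin q}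
    {w : Fin t → Bits n → BitArray t × BitArray t → BitArray t × BitArray t}
    (hw : ∀ r, Computes e 1 (w r)) (l : List (Fin t)) :
    Computes e l.length fun x c => l.foldl (fun c r => w r x c) c := by
  induction l using List.reverseRecOn with
  | nil => exact ⟨fun _ c => c, fun _ _ => rfl, by
      have h : liftWork (fun (_ : Bits n) (c : BitArray t × BitArray t) => c) = id := by
        ext s i
        rcases i with i | i | i | i <;> rfl
      simpa [h] using implements_id e⟩
  | append_singleton l r ih =>
    simpa [List.foldl_append] using (hw r).comp ih

/-- Each step doubles the number of copies of row zero: the rows filled so far are those supported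
on the coordinates already treated. -/
lemma foldl_spreadStep (g : Bits t → Bool) (l : List (Fin t)) (hl : l.Nodup) (p : Bits t × Bits t) :
    l.foldl (fun a r => spreadStep r a) (fun p => if p.1 = zeroBits t then g p.2 else false) p =
      if ∀ r, r ∉ l → p.1 r = false then g p.2 else false := by
  induction l using List.reverseRecOn generalizing p with
  | nil => simp [funext_iff, zeroBits]
  | append_singleton l r ih =>
    rw [List.nodup_append] at hl
    have hr : r ∉ l := fun h => hl.2.2 r h r (by simp) rfl
    rw [List.foldl_append, List.foldl_cons, List.foldl_nil, spreadStep, ih hl.1, ih hl.1]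
    by_cases hp : p.1 r = true
    · have h1 : ¬ ∀ r, r ∉ l → p.1 r = false := fun h => by simp [h r hr] at hp
      rw [if_pos hp, if_neg h1, Bool.false_xor]
      refine if_congr (forall_congr' fun j => ?_) rfl rfl
      by_cases hj : j = r
      · subst hj; simp
      · simp [hj]
    · rw [if_neg hp]
      refine if_congr (forall_congr' fun j => ?_) rfl rfl
      by_cases hj : j = r
      · subst hj; simp [hr, hp]
      · simp [hj]

/-- The transpose of spreading: each step folds one half of the columns onto the other, so after all
coordinates column zero holds the sum of its row. -/
lemma foldl_gatherStep (b : BitArray t) (l : List (Fin t)) (hl : l.Nodup) (v w : Bits t)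
    (hw : ∀ r ∈ l, w r = false) :
    boolZ (l.foldl (fun b r => gatherStep r b) b (v, w)) =
      ∑ w', if ∀ r, r ∉ l → w' r = w r then boolZ (b (v, w')) else 0 := by
  induction l using List.reverseRecOn generalizing w with
  | nil =>
    rw [Finset.sum_eq_single w]
    · simp
    · intro w' _ hw'
      rw [if_neg]
      exact fun h => hw' (funext fun r => h r (by simp))
    · simp
  | append_singleton l r ih =>
    rw [List.nodup_append] at hl
    have hr : r ∉ l := fun h => hl.2.2 r h r (by simp) rfl
    have hwr : w r = false := hw r (by simp)
    rw [List.foldl_append, List.foldl_cons, List.foldl_nil, gatherStep, if_neg (by simp [hwr]),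
      boolZ_xor, ih hl.1 w fun r' h => hw r' (by simp [h]), ih hl.1, ← Finset.sum_add_distrib]
    · refine Finset.sum_congr rfl fun w' _ => ?_
      cases hw' : w' r
      · have h2 : ¬ ∀ j, j ∉ l → w' j = Function.update w r true j := fun h => by
          simpa [hw'] using h r hr
        rw [if_neg h2, add_zero]
        refine if_congr (forall_congr' fun j => ?_) rfl rfl
        by_cases hj : j = r
        · subst hj; simp [hw', hwr]
        · simp [hj]
      · have h2 : ¬ ∀ j, j ∉ l → w' j = w j := fun h => by
          simpa [hw', hwr] using h r hr
        rw [if_neg h2, zero_add]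
        refine if_congr (forall_congr' fun j => ?_) rfl rfl
        by_cases hj : j = r
        · subst hj; simp [hw']
        · simp [hj]
    · intro j hj
      have : j ≠ r := fun h => hr (h ▸ hj)
      rw [Function.update_of_ne this]
      exact hw j (by simp [hj])

/-- The empty ancilla arrays. -/
def noWork (t : ℕ) : BitArray t × BitArray t := (fun _ => false, fun _ => false)

/-- Bits of a linear function. -/
def linBits (M : Matrix (Fin n) (Fin n) (ZMod 2)) (x : Bits n) : Bits n :=
  bitsZ.symm (M *ᵥ bitsZ x)

/-- Matrix-vector multiplication in logarithmic depth: one layer loads `x`, `t` layers copy it into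
every row, one layer selects the entries of `M`, and `t` layers sum each row. -/
lemma exists_computes_linear (e : WorkIdx n t ≃ Fin q) (enc : Fin n ↪ Bits t)
    (M : Matrix (Fin n) (Fin n) (ZMod 2)) :
    ∃ w, Computes e (2 * t + 2) w ∧
      ∀ x i, (w x (noWork t)).2 (enc i, zeroBits t) = linBits M x i := by
  classical
  let m : BitArray t := fun p => decide (∃ i j, p = (enc i, enc j) ∧ M i j = 1)
  have h := (computes_foldl (computes_gatherStep e) (List.finRange t)).comp
    ((computes_addMasked e m).comp ((computes_foldl (computes_spreadStep e)
      (List.finRange t)).comp (computes_loadRow e enc)))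
  refine ⟨_, by convert h using 1; simp; ring, fun x i => ?_⟩
  have hf1 : ∀ (l : List (Fin t)) (c : BitArray t × BitArray t),
      l.foldl (fun c r => (spreadStep r c.1, c.2)) c =
        (l.foldl (fun a r => spreadStep r a) c.1, c.2) := by
    intro l
    induction l with
    | nil => intro c; rfl
    | cons r l ih => intro c; simp [ih]
  have hf2 : ∀ (l : List (Fin t)) (c : BitArray t × BitArray t),
      l.foldl (fun c r => (c.1, gatherStep r c.2)) c =
        (c.1, l.foldl (fun a r => gatherStep r a) c.2) := by
    intro l
    induction l with
    | nil => intro c; rfl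
    | cons r l ih => intro c; simp [ih]
  apply boolZ.injective
  simp only [hf1, hf2, loadRow, noWork, Bool.false_xor, addMasked]
  rw [foldl_gatherStep _ _ (List.nodup_finRange t) (enc i) (zeroBits t) fun _ _ => rfl]
  simp only [foldl_spreadStep _ _ (List.nodup_finRange t), List.mem_finRange, not_true_eq_false,
    false_imp_iff, implies_true, if_true, boolZ_and]
  have hR : boolZ (linBits M x i) = ∑ j, M i j * boolZ (x j) := by
    rw [← bitsZ_apply, linBits, Equiv.apply_symm_apply]; rfl
  rw [hR]
  symm
  refine Fintype.sum_of_injective enc enc.injective _ _ (fun w hw => ?_) (fun j => ?_)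
  · rw [Function.extend_apply' _ _ _ (by simpa using hw)]
    simp [boolZ]
  · rw [enc.injective.extend_apply]
    congr 1
    have : m (enc i, enc j) = decide (M i j = 1) := by simp [m]
    rw [this]
    exact (boolZ.apply_symm_apply (M i j)).symm

/-- Addition of a linear function of the first register to the second one. -/
lemma exists_implements_addLinear (e : WorkIdx n t ≃ Fin q) (enc : Fin n ↪ Bits t)
    (M : Matrix (Fin n) (Fin n) (ZMod 2)) :
    ∃ F, Implements e (4 * t + 5) F (fun _ => 1) ∧
      ∀ x y, F (workState x y (noWork t)) = workState x (xorBits y (linBits M x)) (noWork t) := by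
  obtain ⟨w, ⟨w', h1, h2, h3⟩, hw⟩ := exists_computes_linear e enc M
  -- `G` adds the row sums to the second register between computing and uncomputing, so the ancillas
  -- end in zero; the depth is `2 * (2 * t + 2) + 1`.
  let G : (WorkIdx n t → Bool) → WorkIdx n t → Bool := fun s =>
    workState (fun i => s (.inl i))
      (fun i => xor (s (.inr (.inl i))) (s (.inr (.inr (.inr (enc i, zeroBits t))))))
      (fun p => s (.inr (.inr (.inl p))), fun p => s (.inr (.inr (.inr p))))
  have hG : Implements e 1 G fun _ => 1 := by
    refine implements_cnotLayer e (fun i : Fin n => .inr (.inr (.inr (enc i, zeroBits t))))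
      (fun i => .inr (.inl i)) ?_ _ (fun s k => rfl) (fun s i hi => ?_)
    · rintro (a | a) (b | b) <;> simp
    · rcases i with i | i | i | i
      · rfl
      · exact absurd rfl (hi i)
      · rfl
      · rfl
  refine ⟨liftWork w' ∘ G ∘ liftWork w, ?_, fun x y => ?_⟩
  · convert h3.comp (hG.comp h2) using 1
    · ring
    · simp
  · have : G (workState x y (w x (noWork t))) =
        workState x (xorBits y (linBits M x)) (w x (noWork t)) := by
      have : (fun i => xor (y i) ((w x (noWork t)).2 (enc i, zeroBits t))) =
          xorBits y (linBits M x) := funext fun i => by rw [hw]; rfl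
      rw [← this]
      rfl
    simp [this, h1]

end Distill

namespace Distill

/-! ### Circuits for the 2-design -/

section

variable {n t q : ℕ}

/-- The initial state of the work registers with data `x`. -/
def workEmb (t : ℕ) (x : Bits n) : WorkIdx n t → Bool := workState x (zeroBits n) (noWork t)

lemma xorBits_self_right (x y : Bits n) : xorBits (xorBits x y) y = x :=
  funext fun _ => xor_cancel_right _ _

lemma xorBits_zeroBits (x : Bits n) : xorBits (zeroBits n) x = x :=
  funext fun _ => Bool.false_xor _

lemma exists_implements_addFst (e : WorkIdx n t ≃ Fin q) :
    ∃ F, Implements e 1 F (fun _ => 1) ∧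
      ∀ x y c, F (workState x y c) = workState x (xorBits y x) c := by
  refine ⟨fun s => workState (fun i => s (.inl i)) (fun i => xor (s (.inr (.inl i))) (s (.inl i)))
      (fun p => s (.inr (.inr (.inl p))), fun p => s (.inr (.inr (.inr p)))),
    implements_cnotLayer e (fun i : Fin n => .inl i) (fun i => .inr (.inl i)) ?_ _
      (fun s k => rfl) (fun s i hi => ?_), fun x y c => rfl⟩
  · rintro (a | a) (b | b) <;> simp
  · rcases i with i | i | i | i
    · rfl
    · exact absurd rfl (hi i)
    · rfl
    · rfl

lemma exists_implements_addSnd (e : WorkIdx n t ≃ Fin q) :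
    ∃ F, Implements e 1 F (fun _ => 1) ∧
      ∀ x y c, F (workState x y c) = workState (xorBits x y) y c := by
  refine ⟨fun s => workState (fun i => xor (s (.inl i)) (s (.inr (.inl i))))
      (fun i => s (.inr (.inl i)))
      (fun p => s (.inr (.inr (.inl p))), fun p => s (.inr (.inr (.inr p)))),
    implements_cnotLayer e (fun i : Fin n => .inr (.inl i)) (fun i => .inl i) ?_ _
      (fun s k => rfl) (fun s i hi => ?_), fun x y c => rfl⟩
  · rintro (a | a) (b | b) <;> simp
  · rcases i with i | i | i | i
    · exact absurd rfl (hi i)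
    · rfl
    · rfl
    · rfl

/-- In-place evaluation: `(x, 0)` becomes `(x, g x)`, three CNOT layers swap the registers, and
adding `M' (g x) = x` clears the second one. -/
lemma acts_permMat (e : WorkIdx n t ≃ Fin q) (enc : Fin n ↪ Bits t) {g : Equiv.Perm (Bits n)}
    (hg : IsLinearPerm g) : Acts e (workEmb t) (8 * t + 13) (permMat g) := by
  obtain ⟨M, M', hM, hgM⟩ := hg
  obtain ⟨F, hF, hF'⟩ := exists_implements_addLinear e enc M
  obtain ⟨F2, hF2, hF2'⟩ := exists_implements_addLinear e enc M'
  obtain ⟨A, hA, hA'⟩ := exists_implements_addFst e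
  obtain ⟨B, hB, hB'⟩ := exists_implements_addSnd e
  have h := hF2.comp (hA.comp (hB.comp (hA.comp hF)))
  have h' : Implements e (8 * t + 13) (F2 ∘ A ∘ B ∘ A ∘ F) fun _ => 1 := by
    convert h using 1
    · ring
    · simp
  refine h'.acts_permMat g fun x => ?_
  have h1 : linBits M x = g x := bitsZ.injective (by rw [linBits, Equiv.apply_symm_apply, hgM])
  have h2 : linBits M' (g x) = x := bitsZ.injective (by
    rw [linBits, Equiv.apply_symm_apply, hgM, Matrix.mulVec_mulVec, hM, Matrix.one_mulVec])
  have h3 : xorBits x (xorBits (g x) x) = g x := funext fun i => by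
    simp only [xorBits]; cases g x i <;> cases x i <;> rfl
  have h4 : xorBits (xorBits (g x) x) (g x) = x := funext fun i => by
    simp only [xorBits]; cases g x i <;> cases x i <;> rfl
  have h5 : xorBits x x = zeroBits n := funext fun i => Bool.xor_self _
  simp only [Function.comp_apply, workEmb, hF', xorBits_zeroBits, h1, hA', hB', h3, h4, hF2', h2,
    h5]

lemma implements_phaseFst (e : WorkIdx n t ≃ Fin q) (p : Fin n → Prop) [DecidablePred p] :
    Implements e 1 id fun s => ∏ i, if p i ∧ s (.inl i) = true then Complex.I else 1 := by
  have h := implements_phaseLayer e (fun i : {i // p i} => Sum.inl i.1)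
    (fun a b h => Subtype.ext (by simpa using h)) Complex.I Gate.phase (fun _ => rfl) fun _ => rfl
  convert h using 3 with s
  rw [← Finset.prod_subtype (Finset.univ.filter p) (by simp)
    (fun i => if s (Sum.inl i) = true then Complex.I else 1), Finset.prod_filter]
  exact Finset.prod_congr rfl fun i _ => by by_cases h : p i <;> simp [h]

lemma implements_phaseSnd (e : WorkIdx n t ≃ Fin q) (c : ℂ) (gate : Fin q → Gate q)
    (hs : ∀ i, (gate i).support = {i})
    (hm : ∀ i, (gate i).mat = Matrix.diagonal fun x => if x i = true then c else 1) :
    Implements e 1 id fun s => ∏ i, if s (.inr (.inl i)) = true then c else 1 :=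
  implements_phaseLayer e (fun i : Fin n => Sum.inr (Sum.inl i))
    (fun a b h => by simpa using h) c gate hs hm

/-- A controlled sign from single-qubit phases, since `2ab = a + b - (a xor b)`. -/
lemma signZ_boolZ_mul (a b : Bool) : signZ (boolZ a * boolZ b) =
    (if a = true then Complex.I else 1) * (if b = true then Complex.I else 1) *
      (if xor b a = true then -Complex.I else 1) := by
  cases a <;> cases b <;> simp [signZ, boolZ]

lemma I_pow_val (a : ZMod 4) : (if 1 ≤ a.val then Complex.I else 1) *
    (if 2 ≤ a.val then Complex.I else 1) * (if 3 ≤ a.val then Complex.I else 1) =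
      Complex.I ^ a.val := by
  have h : a.val < 4 := ZMod.val_lt a
  interval_cases a.val <;> simp [pow_succ]

/-- With `B x` in the second register the quadratic sign is one controlled sign per qubit, and the
powers of `i` take at most three layers of phase gates. -/
lemma acts_quadMat (e : WorkIdx n t ≃ Fin q) (enc : Fin n ↪ Bits t) (Q : Quad n) :
    Acts e (workEmb t) (8 * t + 18) (quadMat Q) := by
  obtain ⟨F, hF, hF'⟩ := exists_implements_addLinear e enc Q.2
  obtain ⟨A, hA, hA'⟩ := exists_implements_addFst e
  have hS := implements_phaseFst e fun _ => True
  have hT := implements_phaseSnd e Complex.I Gate.phase (fun _ => rfl) fun _ => rfl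
  have hT' := implements_phaseSnd e (-Complex.I) Gate.phaseInv (fun _ => rfl) fun _ => rfl
  have h := (implements_phaseFst e fun i => 3 ≤ (Q.1 i).val).comp
    ((implements_phaseFst e fun i => 2 ≤ (Q.1 i).val).comp
      ((implements_phaseFst e fun i => 1 ≤ (Q.1 i).val).comp
        (hF.comp (hA.comp (hT'.comp (hA.comp (hT.comp (hS.comp hF))))))))
  have hd : 4 * t + 5 + 1 + 1 + 1 + 1 + 1 + (4 * t + 5) + 1 + 1 + 1 = 8 * t + 18 := by ring
  rw [hd] at h
  refine h.acts_diagonal _ (fun x => ?_) fun x => ?_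
  · simp only [Function.comp_apply, workEmb, hF', hA', id, xorBits_self_right]
  · simp only [Function.comp_apply, workEmb, hF', hA', id, xorBits_self_right, xorBits_zeroBits]
    have h1 : quadPhase Q x = (∏ i, if x i then Complex.I ^ (Q.1 i).val else 1) *
        ∏ i, signZ (boolZ (x i) * boolZ (linBits Q.2 x i)) := by
      rw [quadPhase, dotProduct, signZ_sum]
      congr 1
      refine Finset.prod_congr rfl fun i _ => ?_
      rw [← bitsZ_apply (linBits Q.2 x), linBits, Equiv.apply_symm_apply]
      rfl
    rw [h1]
    simp only [workState, Sum.elim_inl, Sum.elim_inr, one_mul, mul_one, ← Finset.prod_mul_distrib,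
      signZ_boolZ_mul, true_and]
    refine Finset.prod_congr rfl fun i _ => ?_
    rw [← I_pow_val (Q.1 i)]
    simp only [xorBits]
    rcases Bool.eq_false_or_eq_true (x i) with hx | hx <;>
      rcases Bool.eq_false_or_eq_true (linBits Q.2 x i) with hb | hb <;>
      simp [hx, hb]
    split_ifs <;> simp

lemma acts_designMat (e : WorkIdx n t ≃ Fin q) (enc : Fin n ↪ Bits t) (i : Fin (2 ^ n + 1))
    (R : Quad n) {g : Equiv.Perm (Bits n)} (hg : IsLinearPerm g) (Q Q' : Quad n) :
    ∃ d ≤ 32 * t + 69, Acts e (workEmb t) d (designMat i R g Q Q') := by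
  have hH : Acts e (workEmb t) 1 (hadMat n) := acts_hadMat e _ Sum.inl Sum.inl_injective
    (fun _ _ => rfl) (by
      rintro x y (j | j | j | j) hj
      · exact absurd rfl (hj j)
      · rfl
      · rfl
      · rfl)
  have h := (acts_permMat e enc hg).mul ((acts_quadMat e enc Q).mul
    (hH.mul (acts_quadMat e enc Q')))
  rw [designMat]
  split_ifs
  · exact ⟨_, by omega, (acts_one e _).mul h⟩
  · exact ⟨_, by omega, ((acts_quadMat e enc R).mul hH).mul h⟩

end

/-- An explicit 2-design of unitaries with circuits of logarithmic depth. -/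
theorem exists_designFamily {n : ℕ} (hn : n ≠ 0) :
    ∃ (N : ℕ) (C : Fin N → CliffordCircuit n),
      (∀ i, (C i).depth ≤ 32 * Nat.clog 2 n + 69) ∧
      (∀ i, (C i).size ≤ (32 * Nat.clog 2 n + 69) * (10 * n ^ 2)) ∧
      IsTwoDesign (fun i => (C i).toMatrix) ∧
      ∀ X, ∃ α β : ℂ, (N : ℂ)⁻¹ • ∑ i, conjTwo (C i).toMatrix X = α • 1 + β • flipMat (Bits n) := by
  obtain ⟨K, _, _, g, hg, hu⟩ := exists_uniform_linearPerm hn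
  set t := Nat.clog 2 n
  have ht : n ≤ 2 ^ t := Nat.le_pow_clog (by norm_num) n
  have ht' : 2 ^ t ≤ 2 * n := by
    rcases Nat.lt_or_ge 1 n with h | h
    · have := Nat.pow_pred_clog_lt_self (b := 2) (by norm_num) h
      have h0 : 0 < t := Nat.clog_pos (by norm_num) h
      have h2 : 2 ^ t = 2 * 2 ^ (t - 1) := by
        rw [← pow_succ']; congr 1; omega
      have h3 : 2 ^ (t - 1) < n := this
      omega
    · have : t = 0 := Nat.clog_of_right_le_one h 2
      rw [this]; omega
  obtain ⟨enc⟩ : Nonempty (Fin n ↪ Bits t) := Function.Embedding.nonempty_of_card_le (by simpa)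
  let anc := Fintype.card (Fin n ⊕ ((Bits t × Bits t) ⊕ (Bits t × Bits t)))
  let e : WorkIdx n t ≃ Fin (n + anc) :=
    (Equiv.sumCongr (Equiv.refl _) (Fintype.equivFin _)).trans finSumFinEquiv
  have he : ∀ x : Bits n, workEmb t x ∘ e.symm = withZeros anc x := by
    intro x
    funext j
    obtain ⟨j, rfl⟩ := e.surjective j
    rw [Function.comp_apply, Equiv.symm_apply_apply]
    rcases j with j | j
    · exact (Fin.append_left _ _ _).symm
    · have : withZeros anc x (e (Sum.inr j)) = false := by simp [e, withZeros]
      rw [this]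
      rcases j with j | j | j <;> rfl
  -- The width is `2 * n` for the registers plus two arrays of side `2^t ≤ 2 * n`.
  have hq : n + anc ≤ 10 * n ^ 2 := by
    have h1 : anc = n + (2 ^ t * 2 ^ t + 2 ^ t * 2 ^ t) := by simp [anc]
    have h2 : 2 ^ t * 2 ^ t ≤ (2 * n) * (2 * n) := Nat.mul_le_mul ht' ht'
    have h3 : n ≤ n ^ 2 := Nat.le_self_pow (by norm_num) n
    nlinarith
  let J := Fin (2 ^ n + 1) × Quad n × K × Quad n × Quad n
  have : Nonempty J := inferInstance
  let D : J → Matrix (Bits n) (Bits n) ℂ := fun j =>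
    designMat j.1 j.2.1 (g j.2.2.1) j.2.2.2.1 j.2.2.2.2
  have hc : ∀ j : J, ∃ U : CliffordCircuit n, U.toMatrix = D j ∧ U.depth ≤ 32 * t + 69 ∧
      U.size ≤ (32 * t + 69) * (10 * n ^ 2) := by
    intro j
    obtain ⟨d, hd, h⟩ := acts_designMat e enc j.1 j.2.1 (hg j.2.2.1) j.2.2.2.1 j.2.2.2.2
    obtain ⟨U, h1, h2, h3⟩ := h.exists_circuit he
    exact ⟨U, h1, h2.trans_le hd, h3.trans (Nat.mul_le_mul hd hq)⟩
  choose U hU1 hU2 hU3 using hc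
  let f := (Fintype.equivFin J).symm
  have hspan : ∀ X, ∃ α β : ℂ, ((Fintype.card J : ℕ) : ℂ)⁻¹ • ∑ i, conjTwo (U (f i)).toMatrix X =
      α • 1 + β • flipMat (Bits n) := by
    intro X
    obtain ⟨α, β, h⟩ := sum_conjTwo_designMat hg hu X
    refine ⟨(Fintype.card J : ℂ)⁻¹ * α, (Fintype.card J : ℂ)⁻¹ * β, ?_⟩
    rw [Equiv.sum_comp f fun j => conjTwo (U j).toMatrix X]
    have hsum : ∑ j : J, conjTwo (D j) X =
        ∑ i, ∑ R, ∑ k, ∑ Q, ∑ Q', conjTwo (designMat i R (g k) Q Q') X := by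
      rw [Fintype.sum_prod_type]
      refine Finset.sum_congr rfl fun i _ => ?_
      rw [Fintype.sum_prod_type]
      refine Finset.sum_congr rfl fun R _ => ?_
      rw [Fintype.sum_prod_type]
      refine Finset.sum_congr rfl fun k _ => ?_
      rw [Fintype.sum_prod_type]
    simp only [hU1]
    rw [hsum, h, smul_add, smul_smul, smul_smul]
  exact ⟨Fintype.card J, fun i => U (f i), fun i => hU2 _, fun i => hU3 _,
    isTwoDesign_of_twirl_mem Fintype.card_pos
      (fun i => by simpa only [hU1] using designMat_mem_unitaryGroup _ _ _ _ _) hspan, hspan⟩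

theorem exists_box {n k : ℕ} (hn : 2 ≤ n) (hk : 1 ≤ k) (hkn : k ≤ n) :
    ∃ B : Box n k, B.depth ≤ 32 * Nat.clog 2 n + 69 ∧
      B.gates ≤ 20 * (32 * Nat.clog 2 n + 69) * n ^ 2 := by
  obtain ⟨N, C, h1, h2, h3, -⟩ := exists_designFamily (n := n) (by omega)
  refine ⟨⟨hn, hk, hkn, N, C, h3⟩, Finset.sup_le fun i _ => h1 i, ?_⟩
  have : (Finset.univ.sup fun i => (C i).size) ≤ (32 * Nat.clog 2 n + 69) * (10 * n ^ 2) :=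
    Finset.sup_le fun i _ => h2 i
  calc _ ≤ 2 * ((32 * Nat.clog 2 n + 69) * (10 * n ^ 2)) := Nat.mul_le_mul le_rfl this
    _ = _ := by ring

end Distill

namespace Distill

/-! ### The action of a box -/

lemma trace_bell (n : ℕ) : (bell n).trace = 1 := by
  have : ∀ p : Reg n, bell n p p = if p.1 = p.2 then ((2 : ℂ) ^ n)⁻¹ else 0 := fun p => by
    simp [bell]
  simp [Matrix.trace, this, Fintype.sum_prod_type]

lemma bell_mul_bell (n : ℕ) : bell n * bell n = bell n := by
  ext p q
  simp only [Matrix.mul_apply, bell, Fintype.sum_prod_type]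
  by_cases hp : p.1 = p.2 <;> by_cases hq : q.1 = q.2 <;> simp [hp, hq]

section Twirl

variable {n : ℕ}

/-- Conjugation by `C ⊗ C^*`. -/
def conjBilocal (C : Matrix (Bits n) (Bits n) ℂ) (X : Op n) : Op n :=
  (C ⊗ₖ C.map (starRingEnd ℂ)) * X * (C ⊗ₖ C.map (starRingEnd ℂ))ᴴ

/-- Exchange Bob's row and column labels. -/
def bobTranspose (X : Op n) : Op n := fun p q => X (p.1, q.2) (q.1, p.2)

/-- Transposing Bob's side turns `C ⊗ C^*` into `C ⊗ C`; this is how the 2-design property reaches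
the bilocal protocol. -/
lemma conjBilocal_apply (C : Matrix (Bits n) (Bits n) ℂ) (X : Op n) (p q : Reg n) :
    conjBilocal C X p q = conjTwo C (bobTranspose X) (p.1, q.2) (q.1, p.2) := by
  have h : conjBilocal C X p q =
      ∑ r, ∑ s, C p.1 r.1 * star (C p.2 r.2) * X r s * star (C q.1 s.1 * star (C q.2 s.2)) := by
    simp only [conjBilocal, Matrix.mul_apply, Matrix.conjTranspose_apply,
      Matrix.kroneckerMap_apply, Finset.sum_mul, Matrix.map_apply]
    exact Finset.sum_comm
  rw [h, conjTwo_apply]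
  simp only [Fintype.sum_prod_type, bobTranspose]
  refine Finset.sum_congr rfl fun a _ => ?_
  rw [Finset.sum_comm]
  conv_rhs => rw [Finset.sum_comm]
  refine Finset.sum_congr rfl fun b _ => ?_
  rw [Finset.sum_comm]
  refine Finset.sum_congr rfl fun c _ => Finset.sum_congr rfl fun d _ => ?_
  simp only [star_mul', star_star]
  ring

lemma kronecker_conj_mem_unitaryGroup {C : Matrix (Bits n) (Bits n) ℂ}
    (hC : C ∈ Matrix.unitaryGroup (Bits n) ℂ) :
    (C ⊗ₖ C.map (starRingEnd ℂ)) ∈ Matrix.unitaryGroup (Reg n) ℂ := by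
  have h1 : C * Cᴴ = 1 := Matrix.mem_unitaryGroup_iff.1 hC
  have h2 : C.map (starRingEnd ℂ) * (C.map (starRingEnd ℂ))ᴴ = 1 := by
    have : (C.map (starRingEnd ℂ))ᴴ = Cᴴ.map (starRingEnd ℂ) := by ext i j; simp
    rw [this, ← Matrix.map_mul, h1]
    simp
  rw [Matrix.mem_unitaryGroup_iff, Matrix.star_eq_conjTranspose, Matrix.conjTranspose_kronecker,
    ← Matrix.mul_kronecker_mul, h1, h2, Matrix.one_kronecker_one]

lemma bell_mul_kronecker {C : Matrix (Bits n) (Bits n) ℂ}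
    (hC : C ∈ Matrix.unitaryGroup (Bits n) ℂ) :
    bell n * (C ⊗ₖ C.map (starRingEnd ℂ)) = (C ⊗ₖ C.map (starRingEnd ℂ)) * bell n := by
  have h1 : ∀ a b, ∑ x, C a x * star (C b x) = if a = b then 1 else 0 := fun a b => by
    have := congrFun (congrFun (Matrix.mem_unitaryGroup_iff.1 hC) a) b
    simpa [Matrix.mul_apply, Matrix.one_apply] using this
  have h2 : ∀ a b, ∑ x, C x a * star (C x b) = if a = b then 1 else 0 := fun a b => by
    have := congrFun (congrFun (Matrix.mem_unitaryGroup_iff'.1 hC) b) a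
    simpa [Matrix.mul_apply, Matrix.one_apply, mul_comm, eq_comm] using this
  ext p q
  have e1 : (bell n * (C ⊗ₖ C.map (starRingEnd ℂ))) p q =
      if p.1 = p.2 then ((2 : ℂ) ^ n)⁻¹ * ∑ x, C x q.1 * star (C x q.2) else 0 := by
    simp only [Matrix.mul_apply, bell, Fintype.sum_prod_type, Matrix.kroneckerMap_apply,
      Matrix.map_apply]
    split_ifs with h <;> simp [h, Finset.mul_sum]
  have e2 : ((C ⊗ₖ C.map (starRingEnd ℂ)) * bell n) p q =
      if q.1 = q.2 then ((2 : ℂ) ^ n)⁻¹ * ∑ x, C p.1 x * star (C p.2 x) else 0 := by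
    simp only [Matrix.mul_apply, bell, Fintype.sum_prod_type, Matrix.kroneckerMap_apply,
      Matrix.map_apply]
    split_ifs with h <;> simp [h, Finset.mul_sum, mul_comm]
  rw [e1, e2, h1, h2]
  split_ifs <;> simp

lemma trace_conjBilocal {C : Matrix (Bits n) (Bits n) ℂ}
    (hC : C ∈ Matrix.unitaryGroup (Bits n) ℂ) (X : Op n) :
    (conjBilocal C X).trace = X.trace := by
  have h : (C ⊗ₖ C.map (starRingEnd ℂ))ᴴ * (C ⊗ₖ C.map (starRingEnd ℂ)) = 1 :=
    Matrix.mem_unitaryGroup_iff'.1 (kronecker_conj_mem_unitaryGroup hC)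
  rw [conjBilocal, Matrix.trace_mul_comm, ← Matrix.mul_assoc, h, Matrix.one_mul]

lemma trace_bell_mul_conjBilocal {C : Matrix (Bits n) (Bits n) ℂ}
    (hC : C ∈ Matrix.unitaryGroup (Bits n) ℂ) (X : Op n) :
    (bell n * conjBilocal C X).trace = (bell n * X).trace := by
  rw [← trace_conjBilocal hC (bell n * X), conjBilocal, conjBilocal]
  simp only [← Matrix.mul_assoc, bell_mul_kronecker hC]

end Twirl

namespace Box

variable {n k : ℕ} (B : Box n k)

lemma circ_mem_unitaryGroup (i : Fin B.N) :
    (B.circ i).toMatrix ∈ Matrix.unitaryGroup (Bits n) ℂ := B.design.2.1 i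

lemma twirl_eq_sum (X : Op n) :
    B.twirl X = (B.N : ℂ)⁻¹ • ∑ i, conjBilocal (B.circ i).toMatrix X := rfl

lemma natCast_N_ne_zero : (B.N : ℂ) ≠ 0 := Nat.cast_ne_zero.2 B.design.1.ne'

lemma trace_twirl (X : Op n) : (B.twirl X).trace = X.trace := by
  rw [twirl_eq_sum, Matrix.trace_smul, Matrix.trace_sum]
  simp [trace_conjBilocal (B.circ_mem_unitaryGroup _), B.natCast_N_ne_zero]

lemma trace_bell_mul_twirl (X : Op n) : (bell n * B.twirl X).trace = (bell n * X).trace := by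
  rw [twirl_eq_sum, Matrix.mul_smul, Matrix.trace_smul, Matrix.mul_sum, Matrix.trace_sum]
  simp [trace_bell_mul_conjBilocal (B.circ_mem_unitaryGroup _), B.natCast_N_ne_zero]

/-- Bob's partial transpose fixes the identity and maps the flip to `2^n` times the Bell projector.
-/
lemma exists_twirl_eq (X : Op n) : ∃ α β : ℂ, B.twirl X = α • 1 + β • bell n := by
  obtain ⟨N, C, -, -, hC, hspan⟩ := exists_designFamily (n := n) (by have := B.two_le; omega)
  obtain ⟨α, β, h⟩ := hC.twirl_mem_of B.design hspan (bobTranspose X)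
  refine ⟨α, β * 2 ^ n, ?_⟩
  ext ⟨a, b⟩ ⟨c, d⟩
  have := congrFun (congrFun h (a, d)) (c, b)
  simp only [Matrix.smul_apply, Matrix.sum_apply] at this
  simp only [twirl_eq_sum, Matrix.smul_apply, Matrix.sum_apply, conjBilocal_apply, this]
  simp only [Matrix.add_apply, Matrix.smul_apply, Matrix.one_apply, flipMat, bell, smul_eq_mul,
    Prod.mk.injEq, Prod.swap_prod_mk]
  have h1 : (a = c ∧ d = b) = (a = c ∧ b = d) := by rw [@eq_comm _ d b]
  have h2 : (c = d ∧ b = a) = (a = b ∧ c = d) := by rw [@eq_comm _ b a, and_comm]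
  simp only [h1, h2]
  split_ifs <;> simp

/-- The weight of the identity in the twirled state. -/
noncomputable def noise (n : ℕ) (t f : ℝ) : ℝ := (t - f) / (4 ^ n - 1)

lemma four_pow_sub_one_pos {n : ℕ} (hn : 2 ≤ n) : (0 : ℝ) < 4 ^ n - 1 := by
  have : (1 : ℝ) < 4 ^ n := one_lt_pow₀ (by norm_num) (by omega)
  linarith

/-- The twirl preserves trace and Bell overlap, and these give the linear system `t = 4^n α + β`, `f
= α + β`. -/
lemma twirl_eq {X : Op n} {t f : ℝ} (ht : X.trace = t) (hf : (bell n * X).trace = f) :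
    B.twirl X = (noise n t f : ℂ) • 1 + ((f - noise n t f : ℝ) : ℂ) • bell n := by
  obtain ⟨α, β, h⟩ := B.exists_twirl_eq X
  have h1 : (t : ℂ) = α * 4 ^ n + β := by
    rw [← ht, ← B.trace_twirl, h, Matrix.trace_add, Matrix.trace_smul, Matrix.trace_smul,
      Matrix.trace_one, trace_bell]
    simp [← mul_pow]
  have h2 : (f : ℂ) = α + β := by
    rw [← hf, ← B.trace_bell_mul_twirl, h, Matrix.mul_add, Matrix.mul_smul, Matrix.mul_smul,
      bell_mul_bell, Matrix.mul_one, Matrix.trace_add, Matrix.trace_smul, Matrix.trace_smul,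
      trace_bell]
    simp
  have hpos := four_pow_sub_one_pos B.two_le
  have hne : ((4 : ℂ) ^ n - 1) ≠ 0 := by exact_mod_cast hpos.ne'
  have h3 : α = noise n t f := by
    rw [noise]; push_cast
    rw [eq_div_iff hne, h1, h2]; ring
  have h4 : β = ((f - noise n t f : ℝ) : ℂ) := by
    push_cast; rw [← h3, h2]; ring
  rw [h, h3, ← h4]

end Box

/-- Splitting a bit string into its first `n - k` and its last `k` bits. -/
def glueEquiv {n k : ℕ} (h : k ≤ n) : Bits (n - k) × Bits k ≃ Bits n where
  toFun p := glue h p.1 p.2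
  invFun y := (fun i => y ⟨i, by omega⟩, fun j => y ⟨j + (n - k), by omega⟩)
  left_inv p := by
    ext i <;> simp [glue]
  right_inv y := by
    funext i
    simp only [glue]
    split_ifs with hi
    · rfl
    · congr 1; ext; simp; omega

lemma glue_inj {n k : ℕ} (h : k ≤ n) {s s' : Bits (n - k)} {x x' : Bits k} :
    glue h s x = glue h s' x' ↔ s = s' ∧ x = x' := by
  have := (glueEquiv h).injective.eq_iff (a := (s, x)) (b := (s', x'))
  rwa [Prod.mk.injEq] at this

lemma two_pow_mul_four_pow {n k : ℕ} (h : k ≤ n) : (2 : ℝ) ^ (n - k) * 4 ^ k = 2 ^ (n + k) := by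
  rw [show (4 : ℝ) = 2 ^ 2 by norm_num, ← pow_mul, ← pow_add]; congr 1; omega

namespace Box

variable {n k : ℕ} (B : Box n k)

/-- Trace of the accepted state, for an input of trace `t` and Bell overlap `f`. -/
noncomputable def acceptTrace (n k : ℕ) (t f : ℝ) : ℝ := f + noise n t f * (2 ^ (n + k) - 1)

/-- Bell overlap of the accepted state, for an input of trace `t` and Bell overlap `f`. -/
noncomputable def acceptOverlap (n k : ℕ) (t f : ℝ) : ℝ := f + noise n t f * (2 ^ (n - k) - 1)

/-- Summing over the `2^(n-k)` agreeing outcomes multiplies the identity by that number, whereas it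
turns the normalisation `2^(-n)` of the Bell projector into `2^(-k)`. -/
lemma accept_eq {X : Op n} {t f : ℝ} (ht : X.trace = t) (hf : (bell n * X).trace = f) :
    B.accept X = ((noise n t f * 2 ^ (n - k) : ℝ) : ℂ) • 1 +
      ((f - noise n t f : ℝ) : ℂ) • bell k := by
  have hle := B.le
  ext p q
  simp only [accept, B.twirl_eq ht hf, Matrix.add_apply, Matrix.smul_apply, Matrix.one_apply, bell,
    Prod.mk.injEq, glue_inj, true_and, smul_eq_mul, Finset.sum_const, Finset.card_univ,
    nsmul_eq_mul]
  have h1 : (p.1 = q.1 ∧ p.2 = q.2) = (p = q) := by rw [Prod.ext_iff]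
  have h2 : ((2 : ℂ) ^ n)⁻¹ * 2 ^ (n - k) = ((2 : ℂ) ^ k)⁻¹ := by
    have : (2 : ℂ) ^ n = 2 ^ (n - k) * 2 ^ k := by rw [← pow_add, Nat.sub_add_cancel hle]
    rw [this]; field_simp
  have h3 : (Fintype.card (Bits (n - k)) : ℂ) = 2 ^ (n - k) := by simp
  simp only [h1]
  rw [h3, ← h2]
  push_cast
  split_ifs <;> ring

lemma trace_accept {X : Op n} {t f : ℝ} (ht : X.trace = t) (hf : (bell n * X).trace = f) :
    (B.accept X).trace = (acceptTrace n k t f : ℂ) := by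
  rw [B.accept_eq ht hf, Matrix.trace_add, Matrix.trace_smul, Matrix.trace_smul, Matrix.trace_one,
    trace_bell]
  have : (Fintype.card (Reg k) : ℂ) = ((4 ^ k : ℝ) : ℂ) := by
    simp [← mul_pow]
  rw [this, smul_eq_mul, smul_eq_mul, mul_one, ← Complex.ofReal_mul, ← Complex.ofReal_add,
    mul_assoc, two_pow_mul_four_pow B.le, acceptTrace]
  congr 1; ring

lemma trace_bell_mul_accept {X : Op n} {t f : ℝ} (ht : X.trace = t)
    (hf : (bell n * X).trace = f) :
    (bell k * B.accept X).trace = (acceptOverlap n k t f : ℂ) := by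
  rw [B.accept_eq ht hf, Matrix.mul_add, Matrix.mul_smul, Matrix.mul_smul, bell_mul_bell,
    Matrix.mul_one, Matrix.trace_add, Matrix.trace_smul, Matrix.trace_smul, trace_bell,
    smul_eq_mul, smul_eq_mul, mul_one, mul_one, ← Complex.ofReal_add, acceptOverlap]
  congr 1; ring

lemma reject_eq {X : Op n} {t f : ℝ} (ht : X.trace = t) (hf : (bell n * X).trace = f) :
    B.reject X = t - acceptTrace n k t f := by
  have h1 : (B.accept X).trace.re = acceptTrace n k t f := by
    rw [B.trace_accept ht hf, Complex.ofReal_re]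
  have h2 : (B.twirl X).trace.re = t := by rw [B.trace_twirl, ht, Complex.ofReal_re]
  rw [← h1, ← h2]
  let E : (Bits (n - k) × Bits k) × (Bits (n - k) × Bits k) ≃ Reg n :=
    Equiv.prodCongr (glueEquiv B.le) (glueEquiv B.le)
  have hE : ∀ a, (∃ i : Fin n, (i : ℕ) < n - k ∧ (E a).1 i ≠ (E a).2 i) ↔ a.1.1 ≠ a.2.1 := by
    rintro ⟨⟨s, x⟩, ⟨s', x'⟩⟩
    constructor
    · rintro ⟨i, hi, h⟩ (rfl : s = s')
      simp [E, glueEquiv, glue, hi] at h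
    · intro h
      obtain ⟨i, hi⟩ := Function.ne_iff.1 h
      exact ⟨⟨i, by omega⟩, i.2, by simpa [E, glueEquiv, glue] using hi⟩
  have h3 : (B.accept X).trace.re =
      ∑ a, if a.1.1 = a.2.1 then (B.twirl X (E a) (E a)).re else 0 := by
    simp only [Matrix.trace, Matrix.diag, accept, Complex.re_sum, Fintype.sum_prod_type]
    have : ∀ (s : Bits (n - k)) (x : Bits k), (∑ s', ∑ x',
        if s = s' then (B.twirl X (E ((s, x), (s', x'))) (E ((s, x), (s', x')))).re else 0) =
        ∑ x', (B.twirl X (E ((s, x), (s, x'))) (E ((s, x), (s, x')))).re := fun s x => by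
      rw [Finset.sum_eq_single s]
      · simp
      · intro s' _ h; simp [h.symm]
      · simp
    simp only [this]
    symm
    rw [Finset.sum_comm]
    refine Finset.sum_congr rfl fun x _ => ?_
    rw [Finset.sum_comm]
    rfl
  rw [h3, reject, ← Equiv.sum_comp E]
  simp only [Matrix.trace, Matrix.diag, Complex.re_sum]
  rw [← Equiv.sum_comp E fun p => (B.twirl X p p).re, ← Finset.sum_sub_distrib]
  refine Finset.sum_congr rfl fun a _ => ?_
  by_cases h : a.1.1 = a.2.1
  · rw [if_neg (by rw [hE]; simpa using h), if_pos h, sub_self]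
  · rw [if_pos ((hE a).2 h), if_neg h, sub_zero]

end Box

/-! ### Elementary estimates for the accepted state -/

section Estimates

variable {n k : ℕ} {t f : ℝ}

lemma noise_nonneg (hn : 2 ≤ n) (h : f ≤ t) : 0 ≤ Box.noise n t f :=
  div_nonneg (sub_nonneg.2 h) (Box.four_pow_sub_one_pos hn).le

lemma le_acceptOverlap (hn : 2 ≤ n) (h : f ≤ t) : f ≤ Box.acceptOverlap n k t f :=
  le_add_of_nonneg_right (mul_nonneg (noise_nonneg hn h)
    (sub_nonneg.2 (one_le_pow₀ (by norm_num))))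

lemma acceptOverlap_le_acceptTrace (hn : 2 ≤ n) (h : f ≤ t) :
    Box.acceptOverlap n k t f ≤ Box.acceptTrace n k t f := by
  have h1 : (2 : ℝ) ^ (n - k) ≤ 2 ^ (n + k) := pow_le_pow_right₀ (by norm_num) (by omega)
  have := mul_le_mul_of_nonneg_left (sub_le_sub_right h1 1) (noise_nonneg hn h)
  unfold Box.acceptOverlap Box.acceptTrace
  linarith

lemma acceptTrace_le (hn : 2 ≤ n) (hk : k ≤ n) (h : f ≤ t) : Box.acceptTrace n k t f ≤ t := by
  have hpos := Box.four_pow_sub_one_pos hn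
  have h1 : (2 : ℝ) ^ (n + k) ≤ 4 ^ n := by
    rw [show (4 : ℝ) = 2 ^ 2 by norm_num, ← pow_mul]
    exact pow_le_pow_right₀ (by norm_num) (by omega)
  have h2 := mul_le_mul_of_nonneg_left (sub_le_sub_right h1 1) (noise_nonneg hn h)
  have h3 : Box.noise n t f * (4 ^ n - 1) = t - f := by
    rw [Box.noise]; field_simp
  unfold Box.acceptTrace
  linarith

/-- The gain of a box: the left side is `noise * (4^n - 4^(n-k))`, and `noise * (4^n - 1)` is
exactly `t - f`. -/
lemma acceptTrace_sub_acceptOverlap_le (hn : 2 ≤ n) (hk : k ≤ n) (h : f ≤ t) :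
    (Box.acceptTrace n k t f - Box.acceptOverlap n k t f) * 2 ^ (n - k) ≤ t - f := by
  have hpos := Box.four_pow_sub_one_pos hn
  have h3 : Box.noise n t f * (4 ^ n - 1) = t - f := by
    rw [Box.noise]; field_simp
  have h4 : (2 : ℝ) ^ (n + k) * 2 ^ (n - k) = 4 ^ n := by
    rw [show (4 : ℝ) = 2 ^ 2 by norm_num, ← pow_mul, ← pow_add]; congr 1; omega
  have h5 : (1 : ℝ) ≤ 2 ^ (n - k) * 2 ^ (n - k) :=
    one_le_mul_of_one_le_of_one_le (one_le_pow₀ (by norm_num)) (one_le_pow₀ (by norm_num))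
  have h6 : Box.noise n t f * (2 ^ (n + k) * 2 ^ (n - k) - 2 ^ (n - k) * 2 ^ (n - k)) ≤
      Box.noise n t f * (4 ^ n - 1) :=
    mul_le_mul_of_nonneg_left (by rw [h4]; linarith) (noise_nonneg hn h)
  unfold Box.acceptOverlap Box.acceptTrace
  linarith

end Estimates

/-! ### Tensor products of blocks -/

section Blocks

variable {c k : ℕ}

/-- Pair registers of `c` blocks. -/
def blockEquiv (c k : ℕ) : Reg (c * k) ≃ (Fin c → Reg k) where
  toFun p j := (fun i => p.1 (finProdFinEquiv (j, i)), fun i => p.2 (finProdFinEquiv (j, i)))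
  invFun P := (fun l => (P (finProdFinEquiv.symm l).1).1 (finProdFinEquiv.symm l).2,
    fun l => (P (finProdFinEquiv.symm l).1).2 (finProdFinEquiv.symm l).2)
  left_inv p := by
    refine Prod.ext (funext fun l => ?_) (funext fun l => ?_) <;>
      simp only [Prod.mk.eta, Equiv.apply_symm_apply]
  right_inv P := by
    funext j
    refine Prod.ext (funext fun l => ?_) (funext fun l => ?_) <;>
      simp only [Equiv.symm_apply_apply]

lemma blockTensor_apply (σ : Fin c → Op k) (p q : Reg (c * k)) :
    blockTensor σ p q = ∏ j, σ j (blockEquiv c k p j) (blockEquiv c k q j) := rfl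

lemma bell_eq_prod (p q : Reg (c * k)) :
    bell (c * k) p q = ∏ j, bell k (blockEquiv c k p j) (blockEquiv c k q j) := by
  have h : ∀ p : Reg (c * k), p.1 = p.2 ↔
      ∀ j, (blockEquiv c k p j).1 = (blockEquiv c k p j).2 := by
    intro p
    constructor
    · intro h j; simp [blockEquiv, h]
    · intro h
      funext l
      have := congrFun (h (finProdFinEquiv.symm l).1) (finProdFinEquiv.symm l).2
      simpa only [blockEquiv, Equiv.coe_fn_mk, Prod.mk.eta, Equiv.apply_symm_apply] using this
  simp only [bell, Finset.prod_ite_zero, Finset.prod_const, Finset.card_univ, Fintype.card_fin,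
    Finset.mem_univ, true_imp_iff, forall_and, ← h, inv_pow, ← pow_mul, mul_comm]

lemma trace_blockTensor (σ : Fin c → Op k) : (blockTensor σ).trace = ∏ j, (σ j).trace := by
  simp only [Matrix.trace, Matrix.diag]
  rw [Fintype.prod_sum fun j p => σ j p p, ← Equiv.sum_comp (blockEquiv c k)]
  rfl

lemma trace_bell_mul_blockTensor (σ : Fin c → Op k) :
    (bell (c * k) * blockTensor σ).trace = ∏ j, (bell k * σ j).trace := by
  simp only [Matrix.trace, Matrix.diag, Matrix.mul_apply]
  rw [Fintype.prod_sum fun j p => ∑ q, bell k p q * σ j q p, ← Equiv.sum_comp (blockEquiv c k)]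
  refine Finset.sum_congr rfl fun p _ => ?_
  rw [Fintype.prod_sum fun j q => bell k (blockEquiv c k p j) q * σ j q (blockEquiv c k p j),
    ← Equiv.sum_comp (blockEquiv c k)]
  refine Finset.sum_congr rfl fun q _ => ?_
  rw [bell_eq_prod, blockTensor_apply, Finset.prod_mul_distrib]

end Blocks

end Distill

namespace Distill

open scoped ENNReal

/-! ### Sums over lists and over tuples -/

section Sums

variable {α : Type}

/-- A nonempty list, given by its last element and the elements before, either is a singleton or
starts with an element before the last. -/
def unconsEquiv (α : Type) : List α × α ≃ α ⊕ α × (List α × α) where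
  toFun
    | ([], f) => .inl f
    | (a :: l, f) => .inr (a, (l, f))
  invFun
    | .inl f => ([], f)
    | .inr (a, (l, f)) => (a :: l, f)
  left_inv := by rintro ⟨_ | _, _⟩ <;> rfl
  right_inv := by rintro (_ | ⟨_, _, _⟩) <;> rfl

lemma tsum_uncons (F : List α × α → ℝ≥0∞) :
    ∑' p, F p = ∑' f, F ([], f) + ∑' a, ∑' p : List α × α, F (a :: p.1, p.2) := by
  rw [← (unconsEquiv α).symm.tsum_eq F, Summable.tsum_sum ENNReal.summable ENNReal.summable]
  congr 1
  rw [← ENNReal.tsum_prod (f := fun a (p : List α × α) => F (a :: p.1, p.2))]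
  rfl

/-- The sum over the lists of length less than `N`. -/
noncomputable def truncSum (N : ℕ) (F : List α × α → ℝ≥0∞) : ℝ≥0∞ :=
  ∑' p, if p.1.length < N then F p else 0

lemma truncSum_zero (F : List α × α → ℝ≥0∞) : truncSum 0 F = 0 := by simp [truncSum]

lemma truncSum_succ (N : ℕ) (F : List α × α → ℝ≥0∞) :
    truncSum (N + 1) F =
      ∑' f, F ([], f) + ∑' a, truncSum N fun p => F (a :: p.1, p.2) := by
  rw [truncSum, tsum_uncons]
  simp [truncSum]

lemma truncSum_le (N : ℕ) (F : List α × α → ℝ≥0∞) : truncSum N F ≤ ∑' p, F p :=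
  ENNReal.tsum_le_tsum fun p => by split_ifs <;> simp

lemma truncSum_mul_left (N : ℕ) (c : ℝ≥0∞) (F : List α × α → ℝ≥0∞) :
    truncSum N (fun p => c * F p) = c * truncSum N F := by
  rw [truncSum, truncSum, ← ENNReal.tsum_mul_left]
  exact tsum_congr fun p => by split_ifs <;> simp

lemma truncSum_add (N : ℕ) (F G : List α × α → ℝ≥0∞) :
    truncSum N (fun p => F p + G p) = truncSum N F + truncSum N G := by
  rw [truncSum, truncSum, truncSum, ← ENNReal.tsum_add]
  exact tsum_congr fun p => by split_ifs <;> simp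

/-- A finite set of histories has bounded length. This reduces bounds on repeat-until-success sums
to inductions on the number of repetitions. -/
lemma tsum_le_of_truncSum_le {F : List α × α → ℝ≥0∞} {K : ℝ≥0∞} (h : ∀ N, truncSum N F ≤ K) :
    ∑' p, F p ≤ K := by
  rw [ENNReal.tsum_eq_iSup_sum]
  refine iSup_le fun s => ?_
  refine le_trans ?_ (h (s.sup (fun p => p.1.length) + 1))
  refine le_trans (le_of_eq ?_) (ENNReal.sum_le_tsum s)
  refine Finset.sum_congr rfl fun p hp => ?_
  rw [if_pos (Nat.lt_succ_of_le (Finset.le_sup (f := fun p : List α × α => p.1.length) hp))]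

lemma tsum_pi_prod {c : ℕ} (F : Fin c → α → ℝ≥0∞) :
    ∑' a : Fin c → α, ∏ j, F j (a j) = ∏ j, ∑' r, F j r := by
  induction c with
  | zero => simp
  | succ c ih =>
    rw [← (Fin.consEquiv fun _ => α).tsum_eq, Fin.prod_univ_succ, ← ih]
    simp only [Fin.prod_univ_succ, Fin.consEquiv, Equiv.coe_fn_mk, Fin.cons_zero, Fin.cons_succ]
    rw [ENNReal.tsum_prod (f := fun a (b : Fin c → α) => F 0 a * ∏ j, F j.succ (b j))]
    simp only [ENNReal.tsum_mul_left, ENNReal.tsum_mul_right]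

lemma tsum_pi_prod_mul {c : ℕ} (F : Fin c → α → ℝ≥0∞) (hF : ∀ j, ∑' r, F j r = 1) (h : α → ℝ≥0∞)
    (i : Fin c) : ∑' a : Fin c → α, (∏ j, F j (a j)) * h (a i) = ∑' r, F i r * h r := by
  have := tsum_pi_prod fun j r => F j r * if j = i then h r else 1
  simp only [Finset.prod_mul_distrib, Finset.prod_ite_eq', Finset.mem_univ, if_true] at this
  rw [this, Finset.prod_eq_single i]
  · simp
  · intro j _ hj; simp [hj, hF]
  · simp

end Sums

/-! ### Repetition until success -/

section Repeat

variable {α : Type}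

/-- The probability of a list of rejected attempts followed by an accepted one, where `rej i a` and
`acc i a` are the probabilities that the `i`-th attempt has history `a` and is rejected or
accepted. -/
noncomputable def runWeight (rej acc : ℕ → α → ℝ≥0∞) (p : List α × α) : ℝ≥0∞ :=
  (∏ i : Fin p.1.length, rej i (p.1.get i)) * acc p.1.length p.2

lemma runWeight_nil (rej acc : ℕ → α → ℝ≥0∞) (f : α) : runWeight rej acc ([], f) = acc 0 f := by
  simp [runWeight]

lemma runWeight_cons (rej acc : ℕ → α → ℝ≥0∞) (a : α) (l : List α) (f : α) :
    runWeight rej acc (a :: l, f) =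
      rej 0 a * runWeight (fun i => rej (i + 1)) (fun i => acc (i + 1)) (l, f) := by
  simp only [runWeight, List.length_cons]
  rw [Fin.prod_univ_succ, mul_assoc]
  rfl

lemma truncSum_runWeight_succ (N : ℕ) (rej acc : ℕ → α → ℝ≥0∞) :
    truncSum (N + 1) (runWeight rej acc) = ∑' f, acc 0 f +
      (∑' a, rej 0 a) *
        truncSum N (runWeight (fun i => rej (i + 1)) fun i => acc (i + 1)) := by
  simp only [truncSum_succ, runWeight_nil, runWeight_cons, truncSum_mul_left,
    ENNReal.tsum_mul_right]

lemma truncSum_runWeight_le_one (N : ℕ) (rej acc : ℕ → α → ℝ≥0∞)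
    (h : ∀ i, ∑' a, (rej i a + acc i a) = 1) : truncSum N (runWeight rej acc) ≤ 1 := by
  induction N generalizing rej acc with
  | zero => simp [truncSum_zero]
  | succ N ih =>
    rw [truncSum_runWeight_succ, ← h 0, ENNReal.tsum_add, add_comm]
    gcongr
    exact mul_le_of_le_one_right' (ih _ _ fun i => h (i + 1))

/-- The mass still unaccounted for after `N` repetitions is that of `N` rejections in a row. -/
lemma one_le_truncSum_runWeight_add (N : ℕ) (rej acc : ℕ → α → ℝ≥0∞)
    (h : ∀ i, ∑' a, (rej i a + acc i a) = 1) {q : ℝ≥0∞} (hq : ∀ i, ∑' a, rej i a ≤ q) :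
    1 ≤ truncSum N (runWeight rej acc) + q ^ N := by
  induction N generalizing rej acc with
  | zero => simp
  | succ N ih =>
    have h1 := ih _ _ (fun i => h (i + 1)) fun i => hq (i + 1)
    rw [truncSum_runWeight_succ, add_assoc]
    calc (1 : ℝ≥0∞) = ∑' f, acc 0 f + (∑' a, rej 0 a) * 1 := by
          rw [mul_one, add_comm, ← ENNReal.tsum_add, h 0]
      _ ≤ ∑' f, acc 0 f + (∑' a, rej 0 a) *
          (truncSum N (runWeight (fun i => rej (i + 1)) fun i => acc (i + 1)) + q ^ N) := by gcongr
      _ ≤ _ := by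
          rw [mul_add, pow_succ']
          gcongr
          exact hq 0

theorem tsum_runWeight (rej acc : ℕ → α → ℝ≥0∞)
    (h : ∀ i, ∑' a, (rej i a + acc i a) = 1) {q : ℝ≥0∞} (hq : ∀ i, ∑' a, rej i a ≤ q)
    (hq1 : q < 1) : ∑' p, runWeight rej acc p = 1 := by
  refine le_antisymm (tsum_le_of_truncSum_le fun N => truncSum_runWeight_le_one N rej acc h) ?_
  have hlim : Filter.Tendsto (fun N : ℕ => (∑' p, runWeight rej acc p) + q ^ N) Filter.atTop
      (nhds ((∑' p, runWeight rej acc p) + 0)) :=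
    (ENNReal.tendsto_pow_atTop_nhds_zero_of_lt_one hq1).const_add _
  rw [add_zero] at hlim
  refine ge_of_tendsto' hlim fun N => ?_
  exact (one_le_truncSum_runWeight_add N rej acc h hq).trans (by gcongr; exact truncSum_le N _)

/-- Expected total cost when the cost of an attempt is `h`. -/
theorem tsum_runWeight_mul_sum_le (rej acc : ℕ → α → ℝ≥0∞)
    (h : ∀ i, ∑' a, (rej i a + acc i a) = 1) {q : ℝ≥0∞} (hq : ∀ i, ∑' a, rej i a ≤ q)
    (cost : α → ℝ≥0∞) {H K : ℝ≥0∞} (hH : ∀ i, ∑' a, (rej i a + acc i a) * cost a ≤ H)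
    (hK : H + q * K ≤ K) :
    ∑' p, runWeight rej acc p * ((p.1.map cost).sum + cost p.2) ≤ K := by
  refine tsum_le_of_truncSum_le fun N => ?_
  induction N generalizing rej acc with
  | zero => simp [truncSum_zero]
  | succ N ih =>
    set W := runWeight (fun i => rej (i + 1)) fun i => acc (i + 1)
    have h1 := ih _ _ (fun i => h (i + 1)) (fun i => hq (i + 1)) (fun i => hH (i + 1))
    have h2 : truncSum N W ≤ 1 := truncSum_runWeight_le_one N _ _ fun i => h (i + 1)
    have h3 : ∀ a, truncSum N (fun p => runWeight rej acc (a :: p.1, p.2) *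
        (((a :: p.1).map cost).sum + cost p.2)) =
        rej 0 a * cost a * truncSum N W +
          rej 0 a * truncSum N (fun p => W p * ((p.1.map cost).sum + cost p.2)) := fun a => by
      rw [← truncSum_mul_left, ← truncSum_mul_left, ← truncSum_add]
      congr 1
      funext p
      rw [runWeight_cons, List.map_cons, List.sum_cons]
      ring
    rw [truncSum_succ]
    simp only [h3]
    simp only [runWeight_nil, List.map_nil, List.sum_nil, zero_add]
    rw [ENNReal.tsum_add, ENNReal.tsum_mul_right, ENNReal.tsum_mul_right, ← add_assoc]
    -- The first try costs at most `H` on average, accepted or not; with probability at most `q` it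
    -- is followed by a run of expected cost at most `K`.
    refine le_trans (add_le_add (le_trans (add_le_add_right
      (mul_le_of_le_one_right' h2) _) (le_trans (le_of_eq ?_) (hH 0))) (mul_le_mul' (hq 0) h1)) hK
    rw [← ENNReal.tsum_add]
    exact tsum_congr fun a => by ring

/-- Expectation of a product over the attempts. -/
theorem tsum_runWeight_mul_prod_le (rej acc : ℕ → α → ℝ≥0∞) (g : α → ℝ≥0∞) {Φ Q K : ℝ≥0∞}
    (hΦ : ∀ i, ∑' a, acc i a * g a ≤ Φ) (hQ : ∀ i, ∑' a, rej i a * g a ≤ Q)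
    (hK : Φ + Q * K ≤ K) :
    ∑' p, runWeight rej acc p * ((p.1.map g).prod * g p.2) ≤ K := by
  refine tsum_le_of_truncSum_le fun N => ?_
  induction N generalizing rej acc with
  | zero => simp [truncSum_zero]
  | succ N ih =>
    set W := runWeight (fun i => rej (i + 1)) fun i => acc (i + 1)
    have h1 := ih _ _ (fun i => hΦ (i + 1)) (fun i => hQ (i + 1))
    have h3 : ∀ a, truncSum N (fun p => runWeight rej acc (a :: p.1, p.2) *
        (((a :: p.1).map g).prod * g p.2)) =
          rej 0 a * g a * truncSum N (fun p => W p * ((p.1.map g).prod * g p.2)) := fun a => by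
      rw [← truncSum_mul_left]
      congr 1
      funext p
      rw [runWeight_cons, List.map_cons, List.prod_cons]
      ring
    rw [truncSum_succ]
    simp only [h3]
    simp only [runWeight_nil, List.map_nil, List.prod_nil, one_mul]
    rw [ENNReal.tsum_mul_right]
    exact (add_le_add (hΦ 0) (mul_le_mul' (hQ 0) h1)).trans hK

/-- Runs without inner structure are given by the number of rejected attempts. -/
def unitRunEquiv : List Unit × Unit ≃ ℕ where
  toFun p := p.1.length
  invFun r := (List.replicate r (), ())
  left_inv p := Prod.ext (List.eq_replicate_length.2 fun _ _ => rfl).symm rfl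
  right_inv r := by simp

end Repeat

end Distill

namespace Distill

open scoped ENNReal

/-! ### States of bounded infidelity -/

/-- The trace and the Bell overlap of the operator are real and nonnegative and the relative
infidelity is at most `η`. -/
def Regular {n : ℕ} (σ : Op n) (η : ℝ) : Prop :=
  ∃ t f : ℝ, σ.trace = t ∧ (bell n * σ).trace = f ∧ 0 ≤ f ∧ f ≤ t ∧ (1 - η) * t ≤ f

section Regular

variable {n k : ℕ} {σ : Op n} {η : ℝ}

lemma Regular.trace_nonneg (h : Regular σ η) : 0 ≤ σ.trace.re := by
  obtain ⟨t, f, ht, -, h0, hft, -⟩ := h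
  rw [ht, Complex.ofReal_re]; linarith

lemma Regular.bellOverlap_nonneg (h : Regular σ η) : 0 ≤ bellOverlap σ := by
  obtain ⟨t, f, -, hf, h0, -, -⟩ := h
  rw [bellOverlap, hf, Complex.ofReal_re]; exact h0

lemma Regular.bellOverlap_le (h : Regular σ η) : bellOverlap σ ≤ σ.trace.re := by
  obtain ⟨t, f, ht, hf, -, h0, -⟩ := h
  rw [bellOverlap, ht, hf, Complex.ofReal_re, Complex.ofReal_re]; exact h0

lemma Regular.le_bellOverlap (h : Regular σ η) : (1 - η) * σ.trace.re ≤ bellOverlap σ := by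
  obtain ⟨t, f, ht, hf, -, -, h0⟩ := h
  rw [bellOverlap, ht, hf, Complex.ofReal_re, Complex.ofReal_re]; exact h0

lemma Regular.smul (h : Regular σ η) {c : ℝ} (hc : 0 ≤ c) : Regular ((c : ℂ) • σ) η := by
  obtain ⟨t, f, ht, hf, h0, h1, h2⟩ := h
  refine ⟨c * t, c * f, ?_, ?_, mul_nonneg hc h0, mul_le_mul_of_nonneg_left h1 hc, ?_⟩
  · rw [Matrix.trace_smul, ht]; simp
  · rw [Matrix.mul_smul, Matrix.trace_smul, hf]; simp
  · have := mul_le_mul_of_nonneg_left h2 hc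
    linarith

lemma bell_isHermitian (n : ℕ) : (bell n)ᴴ = bell n := by
  ext p q
  simp only [Matrix.conjTranspose_apply, bell, and_comm (a := q.1 = q.2)]
  split_ifs <;> simp

/-- Positivity enters only here: `f` and `1 - f` are the traces of `ρ` compressed by the Bell
projector and by its complement. -/
lemma IsState.regular {ρ : Op n} (h : IsState ρ) {η : ℝ} (hη : 1 - η ≤ bellOverlap ρ) :
    Regular ρ η := by
  have h1 : 0 ≤ (bell n * ρ).trace := by
    have := (h.1.mul_mul_conjTranspose_same (bell n)).trace_nonneg
    rwa [bell_isHermitian, Matrix.trace_mul_comm, ← Matrix.mul_assoc, bell_mul_bell] at this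
  have h2 : 0 ≤ ((1 - bell n) * ρ).trace := by
    have := (h.1.mul_mul_conjTranspose_same (1 - bell n)).trace_nonneg
    have h3 : (1 - bell n) * (1 - bell n) = 1 - bell n := by
      rw [mul_sub, sub_mul, sub_mul, bell_mul_bell]; simp
    rwa [Matrix.conjTranspose_sub, Matrix.conjTranspose_one, bell_isHermitian,
      Matrix.trace_mul_comm, ← Matrix.mul_assoc, h3] at this
  rw [Complex.nonneg_iff] at h1 h2
  refine ⟨1, (bell n * ρ).trace.re, by simp [h.2], ?_, h1.1, ?_, by simpa [bellOverlap] using hη⟩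
  · exact Complex.ext rfl h1.2.symm
  · rw [sub_mul, Matrix.trace_sub, one_mul, h.2] at h2
    simpa using h2.1

/-- As `θ ≤ 1/2`, one has `t - f ≤ f`, and `f` is at most the trace of the accepted state; so the
absolute gain `2^(-(n-k))` is also a relative one, independent of `θ`. -/
lemma Regular.accept {θ : ℝ} (hθ : θ ≤ 1 / 2) (B : Box n k) {X : Op n} (h : Regular X θ) :
    Regular (B.accept X) ((2 : ℝ) ^ (n - k))⁻¹ := by
  obtain ⟨t, f, ht, hf, h0, h1, h2⟩ := h
  have g1 := le_acceptOverlap (k := k) B.two_le h1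
  have g2 := acceptOverlap_le_acceptTrace (k := k) B.two_le h1
  have g3 := acceptTrace_sub_acceptOverlap_le B.two_le B.le h1
  refine ⟨_, _, B.trace_accept ht hf, B.trace_bell_mul_accept ht hf, h0.trans g1, g2, ?_⟩
  have hp : (0 : ℝ) < 2 ^ (n - k) := by positivity
  have g4 : t - f ≤ Box.acceptTrace n k t f := by nlinarith
  have g5 : Box.acceptTrace n k t f - Box.acceptOverlap n k t f ≤
      ((2 : ℝ) ^ (n - k))⁻¹ * Box.acceptTrace n k t f := by
    rw [inv_mul_eq_div, le_div_iff₀ hp]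
    exact g3.trans g4
  linarith

lemma Regular.reject_add (B : Box n k) {X : Op n} (h : Regular X η) :
    B.reject X + (B.accept X).trace.re = X.trace.re := by
  obtain ⟨t, f, ht, hf, h0, h1, h2⟩ := h
  rw [B.reject_eq ht hf, B.trace_accept ht hf, ht, Complex.ofReal_re, Complex.ofReal_re]; ring

lemma Regular.reject_nonneg (B : Box n k) {X : Op n} (h : Regular X η) : 0 ≤ B.reject X := by
  obtain ⟨t, f, ht, hf, h0, h1, h2⟩ := h
  rw [B.reject_eq ht hf]
  exact sub_nonneg.2 (acceptTrace_le B.two_le B.le h1)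

/-- The Bell component is never rejected, which leaves at most `t - f`. -/
lemma Regular.reject_le (B : Box n k) {X : Op n} (h : Regular X η) :
    B.reject X ≤ η * X.trace.re := by
  obtain ⟨t, f, ht, hf, h0, h1, h2⟩ := h
  rw [B.reject_eq ht hf, ht, Complex.ofReal_re]
  have g1 := le_acceptOverlap (k := k) B.two_le h1
  have g2 := acceptOverlap_le_acceptTrace (k := k) B.two_le h1
  linarith

/-- Traces and overlaps multiply over the blocks, and Bernoulli's inequality gives `1 - c * η ≤ (1 -
η)^c`. -/
lemma Regular.blockTensor {c : ℕ} {σ : Fin c → Op k} (h : ∀ j, Regular (σ j) η) (hη : η ≤ 1) :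
    Regular (blockTensor σ) (c * η) := by
  choose t f ht hf h0 h1 h2 using h
  refine ⟨∏ j, t j, ∏ j, f j, ?_, ?_, Finset.prod_nonneg fun j _ => h0 j,
    Finset.prod_le_prod (fun j _ => h0 j) fun j _ => h1 j, ?_⟩
  · rw [trace_blockTensor]; simp [ht]
  · rw [trace_bell_mul_blockTensor]; simp [hf]
  · have ht0 : ∀ j, 0 ≤ t j := fun j => (h0 j).trans (h1 j)
    calc (1 - c * η) * ∏ j, t j ≤ (1 - η) ^ c * ∏ j, t j := by
          refine mul_le_mul_of_nonneg_right ?_ (Finset.prod_nonneg fun j _ => ht0 j)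
          have := one_add_mul_le_pow (a := -η) (by linarith) c
          calc 1 - c * η = 1 + c * -η := by ring
            _ ≤ _ := this
            _ = _ := by ring
      _ = ∏ j, (1 - η) * t j := by simp [Finset.prod_mul_distrib]
      _ ≤ ∏ j, f j := Finset.prod_le_prod (fun j _ => mul_nonneg (by linarith) (ht0 j))
          fun j _ => h2 j

end Regular

/-! ### Analysis of a concatenated protocol -/

namespace Scheme

variable {b : ℕ}

/-- The probability of a history. -/
noncomputable def weight (ρ : List ℕ → Op b) {k : ℕ} (S : Scheme b k) (w : List ℕ) (r : S.Run) :
    ℝ≥0∞ :=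
  ENNReal.ofReal (S.outState ρ w r).trace.re

/-- Bounds for a protocol all of whose input blocks have infidelity at most `θ`: the infidelity `η`
of the output for any history, the expected numbers `E` and `G` of input pairs and gates, and the
exponential moment `φ` of the depth to base `x`. -/
structure Bounds {k : ℕ} (S : Scheme b k) (θ η : ℝ) (E G : ℝ≥0∞) (x φ : ℝ≥0∞) : Prop where
  regular : ∀ ρ : List ℕ → Op b, (∀ w, Regular (ρ w) θ ∧ (ρ w).trace = 1) →
    ∀ w r, Regular (S.outState ρ w r) η
  total : ∀ ρ : List ℕ → Op b, (∀ w, Regular (ρ w) θ ∧ (ρ w).trace = 1) →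
    ∀ w, ∑' r, S.weight ρ w r = 1
  pairs : ∀ ρ : List ℕ → Op b, (∀ w, Regular (ρ w) θ ∧ (ρ w).trace = 1) →
    ∀ w, ∑' r, S.weight ρ w r * S.pairs r ≤ E
  gates : ∀ ρ : List ℕ → Op b, (∀ w, Regular (ρ w) θ ∧ (ρ w).trace = 1) →
    ∀ w, ∑' r, S.weight ρ w r * S.gates r ≤ G
  depth : ∀ ρ : List ℕ → Op b, (∀ w, Regular (ρ w) θ ∧ (ρ w).trace = 1) →
    ∀ w, ∑' r, S.weight ρ w r * x ^ S.depth r ≤ φ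

section First

variable {k : ℕ} (B : Box b k)

lemma weight_first {θ : ℝ} {ρ : List ℕ → Op b} (hρ : ∀ w, Regular (ρ w) θ) (w : List ℕ)
    (p : List Unit × Unit) :
    (first B).weight ρ w (unitRunEquiv p) =
      runWeight (fun i _ => ENNReal.ofReal (B.reject (ρ (i :: w))))
        (fun i _ => ENNReal.ofReal (B.accept (ρ (i :: w))).trace.re) p := by
  have hn : ∀ i, 0 ≤ B.reject (ρ (i :: w)) := fun i => (hρ _).reject_nonneg B
  have h1 : (first B).outState ρ w (unitRunEquiv p) =
      ((∏ i ∈ Finset.range p.1.length, B.reject (ρ (i :: w)) : ℝ) : ℂ) •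
        B.accept (ρ (p.1.length :: w)) := rfl
  unfold weight
  rw [h1, Matrix.trace_smul, smul_eq_mul, Complex.re_ofReal_mul,
    ENNReal.ofReal_mul (Finset.prod_nonneg fun i _ => hn i), runWeight,
    ENNReal.ofReal_prod_of_nonneg fun i _ => hn i, Finset.prod_range]

lemma tsum_first (F : ℕ → ℝ≥0∞) :
    ∑' r : (first B).Run, F r = ∑' p : List Unit × Unit, F (unitRunEquiv p) :=
  (unitRunEquiv.tsum_eq F).symm

/-- The hypotheses on `E`, `G` and `φ` are renewal inequalities with rejection probability `θ`. In
the multiplicative one for the depth, a rejected try also pays the factor `x ^ B.depth`. -/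
theorem bounds_first {θ : ℝ} (hθ : θ ≤ 1 / 2) {E G x φ : ℝ≥0∞}
    (hE : b + ENNReal.ofReal θ * E ≤ E) (hG : B.gates + ENNReal.ofReal θ * G ≤ G)
    (hφ : x ^ B.depth + ENNReal.ofReal θ * x ^ B.depth * φ ≤ φ) :
    (first B).Bounds θ ((2 : ℝ) ^ (b - k))⁻¹ E G x φ := by
  have hsum : ∀ ρ : List ℕ → Op b, (∀ w, Regular (ρ w) θ ∧ (ρ w).trace = 1) → ∀ w,
      ENNReal.ofReal (B.reject (ρ w)) + ENNReal.ofReal (B.accept (ρ w)).trace.re = 1 := by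
    intro ρ hρ w
    rw [← ENNReal.ofReal_add ((hρ w).1.reject_nonneg B) ((hρ w).1.accept hθ B).trace_nonneg,
      (hρ w).1.reject_add B, (hρ w).2]
    simp
  have hrej : ∀ ρ : List ℕ → Op b, (∀ w, Regular (ρ w) θ ∧ (ρ w).trace = 1) → ∀ w,
      ENNReal.ofReal (B.reject (ρ w)) ≤ ENNReal.ofReal θ := by
    intro ρ hρ w
    refine ENNReal.ofReal_le_ofReal (((hρ w).1.reject_le B).trans ?_)
    rw [(hρ w).2]; simp
  have hq : ENNReal.ofReal θ < 1 := by
    rw [ENNReal.ofReal_lt_one]; linarith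
  refine ⟨fun ρ hρ w r => ?_, fun ρ hρ w => ?_, fun ρ hρ w => ?_, fun ρ hρ w => ?_,
    fun ρ hρ w => ?_⟩
  · exact ((hρ _).1.accept hθ B).smul
      (Finset.prod_nonneg fun i _ => (hρ _).1.reject_nonneg B)
  · rw [tsum_first B fun r => (first B).weight ρ w r]
    simp only [weight_first B (fun w => (hρ w).1)]
    exact tsum_runWeight _ _ (fun i => by simp [hsum ρ hρ]) (fun i => by simpa using hrej ρ hρ _) hq
  · rw [tsum_first B fun r => (first B).weight ρ w r * (first B).pairs r]
    have hc : ∀ p : List Unit × Unit, (((first B).pairs (unitRunEquiv p) : ℕ) : ℝ≥0∞) =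
        (p.1.map fun _ => (b : ℝ≥0∞)).sum + b := fun p => by
      have : (first B).pairs (unitRunEquiv p) = (p.1.length + 1) * b := rfl
      rw [this]; push_cast
      simp; ring
    simp only [weight_first B (fun w => (hρ w).1), hc]
    exact tsum_runWeight_mul_sum_le _ _ (fun i => by simp [hsum ρ hρ])
      (fun i => by simpa using hrej ρ hρ _) (fun _ => (b : ℝ≥0∞)) (fun i => by simp [hsum ρ hρ]) hE
  · rw [tsum_first B fun r => (first B).weight ρ w r * (first B).gates r]
    have hc : ∀ p : List Unit × Unit, (((first B).gates (unitRunEquiv p) : ℕ) : ℝ≥0∞) =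
        (p.1.map fun _ => (B.gates : ℝ≥0∞)).sum + B.gates := fun p => by
      have : (first B).gates (unitRunEquiv p) = (p.1.length + 1) * B.gates := rfl
      rw [this]; push_cast
      simp; ring
    simp only [weight_first B (fun w => (hρ w).1), hc]
    exact tsum_runWeight_mul_sum_le _ _ (fun i => by simp [hsum ρ hρ])
      (fun i => by simpa using hrej ρ hρ _) (fun _ => (B.gates : ℝ≥0∞))
      (fun i => by simp [hsum ρ hρ]) hG
  · rw [tsum_first B fun r => (first B).weight ρ w r * x ^ (first B).depth r]
    have hc : ∀ p : List Unit × Unit, x ^ (first B).depth (unitRunEquiv p) =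
        (p.1.map fun _ => x ^ B.depth).prod * x ^ B.depth := fun p => by
      have : (first B).depth (unitRunEquiv p) = (p.1.length + 1) * B.depth := rfl
      rw [this, mul_comm, pow_mul, pow_succ]
      simp
    simp only [weight_first B (fun w => (hρ w).1), hc]
    refine tsum_runWeight_mul_prod_le _ _ (fun _ => x ^ B.depth) (fun i => ?_) (fun i => ?_) hφ
    · have : ENNReal.ofReal (B.accept (ρ (i :: w))).trace.re ≤ 1 := by
        rw [← hsum ρ hρ (i :: w)]; exact le_add_self
      simpa using mul_le_of_le_one_left' this
    · simpa using mul_le_mul' (hrej ρ hρ (i :: w)) le_rfl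

end First

end Scheme

end Distill

/-! ### Adding a layer to a concatenated protocol -/

namespace Distill

open scoped ENNReal

namespace Scheme

variable {b : ℕ}

section Next

variable {k k' c : ℕ} {S : Scheme b k} {B : Box (c * k) k'} {ρ : List ℕ → Op b}

/-- The input of the `i`-th attempt of the top box with address `w`. -/
noncomputable def boxInput (ρ : List ℕ → Op b) (S : Scheme b k) (w : List ℕ) (i : ℕ) (a : Fin c → S.Run) :
    Op (c * k) :=
  blockTensor fun j => S.outState ρ (j :: i :: w) (a j)

lemma ofReal_trace_boxInput {η : ℝ} (h : ∀ w r, Regular (S.outState ρ w r) η) (w : List ℕ) (i : ℕ)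
    (a : Fin c → S.Run) :
    ENNReal.ofReal (boxInput ρ S w i a).trace.re = ∏ j : Fin c, S.weight ρ (j :: i :: w) (a j) := by
  have h1 : ∀ j : Fin c, (S.outState ρ (j :: i :: w) (a j)).trace =
      ((S.outState ρ (j :: i :: w) (a j)).trace.re : ℂ) := fun j => by
    obtain ⟨t, f, ht, -⟩ := h (j :: i :: w) (a j)
    rw [ht, Complex.ofReal_re]
  rw [boxInput, trace_blockTensor, Finset.prod_congr rfl fun j _ => h1 j, ← Complex.ofReal_prod,
    Complex.ofReal_re, ENNReal.ofReal_prod_of_nonneg fun j _ => (h _ _).trace_nonneg]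
  rfl

lemma weight_next {θ : ℝ} (h : ∀ w i (a : Fin c → S.Run), Regular (boxInput ρ S w i a) θ)
    (w : List ℕ) (p : List (Fin c → S.Run) × (Fin c → S.Run)) :
    (next S c B).weight ρ w p =
      runWeight (fun i a => ENNReal.ofReal (B.reject (boxInput ρ S w i a)))
        (fun i a => ENNReal.ofReal (B.accept (boxInput ρ S w i a)).trace.re) p := by
  have h1 : (next S c B).outState ρ w p =
      ((∏ i : Fin p.1.length, B.reject (boxInput ρ S w i (p.1.get i)) : ℝ) : ℂ) •
        B.accept (boxInput ρ S w p.1.length p.2) := rfl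
  unfold weight
  rw [h1, Matrix.trace_smul, smul_eq_mul, Complex.re_ofReal_mul,
    ENNReal.ofReal_mul (Finset.prod_nonneg fun i _ => (h _ _ _).reject_nonneg B), runWeight,
    ENNReal.ofReal_prod_of_nonneg fun i _ => (h _ _ _).reject_nonneg B]

/-- The inputs of a box are independent, so tuples of histories carry product weights and mean costs
are at most `c` times those of one input. The box then repeats with rejection probability at most `c
* η`, and the renewal bounds apply. -/
theorem Bounds.next {θ η : ℝ} {E G x φ : ℝ≥0∞} (hS : S.Bounds θ η E G x φ) (B : Box (c * k) k')
    (hη : η ≤ 1) (hcη : c * η ≤ 1 / 2) {E' G' φ' : ℝ≥0∞}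
    (hE : c * E + ENNReal.ofReal (c * η) * E' ≤ E')
    (hG : c * G + B.gates + ENNReal.ofReal (c * η) * G' ≤ G')
    (hφ : c * φ * x ^ B.depth + ENNReal.ofReal (c * η) * (c * φ * x ^ B.depth) * φ' ≤ φ') :
    (Scheme.next S c B).Bounds θ ((2 : ℝ) ^ (c * k - k'))⁻¹ E' G' x φ' := by
  have hc : 0 < c := by
    rcases Nat.eq_zero_or_pos c with rfl | hc
    · have := B.two_le; omega
    · exact hc
  have hq : ENNReal.ofReal (c * η) < 1 := by
    rw [ENNReal.ofReal_lt_one]; linarith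
  have hreg : ∀ ρ : List ℕ → Op b, (∀ w, Regular (ρ w) θ ∧ (ρ w).trace = 1) →
      ∀ w i (a : Fin c → S.Run), Regular (boxInput ρ S w i a) (c * η) := fun ρ hρ w i a =>
    Regular.blockTensor (fun j => hS.regular ρ hρ _ _) hη
  have hadd : ∀ ρ : List ℕ → Op b, (∀ w, Regular (ρ w) θ ∧ (ρ w).trace = 1) →
      ∀ w i (a : Fin c → S.Run), ENNReal.ofReal (B.reject (boxInput ρ S w i a)) +
        ENNReal.ofReal (B.accept (boxInput ρ S w i a)).trace.re =
          ∏ j : Fin c, S.weight ρ (j :: i :: w) (a j) := fun ρ hρ w i a => by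
    rw [← ENNReal.ofReal_add ((hreg ρ hρ w i a).reject_nonneg B)
      ((hreg ρ hρ w i a).accept hcη B).trace_nonneg, (hreg ρ hρ w i a).reject_add B,
      ofReal_trace_boxInput (hS.regular ρ hρ)]
  -- This holds for every tuple of input histories, hence also when weighted by the cost: a
  -- rejection cannot be strongly correlated with a long run below.
  have hrej : ∀ ρ : List ℕ → Op b, (∀ w, Regular (ρ w) θ ∧ (ρ w).trace = 1) →
      ∀ w i (a : Fin c → S.Run), ENNReal.ofReal (B.reject (boxInput ρ S w i a)) ≤
        ENNReal.ofReal (c * η) * ∏ j : Fin c, S.weight ρ (j :: i :: w) (a j) :=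
    fun ρ hρ w i a => by
      rw [← ofReal_trace_boxInput (hS.regular ρ hρ),
        ← ENNReal.ofReal_mul' (hreg ρ hρ w i a).trace_nonneg]
      exact ENNReal.ofReal_le_ofReal ((hreg ρ hρ w i a).reject_le B)
  have htot : ∀ ρ : List ℕ → Op b, (∀ w, Regular (ρ w) θ ∧ (ρ w).trace = 1) →
      ∀ w i, ∑' a : Fin c → S.Run, ∏ j : Fin c, S.weight ρ (j :: i :: w) (a j) = 1 :=
    fun ρ hρ w i => by
      rw [tsum_pi_prod fun (j : Fin c) r => S.weight ρ (j :: i :: w) r]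
      exact Finset.prod_eq_one fun j _ => hS.total ρ hρ _
  have hmean : ∀ ρ : List ℕ → Op b, (∀ w, Regular (ρ w) θ ∧ (ρ w).trace = 1) →
      ∀ w i (h : S.Run → ℝ≥0∞) (H : ℝ≥0∞), (∀ w, ∑' r, S.weight ρ w r * h r ≤ H) →
        ∑' a : Fin c → S.Run, (∏ j : Fin c, S.weight ρ (j :: i :: w) (a j)) * ∑ j, h (a j) ≤
          c * H := fun ρ hρ w i h H hH => by
    simp only [Finset.mul_sum]
    rw [Summable.tsum_finsetSum fun _ _ => ENNReal.summable]
    calc _ = ∑ j : Fin c, ∑' r, S.weight ρ (j :: i :: w) r * h r :=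
          Finset.sum_congr rfl fun l _ => tsum_pi_prod_mul
            (fun (j : Fin c) r => S.weight ρ (j :: i :: w) r) (fun j => hS.total ρ hρ _) h l
      _ ≤ ∑ _j : Fin c, H := Finset.sum_le_sum fun j _ => hH _
      _ = c * H := by simp
  have hone : ∀ ρ : List ℕ → Op b, (∀ w, Regular (ρ w) θ ∧ (ρ w).trace = 1) → ∀ w i,
      ∑' a : Fin c → S.Run, (ENNReal.ofReal (B.reject (boxInput ρ S w i a)) +
        ENNReal.ofReal (B.accept (boxInput ρ S w i a)).trace.re) = 1 := fun ρ hρ w i => by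
    simp only [hadd ρ hρ, htot ρ hρ]
  have hle : ∀ ρ : List ℕ → Op b, (∀ w, Regular (ρ w) θ ∧ (ρ w).trace = 1) → ∀ w i,
      ∑' a : Fin c → S.Run, ENNReal.ofReal (B.reject (boxInput ρ S w i a)) ≤
        ENNReal.ofReal (c * η) := fun ρ hρ w i => by
    refine (ENNReal.tsum_le_tsum fun a => hrej ρ hρ w i a).trans ?_
    rw [ENNReal.tsum_mul_left, htot ρ hρ, mul_one]
  refine ⟨fun ρ hρ w r => ?_, fun ρ hρ w => ?_, fun ρ hρ w => ?_, fun ρ hρ w => ?_,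
    fun ρ hρ w => ?_⟩
  · exact ((hreg ρ hρ w _ _).accept hcη B).smul
      (Finset.prod_nonneg fun i _ => (hreg ρ hρ w _ _).reject_nonneg B)
  · exact (tsum_congr (weight_next (hreg ρ hρ) w)).trans
      (tsum_runWeight _ _ (hone ρ hρ w) (hle ρ hρ w) hq)
  · have hcost : ∀ p : List (Fin c → S.Run) × (Fin c → S.Run),
        (((Scheme.next S c B).pairs p : ℕ) : ℝ≥0∞) =
          (p.1.map fun a => ∑ j, (S.pairs (a j) : ℝ≥0∞)).sum + ∑ j, (S.pairs (p.2 j) : ℝ≥0∞) :=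
      fun p => by
        have : (Scheme.next S c B).pairs p =
          (p.1.map fun a => ∑ j, S.pairs (a j)).sum + ∑ j, S.pairs (p.2 j) := rfl
        rw [this]
        push_cast [List.map_map]
        simp [Function.comp_def]
    have key := tsum_runWeight_mul_sum_le _ _ (hone ρ hρ w) (hle ρ hρ w)
      (fun a : Fin c → S.Run => ∑ j, (S.pairs (a j) : ℝ≥0∞)) (H := c * E) (fun i => by
        simp only [hadd ρ hρ]
        exact hmean ρ hρ w i _ _ (hS.pairs ρ hρ)) hE
    exact le_of_eq_of_le (tsum_congr fun p =>
      congrArg₂ (· * ·) (weight_next (hreg ρ hρ) w p) (hcost p)) key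
  · have hcost : ∀ p : List (Fin c → S.Run) × (Fin c → S.Run),
        (((Scheme.next S c B).gates p : ℕ) : ℝ≥0∞) =
          (p.1.map fun a => ∑ j, (S.gates (a j) : ℝ≥0∞) + B.gates).sum +
            (∑ j, (S.gates (p.2 j) : ℝ≥0∞) + B.gates) :=
      fun p => by
        have : (Scheme.next S c B).gates p = (p.1.map fun a => ∑ j, S.gates (a j) + B.gates).sum +
          (∑ j, S.gates (p.2 j) + B.gates) := rfl
        rw [this]
        push_cast [List.map_map]
        simp [Function.comp_def]
    have key := tsum_runWeight_mul_sum_le _ _ (hone ρ hρ w) (hle ρ hρ w)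
      (fun a : Fin c → S.Run => ∑ j, (S.gates (a j) : ℝ≥0∞) + B.gates) (H := c * G + B.gates)
      (fun i => by
        simp only [hadd ρ hρ, mul_add]
        rw [ENNReal.tsum_add, ENNReal.tsum_mul_right, htot ρ hρ, one_mul]
        gcongr
        exact hmean ρ hρ w i _ _ (hS.gates ρ hρ)) hG
    exact le_of_eq_of_le (tsum_congr fun p =>
      congrArg₂ (· * ·) (weight_next (hreg ρ hρ) w p) (hcost p)) key
  · let g : (Fin c → S.Run) → ℝ≥0∞ := fun a =>
      x ^ ((Finset.univ.sup fun j => S.depth (a j)) + B.depth)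
    have hcost : ∀ p : List (Fin c → S.Run) × (Fin c → S.Run),
        x ^ (Scheme.next S c B).depth p = (p.1.map g).prod * g p.2 := by
      rintro ⟨l, f⟩
      have : (Scheme.next S c B).depth (l, f) =
        (l.map fun a => (Finset.univ.sup fun j => S.depth (a j)) + B.depth).sum +
          ((Finset.univ.sup fun j => S.depth (f j)) + B.depth) := rfl
      rw [this, pow_add]
      congr 1
      induction l with
      | nil => simp
      | cons a l ih => rw [List.map_cons, List.sum_cons, pow_add, ih rfl, List.map_cons,
          List.prod_cons]
    -- The parallel runs last as long as the slowest one; the exponential of a maximum is at most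
    -- the sum of the exponentials.
    have hg : ∀ a, g a ≤ (∑ j, x ^ S.depth (a j)) * x ^ B.depth := fun a => by
      have : Nonempty (Fin c) := ⟨⟨0, hc⟩⟩
      obtain ⟨j, -, hj⟩ := Finset.exists_mem_eq_sup Finset.univ Finset.univ_nonempty
        fun j => S.depth (a j)
      simp only [g]
      rw [hj, pow_add]
      gcongr
      exact Finset.single_le_sum (f := fun j => x ^ S.depth (a j)) (fun _ _ => zero_le)
        (Finset.mem_univ j)
    have hmoment : ∀ i, ∑' a : Fin c → S.Run,
        (∏ j : Fin c, S.weight ρ (j :: i :: w) (a j)) * g a ≤ c * φ * x ^ B.depth := fun i => by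
      refine (ENNReal.tsum_le_tsum fun a => mul_le_mul_right (hg a) _).trans ?_
      simp only [← mul_assoc]
      rw [ENNReal.tsum_mul_right]
      gcongr
      exact hmean ρ hρ w i _ _ (hS.depth ρ hρ)
    have key := tsum_runWeight_mul_prod_le
      (fun i a => ENNReal.ofReal (B.reject (boxInput ρ S w i a)))
      (fun i a => ENNReal.ofReal (B.accept (boxInput ρ S w i a)).trace.re) g (fun i => by
        refine (ENNReal.tsum_le_tsum fun a => mul_le_mul_left ?_ _).trans (hmoment i)
        rw [← hadd ρ hρ]
        exact le_add_self) (fun i => by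
        refine (ENNReal.tsum_le_tsum fun a => mul_le_mul_left (hrej ρ hρ w i a) _).trans ?_
        simp only [mul_assoc]
        rw [ENNReal.tsum_mul_left]
        gcongr
        simpa only [mul_assoc] using hmoment i) hφ
    exact le_of_eq_of_le (tsum_congr fun p =>
      congrArg₂ (· * ·) (weight_next (hreg ρ hρ) w p) (hcost p)) key

end Next

end Scheme

end Distill

/-! ### Budgets and repeated tries of the whole protocol -/

namespace Distill

open scoped ENNReal

/-- Markov's inequality. -/
lemma tsum_mul_ite_le {α : Type*} (W f : α → ℝ≥0∞) {y : ℝ≥0∞} (hy0 : y ≠ 0) (hy : y ≠ ⊤) :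
    ∑' r, W r * (if y ≤ f r then 1 else 0) ≤ (∑' r, W r * f r) / y := by
  rw [ENNReal.div_eq_inv_mul, ← ENNReal.tsum_mul_left]
  refine ENNReal.tsum_le_tsum fun r => ?_
  split_ifs with h
  · rw [← mul_assoc, mul_comm y⁻¹, mul_assoc]
    gcongr
    rwa [← ENNReal.div_eq_inv_mul, ENNReal.le_div_iff_mul_le (.inl hy0) (.inl hy), one_mul]
  · simp

lemma sum_range_prod_one_sub_mul (p : ℕ → ℝ) (A : ℕ) :
    ∑ t ∈ Finset.range A, (∏ u ∈ Finset.range t, (1 - p u)) * p t =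
      1 - ∏ u ∈ Finset.range A, (1 - p u) := by
  induction A with
  | zero => simp
  | succ A ih => rw [Finset.sum_range_succ, ih, Finset.prod_range_succ]; ring

namespace Scheme

variable {b k : ℕ} {S : Scheme b k} {θ η : ℝ} {E K x φ : ℝ≥0∞} {ρ : List ℕ → Op b}

/-- The event that a run stays within its budget. -/
def InBudget (S : Scheme b k) (P G D : ℕ) (r : S.Run) : Prop :=
  S.pairs r ≤ P ∧ S.gates r ≤ G ∧ S.depth r ≤ D

-- Markov's inequality loses at most `1/4` for the pairs, `1/8` for the gates and `1/8` for the
-- depth, the latter applied to `x ^ depth`.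
open Classical in
theorem Bounds.half_le (hS : S.Bounds θ η E K x φ) (hx : 1 ≤ x) (hx' : x ≠ ⊤) {P G D : ℕ}
    (hP : E ≤ 4⁻¹ * P) (hG : K ≤ 8⁻¹ * G) (hP0 : P ≠ 0) (hG0 : G ≠ 0) (hD : φ ≤ 8⁻¹ * x ^ D)
    (hρ : ∀ w, Regular (ρ w) θ ∧ (ρ w).trace = 1) (w : List ℕ) :
    2⁻¹ ≤ ∑' r, if S.InBudget P G D r then S.weight ρ w r else 0 := by
  have hxD0 : x ^ D ≠ 0 := pow_ne_zero _ (one_pos.trans_le hx).ne'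
  have hxD : x ^ D ≠ ⊤ := ENNReal.pow_ne_top hx'
  have hP1 : (P : ℝ≥0∞) ≠ 0 := Nat.cast_ne_zero.2 hP0
  have hG1 : (G : ℝ≥0∞) ≠ 0 := Nat.cast_ne_zero.2 hG0
  have h1 := (tsum_mul_ite_le (S.weight ρ w) (fun r => (S.pairs r : ℝ≥0∞)) hP1
    (ENNReal.natCast_ne_top P)).trans
      (ENNReal.div_le_of_le_mul ((hS.pairs ρ hρ w).trans hP))
  have h2 := (tsum_mul_ite_le (S.weight ρ w) (fun r => (S.gates r : ℝ≥0∞)) hG1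
    (ENNReal.natCast_ne_top G)).trans
      (ENNReal.div_le_of_le_mul ((hS.gates ρ hρ w).trans hG))
  have h3 := (tsum_mul_ite_le (S.weight ρ w) (fun r => x ^ S.depth r) hxD0 hxD).trans
      (ENNReal.div_le_of_le_mul ((hS.depth ρ hρ w).trans hD))
  have h4 : 1 ≤ (∑' r, if S.InBudget P G D r then S.weight ρ w r else 0) + 2⁻¹ := by
    calc (1 : ℝ≥0∞) = ∑' r, S.weight ρ w r := (hS.total ρ hρ w).symm
      _ ≤ ∑' r, ((if S.InBudget P G D r then S.weight ρ w r else 0) +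
          (S.weight ρ w r * (if (P : ℝ≥0∞) ≤ S.pairs r then 1 else 0) +
          (S.weight ρ w r * (if (G : ℝ≥0∞) ≤ S.gates r then 1 else 0) +
          S.weight ρ w r * (if x ^ D ≤ x ^ S.depth r then 1 else 0)))) := by
        refine ENNReal.tsum_le_tsum fun r => ?_
        by_cases hr : S.InBudget P G D r
        · rw [if_pos hr]; exact le_self_add
        · rw [if_neg hr, zero_add, ← mul_add, ← mul_add]
          refine le_mul_of_one_le_right' ?_
          by_cases hp : S.pairs r ≤ P
          · by_cases hg : S.gates r ≤ G
            · have hd : D ≤ S.depth r := by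
                by_contra hd
                exact hr ⟨hp, hg, by omega⟩
              rw [if_pos (pow_le_pow_right₀ hx hd), ← add_assoc]
              exact le_add_self
            · rw [if_pos (c := (G : ℝ≥0∞) ≤ _) (by exact_mod_cast (not_le.1 hg).le)]
              rw [add_left_comm]
              exact le_self_add
          · rw [if_pos (by exact_mod_cast (not_le.1 hp).le)]
            exact le_self_add
      _ ≤ (∑' r, if S.InBudget P G D r then S.weight ρ w r else 0) + (4⁻¹ + (8⁻¹ + 8⁻¹)) := by
        rw [ENNReal.tsum_add, ENNReal.tsum_add, ENNReal.tsum_add]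
        gcongr
      _ = _ := by
        congr 1
        rw [← ENNReal.toReal_eq_toReal_iff' (by finiteness) (by finiteness)]
        rw [ENNReal.toReal_add (by finiteness) (by finiteness),
          ENNReal.toReal_add (by finiteness) (by finiteness)]
        norm_num
  rw [← ENNReal.inv_two_add_inv_two] at h4
  exact (ENNReal.add_le_add_iff_right (by simp)).1 h4

open Classical in
lemma budgeted_eq_toReal (hS : S.Bounds θ η E K x φ) (P G D : ℕ)
    (hρ : ∀ w, Regular (ρ w) θ ∧ (ρ w).trace = 1) (w : List ℕ) :
    S.budgeted ρ P G D (fun σ => σ.trace.re) w =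
      (∑' r, if S.InBudget P G D r then S.weight ρ w r else 0).toReal := by
  rw [ENNReal.tsum_toReal_eq fun r => by split_ifs <;> simp [weight]]
  refine tsum_congr fun r => ?_
  rw [apply_ite ENNReal.toReal, weight, ENNReal.toReal_ofReal (hS.regular ρ hρ w r).trace_nonneg]
  exact if_congr Iff.rfl rfl ENNReal.toReal_zero.symm

/-- The infidelity bound holds history by history and so survives restriction to the histories
within budget. -/
theorem Bounds.mul_budgeted_le (hS : S.Bounds θ η E K x φ) (P G D : ℕ)
    (hρ : ∀ w, Regular (ρ w) θ ∧ (ρ w).trace = 1) (w : List ℕ) :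
    (1 - η) * S.budgeted ρ P G D (fun σ => σ.trace.re) w ≤ S.budgeted ρ P G D bellOverlap w := by
  classical
  -- Summability is needed because a real `tsum` of a non-summable family is `0` by default.
  have h1 : Summable fun r => (S.weight ρ w r).toReal := ENNReal.summable_toReal (by
    rw [hS.total ρ hρ w]; simp)
  have h2 : ∀ r, (S.weight ρ w r).toReal = (S.outState ρ w r).trace.re := fun r =>
    ENNReal.toReal_ofReal (hS.regular ρ hρ w r).trace_nonneg
  simp only [h2] at h1
  have h3 : Summable fun r => if S.pairs r ≤ P ∧ S.gates r ≤ G ∧ S.depth r ≤ D then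
      (S.outState ρ w r).trace.re else 0 :=
    h1.of_nonneg_of_le (fun r => by
      split_ifs
      exacts [(hS.regular ρ hρ w r).trace_nonneg, le_rfl]) fun r => by
      split_ifs
      exacts [le_rfl, (hS.regular ρ hρ w r).trace_nonneg]
  have h4 : Summable fun r => if S.pairs r ≤ P ∧ S.gates r ≤ G ∧ S.depth r ≤ D then
      bellOverlap (S.outState ρ w r) else 0 :=
    h3.of_nonneg_of_le (fun r => by
      split_ifs
      exacts [(hS.regular ρ hρ w r).bellOverlap_nonneg, le_rfl]) fun r => by
      split_ifs
      exacts [(hS.regular ρ hρ w r).bellOverlap_le, le_rfl]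
  unfold budgeted
  rw [← tsum_mul_left]
  refine (h3.mul_left _).tsum_le_tsum (fun r => ?_) h4
  split_ifs
  · exact (hS.regular ρ hρ w r).le_bellOverlap
  · simp

theorem Bounds.success (hS : S.Bounds θ η E K x φ) (hx : 1 ≤ x) (hx' : x ≠ ⊤) {P G D : ℕ}
    (hP : E ≤ 4⁻¹ * P) (hG : K ≤ 8⁻¹ * G) (hP0 : P ≠ 0) (hG0 : G ≠ 0) (hD : φ ≤ 8⁻¹ * x ^ D)
    (hρ : ∀ w, Regular (ρ w) θ ∧ (ρ w).trace = 1) (A : ℕ) :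
    1 - 2⁻¹ ^ A ≤ S.successProb ρ A P G D ∧
      (1 - η) * S.successProb ρ A P G D ≤ S.successBellProb ρ A P G D := by
  classical
  have hle : ∀ u, S.attemptProb ρ P G D u ≤ 1 := fun u => by
    rw [attemptProb, budgeted_eq_toReal hS P G D hρ]
    refine ENNReal.toReal_le_of_le_ofReal zero_le_one ?_
    rw [ENNReal.ofReal_one, ← hS.total ρ hρ [u]]
    exact ENNReal.tsum_le_tsum fun r => by split_ifs <;> simp
  have hge : ∀ u, 2⁻¹ ≤ S.attemptProb ρ P G D u := fun u => by
    have h1 := hS.half_le hx hx' hP hG hP0 hG0 hD hρ [u]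
    rw [attemptProb, budgeted_eq_toReal hS P G D hρ]
    rw [← ENNReal.ofReal_le_iff_le_toReal]
    · simpa [ENNReal.ofReal_inv_of_pos] using h1
    · refine ne_top_of_le_ne_top ENNReal.one_ne_top ?_
      rw [← hS.total ρ hρ [u]]
      exact ENNReal.tsum_le_tsum fun r => by split_ifs <;> simp
  constructor
  · rw [successProb, sum_range_prod_one_sub_mul, sub_le_sub_iff_left,
      ← Finset.card_range A, ← Finset.prod_const, Finset.card_range]
    refine Finset.prod_le_prod (fun u _ => sub_nonneg.2 (hle u)) fun u _ => ?_
    linarith [hge u]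
  · rw [successProb, successBellProb, Finset.mul_sum]
    refine Finset.sum_le_sum fun t _ => ?_
    rw [mul_left_comm]
    exact mul_le_mul_of_nonneg_left (hS.mul_budgeted_le P G D hρ [t])
      (Finset.prod_nonneg fun u _ => sub_nonneg.2 (hle u))

end Scheme

end Distill

namespace Distill

/-! ### Sizes of the layers -/

/-- The number of pairs that a box of a given layer measures. -/
def syndrome : ℕ → ℕ
  | 0 => 192
  | j + 1 => 2 ^ (syndrome j / 8) * (syndrome j * (2 ^ (j + 2) - 1))

/-- The number of pairs that a box of a given layer outputs. -/
def outSize (j : ℕ) : ℕ := syndrome j * (2 ^ (j + 2) - 1)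

/-- The number of boxes of a layer that feed a box of the next one. -/
def fanIn (j : ℕ) : ℕ := 2 ^ (syndrome j / 8) * 2 ^ (j + 3)

/-- The memory of the protocol that ends with a given layer. -/
def memorySize : ℕ → ℕ
  | 0 => 768
  | j + 1 => fanIn j * memorySize j

lemma syndrome_succ (j : ℕ) : syndrome (j + 1) = 2 ^ (syndrome j / 8) * outSize j := rfl

/-- A box of layer `j + 1` receives `2^(j+3)` times as many pairs as it measures. Its rate is
therefore `1 - 2^(-(j+3))`, and the product of the rates stays bounded away from zero. -/
lemma fanIn_mul_outSize (j : ℕ) : fanIn j * outSize j = syndrome (j + 1) * 2 ^ (j + 3) := by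
  rw [fanIn, syndrome_succ]; ring

lemma syndrome_le_outSize (j : ℕ) : syndrome j ≤ outSize j := by
  refine Nat.le_mul_of_pos_right _ (Nat.sub_pos_of_lt ?_)
  exact Nat.one_lt_two_pow (by omega)

lemma le_syndrome (j : ℕ) : 192 * 4 ^ j ≤ syndrome j := by
  induction j with
  | zero => simp [syndrome]
  | succ j ih =>
    have h1 : 2 ^ 2 ≤ 2 ^ (syndrome j / 8) := by
      refine Nat.pow_le_pow_right (by norm_num) ?_
      have : 1 ≤ 4 ^ j := Nat.one_le_pow _ _ (by norm_num)
      omega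
    calc 192 * 4 ^ (j + 1) = 2 ^ 2 * (192 * 4 ^ j) := by ring
      _ ≤ 2 ^ (syndrome j / 8) * outSize j :=
          Nat.mul_le_mul h1 (ih.trans (syndrome_le_outSize j))

lemma linear_le_syndrome (j : ℕ) : 192 + 192 * j ≤ syndrome j := by
  refine le_trans ?_ (le_syndrome j)
  have : j < 4 ^ j := Nat.lt_pow_self (by norm_num)
  omega

lemma two_pow_mul_syndrome_le (j : ℕ) : 2 ^ 24 * syndrome j ≤ syndrome (j + 1) := by
  refine Nat.mul_le_mul (Nat.pow_le_pow_right (by norm_num) ?_) (syndrome_le_outSize j)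
  have := linear_le_syndrome j
  omega

lemma syndrome_pos (j : ℕ) : 0 < syndrome j := by
  have := linear_le_syndrome j
  omega

lemma outSize_pos (j : ℕ) : 0 < outSize j := (syndrome_pos j).trans_le (syndrome_le_outSize j)

lemma fanIn_pos (j : ℕ) : 0 < fanIn j := by unfold fanIn; positivity

lemma cast_outSize (j : ℕ) : (outSize j : ℝ) = syndrome j * (2 ^ (j + 2) - 1) := by
  rw [outSize, Nat.cast_mul, Nat.cast_sub Nat.one_le_two_pow]
  simp

lemma cast_outSize_succ (j : ℕ) :
    (outSize (j + 1) : ℝ) = fanIn j * outSize j * (1 - (2 ^ (j + 3))⁻¹) := by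
  have h1 : (fanIn j * outSize j : ℝ) = syndrome (j + 1) * 2 ^ (j + 3) := by
    exact_mod_cast fanIn_mul_outSize j
  rw [h1, cast_outSize]
  field_simp

lemma inv_two_pow_succ (j : ℕ) : ((2 : ℝ) ^ (j + 1))⁻¹ = 4 * (2 ^ (j + 3))⁻¹ ∧
    ((2 : ℝ) ^ (j + 1 + 1))⁻¹ = 2 * (2 ^ (j + 3))⁻¹ := by
  constructor <;> · field_simp; ring

lemma inv_two_pow_le (j : ℕ) : ((2 : ℝ) ^ (j + 3))⁻¹ ≤ 1 / 8 := by
  rw [inv_le_comm₀ (by positivity) (by norm_num)]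
  have : (2 : ℝ) ^ 3 ≤ 2 ^ (j + 3) := pow_le_pow_right₀ (by norm_num) (by omega)
  linarith

/-- The factor `1 - 2^(-(j+1))` strengthens the induction enough to absorb the rate: with `y =
2^(-(j+3))`, the step is `1 - 4y ≤ (1 - 2y)(1 - y)`. -/
lemma memorySize_le (j : ℕ) :
    (memorySize j : ℝ) ≤ 3 * (1 - (2 ^ (j + 1))⁻¹) * outSize j := by
  induction j with
  | zero => rw [cast_outSize]; norm_num [memorySize, syndrome]
  | succ j ih =>
    obtain ⟨h1, h2⟩ := inv_two_pow_succ j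
    rw [h1] at ih
    rw [h2, cast_outSize_succ, memorySize]
    have hy := inv_two_pow_le j
    have hy0 : (0 : ℝ) < (2 ^ (j + 3))⁻¹ := by positivity
    set y : ℝ := (2 ^ (j + 3))⁻¹
    push_cast
    calc (fanIn j * memorySize j : ℝ) ≤ fanIn j * (3 * (1 - 4 * y) * outSize j) := by gcongr
      _ = (fanIn j * outSize j) * (3 * (1 - 4 * y)) := by ring
      _ ≤ (fanIn j * outSize j) * (3 * (1 - 2 * y) * (1 - y)) := by
          refine mul_le_mul_of_nonneg_left ?_ (by positivity)
          nlinarith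
      _ = _ := by ring

lemma memorySize_le_three_mul (j : ℕ) : (memorySize j : ℝ) ≤ 3 * outSize j := by
  refine (memorySize_le j).trans ?_
  have : (0 : ℝ) < (2 ^ (j + 1))⁻¹ := by positivity
  gcongr
  linarith

lemma outSize_le_memorySize (j : ℕ) : outSize j ≤ memorySize j := by
  induction j with
  | zero => norm_num [outSize, memorySize, syndrome]
  | succ j ih =>
    rw [memorySize, outSize]
    calc _ ≤ syndrome (j + 1) * 2 ^ (j + 3) := Nat.mul_le_mul_left _ (Nat.sub_le _ _)
      _ = fanIn j * outSize j := (fanIn_mul_outSize j).symm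
      _ ≤ _ := Nat.mul_le_mul_left _ ih

lemma memorySize_le_succ (j : ℕ) : memorySize j ≤ memorySize (j + 1) :=
  Nat.le_mul_of_pos_left _ (fanIn_pos j)

lemma memorySize_le_syndrome (j : ℕ) : memorySize j ≤ 2 ^ (j + 4) * syndrome j := by
  have h1 := memorySize_le_three_mul j
  have h2 : (memorySize j : ℝ) ≤ 2 ^ (j + 4) * syndrome j := by
    refine h1.trans ?_
    rw [cast_outSize, show (2 : ℝ) ^ (j + 4) = 4 * 2 ^ (j + 2) by ring]
    have : (0 : ℝ) < syndrome j := Nat.cast_pos.2 (syndrome_pos j)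
    have h3 : (0 : ℝ) < 2 ^ (j + 2) := by positivity
    nlinarith [mul_pos this h3]
  exact_mod_cast h2

/-- The source of the exponent `3/2` of the memory: a third of the power `3/2` of `syndrome j`
covers the memory. For the first layer this is `9 * 768² ≤ 192³`; later the memory exceeds
`syndrome` only by a factor `2^(j+4)`. -/
lemma memorySize_sq_le (j : ℕ) : 9 * memorySize j ^ 2 ≤ syndrome j ^ 3 := by
  cases j with
  | zero => norm_num [memorySize, syndrome]
  | succ j =>
    have h1 : 9 * 2 ^ (2 * (j + 5)) ≤ syndrome (j + 1) := by
      calc 9 * 2 ^ (2 * (j + 5)) = (9 * 1024) * 4 ^ j := by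
            rw [pow_mul, pow_add]; norm_num; ring
        _ ≤ 2 ^ 24 * (192 * 4 ^ j) := by omega
        _ ≤ _ := (Nat.mul_le_mul_left _ (le_syndrome j)).trans (two_pow_mul_syndrome_le j)
    calc 9 * memorySize (j + 1) ^ 2 ≤ 9 * (2 ^ (j + 5) * syndrome (j + 1)) ^ 2 := by
          gcongr
          exact memorySize_le_syndrome (j + 1)
      _ = (9 * 2 ^ (2 * (j + 5))) * syndrome (j + 1) ^ 2 := by rw [mul_pow, ← pow_mul]; ring
      _ ≤ syndrome (j + 1) * syndrome (j + 1) ^ 2 := by gcongr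
      _ = _ := by ring

/-- The left side bounds the rejection probability in the next layer, which is thus no larger than
the fraction of pairs measured there. -/
lemma fanIn_mul_le (j : ℕ) : (fanIn j : ℝ) * ((2 : ℝ) ^ syndrome j)⁻¹ ≤ (2 ^ (j + 3))⁻¹ := by
  rw [← div_eq_mul_inv, div_le_iff₀ (by positivity), inv_mul_eq_div, le_div_iff₀ (by positivity)]
  have h : fanIn j * 2 ^ (j + 3) ≤ 2 ^ syndrome j := by
    rw [fanIn, ← pow_add, ← pow_add]
    refine Nat.pow_le_pow_right (by norm_num) ?_
    have := linear_le_syndrome j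
    omega
  exact_mod_cast h

/-- This keeps rejections from more than doubling the exponential moment of the depth. In the
exponent, `fanIn j ^ 2` and the memory cost about a quarter of `syndrome j` each, plus terms linear
in `j`. -/
lemma fanIn_sq_mul_le (j : ℕ) :
    4 * (fanIn j : ℝ) ^ 2 * ((2 : ℝ) ^ syndrome j)⁻¹ * (4 ^ j * memorySize j) ≤ 1 := by
  rw [mul_right_comm, ← div_eq_mul_inv, div_le_one (by positivity)]
  have h1 : syndrome j ≤ 2 ^ (syndrome j / 4 + 1) := by
    have h2 : syndrome j / 8 + 1 ≤ 2 ^ (syndrome j / 8) := Nat.lt_two_pow_self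
    have h3 : syndrome j ≤ 8 * (syndrome j / 8 + 1) := by omega
    calc syndrome j ≤ 2 ^ 3 * 2 ^ (syndrome j / 8) := by omega
      _ ≤ _ := by
        rw [← pow_add]
        refine Nat.pow_le_pow_right (by norm_num) ?_
        have := linear_le_syndrome j
        omega
  have h : 4 * fanIn j ^ 2 * (4 ^ j * memorySize j) ≤ 2 ^ syndrome j := by
    calc 4 * fanIn j ^ 2 * (4 ^ j * memorySize j)
        ≤ 4 * fanIn j ^ 2 * (4 ^ j * (2 ^ (j + 4) * 2 ^ (syndrome j / 4 + 1))) := by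
          gcongr
          exact (memorySize_le_syndrome j).trans (Nat.mul_le_mul_left _ h1)
      _ = 2 ^ (2 + (syndrome j / 8 * 2 + (j + 3) * 2) +
            (2 * j + (j + 4 + (syndrome j / 4 + 1)))) := by
          rw [fanIn, mul_pow, ← pow_mul, ← pow_mul, show 4 = 2 ^ 2 from rfl, ← pow_mul]
          simp only [← pow_add]
      _ ≤ _ := by
          refine Nat.pow_le_pow_right (by norm_num) ?_
          have := linear_le_syndrome j
          omega
  exact_mod_cast h

/-! ### The iterated logarithm -/

/-- Iterated powers of two. -/
def tower : ℕ → ℕ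
  | 0 => 1
  | j + 1 => 2 ^ tower j

lemma tower_pos (j : ℕ) : 1 ≤ tower j := by
  cases j with
  | zero => exact le_rfl
  | succ j => exact Nat.one_le_two_pow

/-- The factor 8 offsets the division by 8 in the exponent of the recursion for `syndrome`. -/
lemma eight_mul_tower_le (j : ℕ) : 8 * tower j ≤ syndrome j := by
  induction j with
  | zero => norm_num [tower, syndrome]
  | succ j ih =>
    rw [tower, syndrome_succ, mul_comm]
    refine Nat.mul_le_mul (Nat.pow_le_pow_right (by norm_num) (by omega)) ?_
    have := linear_le_syndrome j
    have := syndrome_le_outSize j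
    omega

/-- `logStar` is an infimum in `ℕ`, with value `0` on the empty set, so its set has to be nonempty.
For `x ≥ 2` one application lowers the bound by one, as `x ≤ 2^(x-1)`; the interval between 1 and 2,
where this fails, is treated apart. -/
lemma exists_iterate_logb_le_one (n : ℕ) : ∀ x : ℝ, x ≤ n → ∃ j, (Real.logb 2)^[j] x ≤ 1 := by
  induction n with
  | zero => exact fun x hx => ⟨0, by simp only [Function.iterate_zero, id]; push_cast at hx; linarith⟩
  | succ n ih =>
    intro x hx
    push_cast at hx
    by_cases h1 : x ≤ 1
    · exact ⟨0, h1⟩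
    by_cases h2 : x ≤ 2
    · refine ⟨1, ?_⟩
      simp only [Function.iterate_one]
      rw [Real.logb_le_iff_le_rpow (by norm_num) (by linarith)]
      simpa using h2
    · have h3 : Real.logb 2 x ≤ n := by
        rw [Real.logb_le_iff_le_rpow (by norm_num) (by linarith)]
        have h4 := one_add_mul_self_le_rpow_one_add (s := 1) (p := x - 1) (by norm_num)
          (by linarith)
        calc x = 1 + (x - 1) * 1 := by ring
          _ ≤ (1 + 1) ^ (x - 1) := h4
          _ = (2 : ℝ) ^ (x - 1) := by norm_num
          _ ≤ 2 ^ (n : ℝ) := Real.rpow_le_rpow_of_exponent_le (by norm_num) (by linarith)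
      obtain ⟨j, hj⟩ := ih _ h3
      exact ⟨j + 1, by rwa [Function.iterate_succ_apply]⟩

lemma one_lt_iterate_logb (j : ℕ) : ∀ x : ℝ, tower j < x → ∀ i ≤ j, 1 < (Real.logb 2)^[i] x := by
  induction j with
  | zero =>
    intro x hx i hi
    obtain rfl : i = 0 := by omega
    simpa [tower] using hx
  | succ j ih =>
    intro x hx i hi
    have hx1 : (1 : ℝ) < x := lt_of_le_of_lt (by exact_mod_cast tower_pos (j + 1)) hx
    cases i with
    | zero => exact hx1
    | succ i =>
      rw [Function.iterate_succ_apply]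
      refine ih _ ?_ i (by omega)
      rw [Real.lt_logb_iff_rpow_lt (by norm_num) (by linarith), Real.rpow_natCast]
      simpa [tower] using hx

lemma lt_logStar {j : ℕ} {x : ℝ} (h : tower j < x) : j < logStar x := by
  obtain ⟨n, hn⟩ := exists_nat_ge x
  have h1 : logStar x ∈ {i : ℕ | (Real.logb 2)^[i] x ≤ 1} :=
    Nat.sInf_mem (exists_iterate_logb_le_one n x hn)
  by_contra h2
  exact not_le.2 (one_lt_iterate_logb j x h _ (not_lt.1 h2)) h1

end Distill

namespace Distill

open scoped ENNReal

/-! ### The protocol -/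

/-- A bound on the depth of the boxes on at most `N` pairs. -/
def depthBound (N : ℕ) : ℕ := 32 * Nat.clog 2 N + 69

/-- A bound on the number of gates of the boxes on at most `N` pairs. -/
def gateBound (N : ℕ) : ℕ := 20 * depthBound N * N ^ 2

lemma exists_box_of_le {n k N : ℕ} (hn : 2 ≤ n) (hk : 1 ≤ k) (hkn : k ≤ n) (hN : n ≤ N)
    {x : ℝ≥0∞} (hx : 1 ≤ x) (hxd : x ^ depthBound N = 2) :
    ∃ B : Box n k, x ^ B.depth ≤ 2 ∧ B.gates ≤ gateBound N := by
  obtain ⟨B, h1, h2⟩ := exists_box hn hk hkn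
  have h3 : 32 * Nat.clog 2 n + 69 ≤ depthBound N := by
    have := Nat.clog_mono_right 2 hN
    unfold depthBound; omega
  refine ⟨B, hxd ▸ pow_le_pow_right₀ hx (h1.trans h3), h2.trans ?_⟩
  unfold gateBound
  gcongr

/-- With `d` a bound on the depth of all boxes, this base makes each box contribute a factor at most
2 to the moment, so depth is measured in units of `d`. -/
lemma exists_pow_eq_two {d : ℕ} (hd : d ≠ 0) : ∃ x : ℝ≥0∞, 1 ≤ x ∧ x ≠ ⊤ ∧ x ^ d = 2 := by
  refine ⟨2 ^ ((d : ℝ)⁻¹), ENNReal.one_le_rpow (by norm_num) (by positivity),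
    ENNReal.rpow_ne_top_of_nonneg (by positivity) (by norm_num), ?_⟩
  rw [← ENNReal.rpow_natCast, ← ENNReal.rpow_mul, inv_mul_cancel₀ (by positivity),
    ENNReal.rpow_one]

lemma gateBound_le {N : ℕ} (hN : 1 ≤ N) : gateBound N ≤ 2020 * N ^ 3 := by
  have h1 : depthBound N ≤ 101 * N := by
    have : Nat.clog 2 N ≤ N := Nat.clog_le_of_le_pow Nat.lt_two_pow_self.le
    unfold depthBound; omega
  calc gateBound N ≤ 20 * (101 * N) * N ^ 2 := by unfold gateBound; gcongr
    _ = _ := by ring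

namespace Scheme

variable {b k k' c : ℕ} {θ : ℝ} {x : ℝ≥0∞}

theorem Bounds.next_ofReal {S : Scheme b k} {η e g φ e' g' φ' : ℝ} {γ : ℕ}
    (hS : S.Bounds θ η (ENNReal.ofReal e) (ENNReal.ofReal g) x (ENNReal.ofReal φ))
    (B : Box (c * k) k') (hd : x ^ B.depth ≤ 2) (hγ : B.gates ≤ γ) (hη0 : 0 ≤ η) (hη : η ≤ 1)
    (hcη : c * η ≤ 1 / 2) (he0 : 0 ≤ e) (hg0 : 0 ≤ g) (hφ0 : 0 ≤ φ) (he0' : 0 ≤ e')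
    (hg0' : 0 ≤ g') (hφ0' : 0 ≤ φ') (he : c * e + c * η * e' ≤ e')
    (hg : c * g + γ + c * η * g' ≤ g') (hφ : 2 * (c * φ) + c * η * (2 * (c * φ)) * φ' ≤ φ') :
    (Scheme.next S c B).Bounds θ ((2 : ℝ) ^ (c * k - k'))⁻¹ (ENNReal.ofReal e') (ENNReal.ofReal g') x
      (ENNReal.ofReal φ') := by
  refine hS.next B hη hcη ?_ ?_ ?_
  · rw [← ENNReal.ofReal_natCast c, ← ENNReal.ofReal_mul (by positivity),
      ← ENNReal.ofReal_mul (by positivity), ← ENNReal.ofReal_add (by positivity) (by positivity)]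
    exact ENNReal.ofReal_le_ofReal he
  · have h1 : (B.gates : ℝ≥0∞) ≤ ENNReal.ofReal γ := by
      rw [ENNReal.ofReal_natCast]; exact_mod_cast hγ
    refine le_trans (add_le_add_left (add_le_add_right h1 _) _) ?_
    rw [← ENNReal.ofReal_natCast c, ← ENNReal.ofReal_mul (by positivity),
      ← ENNReal.ofReal_mul (by positivity), ← ENNReal.ofReal_add (by positivity) (by positivity),
      ← ENNReal.ofReal_add (by positivity) (by positivity)]
    exact ENNReal.ofReal_le_ofReal hg
  · have h1 : c * ENNReal.ofReal φ * x ^ B.depth ≤ ENNReal.ofReal (2 * (c * φ)) := by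
      rw [mul_comm 2 _, ENNReal.ofReal_mul (by positivity), ENNReal.ofReal_mul (by positivity),
        ENNReal.ofReal_natCast]
      gcongr
      simpa using hd
    refine le_trans (add_le_add h1 (mul_le_mul_left (mul_le_mul_right h1 _) _)) ?_
    rw [← ENNReal.ofReal_mul (by positivity), ← ENNReal.ofReal_mul (by positivity),
      ← ENNReal.ofReal_add (by positivity) (by positivity)]
    exact ENNReal.ofReal_le_ofReal hφ

theorem bounds_first_ofReal (B : Box b k) (hθ0 : 0 ≤ θ) (hθ : θ ≤ 1 / 2) {e g φ : ℝ} {γ : ℕ}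
    (hd : x ^ B.depth ≤ 2) (hγ : B.gates ≤ γ) (he0 : 0 ≤ e) (hg0 : 0 ≤ g) (hφ0 : 0 ≤ φ)
    (he : b + θ * e ≤ e) (hg : γ + θ * g ≤ g) (hφ : 2 + θ * 2 * φ ≤ φ) :
    (first B).Bounds θ ((2 : ℝ) ^ (b - k))⁻¹ (ENNReal.ofReal e) (ENNReal.ofReal g) x
      (ENNReal.ofReal φ) := by
  refine bounds_first B hθ ?_ ?_ ?_
  · rw [← ENNReal.ofReal_natCast b, ← ENNReal.ofReal_mul (by positivity),
      ← ENNReal.ofReal_add (by positivity) (by positivity)]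
    exact ENNReal.ofReal_le_ofReal he
  · have h1 : (B.gates : ℝ≥0∞) ≤ ENNReal.ofReal γ := by
      rw [ENNReal.ofReal_natCast]; exact_mod_cast hγ
    refine le_trans (add_le_add_left h1 _) ?_
    rw [← ENNReal.ofReal_mul (by positivity), ← ENNReal.ofReal_add (by positivity) (by positivity)]
    exact ENNReal.ofReal_le_ofReal hg
  · have h1 : x ^ B.depth ≤ ENNReal.ofReal 2 := by simpa using hd
    refine le_trans (add_le_add h1 (mul_le_mul_left (mul_le_mul_right h1 _) _)) ?_
    rw [← ENNReal.ofReal_mul (by positivity), ← ENNReal.ofReal_mul (by positivity),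
      ← ENNReal.ofReal_add (by positivity) (by positivity)]
    exact ENNReal.ofReal_le_ofReal hφ

/-- Adding a layer whose boxes take the outputs of at most `fanIn j` boxes of layer `j`. -/
theorem Bounds.next_of_le_fanIn {j : ℕ} {S : Scheme b (outSize j)} {e e' : ℝ} {γ : ℕ}
    (hS : S.Bounds θ ((2 : ℝ) ^ syndrome j)⁻¹ (ENNReal.ofReal e)
      (ENNReal.ofReal (4 ^ (j + 1) * memorySize j * γ)) x (ENNReal.ofReal (4 ^ j * memorySize j)))
    (hc0 : 1 ≤ c) (hc : c ≤ fanIn j) (B : Box (c * outSize j) k') (hd : x ^ B.depth ≤ 2)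
    (hγ : B.gates ≤ γ) (he0 : 0 ≤ e) (he0' : 0 ≤ e')
    (he : c * e ≤ (1 - (2 ^ (j + 3))⁻¹) * e') :
    (Scheme.next S c B).Bounds θ ((2 : ℝ) ^ (c * outSize j - k'))⁻¹ (ENNReal.ofReal e')
      (ENNReal.ofReal (4 ^ (j + 2) * (c * memorySize j) * γ)) x
      (ENNReal.ofReal (4 ^ (j + 1) * (c * memorySize j))) := by
  have hcη : c * ((2 : ℝ) ^ syndrome j)⁻¹ ≤ (2 ^ (j + 3))⁻¹ := by
    refine le_trans ?_ (fanIn_mul_le j)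
    gcongr
  have hcφ : 4 * (c : ℝ) ^ 2 * ((2 : ℝ) ^ syndrome j)⁻¹ * (4 ^ j * memorySize j) ≤ 1 := by
    refine le_trans ?_ (fanIn_sq_mul_le j)
    gcongr
  have hy := inv_two_pow_le j
  have hη0 : (0 : ℝ) ≤ ((2 : ℝ) ^ syndrome j)⁻¹ := by positivity
  have hη1 : ((2 : ℝ) ^ syndrome j)⁻¹ ≤ 1 := inv_le_one_of_one_le₀ (one_le_pow₀ (by norm_num))
  have hc1 : (1 : ℝ) ≤ c := by exact_mod_cast hc0
  have hM : (1 : ℝ) ≤ memorySize j := by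
    exact_mod_cast (outSize_pos j).trans_le (outSize_le_memorySize j)
  have h4 : (1 : ℝ) ≤ 4 ^ (j + 1) := one_le_pow₀ (by norm_num)
  refine hS.next_ofReal B hd hγ hη0 hη1 (by linarith) he0 (by positivity) (by positivity) he0'
    (by positivity) (by positivity) ?_ ?_ ?_
  · have := mul_le_mul_of_nonneg_right hcη he0'
    linarith
  · set η := ((2 : ℝ) ^ syndrome j)⁻¹
    have h5 : (γ : ℝ) ≤ c * (4 ^ (j + 1) * memorySize j * γ) := by
      have h6 : (1 : ℝ) ≤ c * (4 ^ (j + 1) * memorySize j) :=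
        one_le_mul_of_one_le_of_one_le hc1 (one_le_mul_of_one_le_of_one_le h4 hM)
      calc (γ : ℝ) = 1 * γ := (one_mul _).symm
        _ ≤ c * (4 ^ (j + 1) * memorySize j) * γ := by gcongr
        _ = _ := by ring
    have h7 : c * η * (4 ^ (j + 2) * (c * memorySize j) * γ) ≤
        1 / 2 * (4 * (c * (4 ^ (j + 1) * memorySize j * γ))) := by
      rw [show (4 : ℝ) ^ (j + 2) * (c * memorySize j) * γ =
        4 * (c * (4 ^ (j + 1) * memorySize j * γ)) by ring]
      exact mul_le_mul_of_nonneg_right (by linarith) (by positivity)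
    rw [show (4 : ℝ) ^ (j + 2) * (c * memorySize j) * γ =
      4 * (c * (4 ^ (j + 1) * memorySize j * γ)) by ring] at h7 ⊢
    linarith
  · set η := ((2 : ℝ) ^ syndrome j)⁻¹
    set φ : ℝ := 4 ^ j * memorySize j
    -- With new moment `4cφ` the rejection term is `4c²ηφ` times `2cφ`, hence at most `2cφ`.
    have h5 : (4 : ℝ) ^ (j + 1) * (c * memorySize j) = 4 * (c * φ) := by ring
    have h6 : c * η * (2 * (c * φ)) * (4 * (c * φ)) = 4 * c ^ 2 * η * φ * (2 * (c * φ)) := by ring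
    rw [h5, h6]
    have h7 : 0 ≤ 2 * (c * φ) := by positivity
    have := mul_le_mul_of_nonneg_right hcφ h7
    linarith

/-- The concatenation of boxes of the standard sizes. -/
theorem exists_scheme_outSize {N : ℕ} (hx : 1 ≤ x) (hxd : x ^ depthBound N = 2) (j : ℕ)
    (hj : memorySize j ≤ N) :
    ∃ S : Scheme 768 (outSize j), S.memory = memorySize j ∧ S.layers = j + 1 ∧
      S.Bounds (0.0006 * (768 : ℕ)) ((2 : ℝ) ^ syndrome j)⁻¹
        (ENNReal.ofReal (6 * (1 - (2 ^ (j + 1))⁻¹) * outSize j))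
        (ENNReal.ofReal (4 ^ (j + 1) * memorySize j * gateBound N)) x
        (ENNReal.ofReal (4 ^ j * memorySize j)) := by
  induction j with
  | zero =>
    obtain ⟨B, hB, hB'⟩ := exists_box_of_le (n := 768) (k := outSize 0) (N := N) (by norm_num)
      (outSize_pos 0) (by norm_num [outSize, syndrome]) hj hx hxd
    have h1 : 768 - outSize 0 = syndrome 0 := by norm_num [outSize, syndrome]
    refine ⟨first B, rfl, rfl, ?_⟩
    rw [← h1]
    have hγ : (0 : ℝ) ≤ gateBound N := Nat.cast_nonneg _
    -- Here `θ = 0.0006 * 768 = 0.4608`. The renewal inequality for the depth moment, with its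
    -- factor `2θ`, requires `θ < 1/2`.
    refine bounds_first_ofReal B (by norm_num) (by norm_num) hB hB' (by norm_num)
      (by positivity) (by positivity) ?_ ?_ ?_
    · norm_num [cast_outSize, syndrome]
    · norm_num [memorySize]; linarith
    · norm_num [memorySize]
  | succ j ih =>
    obtain ⟨S, h1, h2, h3⟩ := ih ((memorySize_le_succ j).trans hj)
    have h4 : outSize (j + 1) ≤ fanIn j * outSize j := by
      rw [fanIn_mul_outSize]
      exact Nat.mul_le_mul_left _ (Nat.sub_le _ _)
    have h5 : fanIn j * outSize j - outSize (j + 1) = syndrome (j + 1) := by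
      rw [fanIn_mul_outSize, outSize, ← Nat.mul_sub, Nat.sub_sub_self Nat.one_le_two_pow, mul_one]
    have h6 : 2 ≤ fanIn j * outSize j := by
      have := linear_le_syndrome (j + 1)
      omega
    obtain ⟨B, hB, hB'⟩ := exists_box_of_le h6 (outSize_pos (j + 1)) h4
      ((Nat.mul_le_mul_left _ (outSize_le_memorySize j)).trans hj) hx hxd
    have hy := inv_two_pow_le j
    have hy0 : (0 : ℝ) < (2 ^ (j + 3))⁻¹ := by positivity
    obtain ⟨g1, g2⟩ := inv_two_pow_succ j
    rw [g1] at h3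
    refine ⟨next S (fanIn j) B, by rw [memory, h1, memorySize], by rw [layers, h2], ?_⟩
    have h7 := h3.next_of_le_fanIn (fanIn_pos j) le_rfl B hB hB'
      (e' := 6 * (1 - (2 ^ (j + 2))⁻¹) * outSize (j + 1)) (by
        have : (0 : ℝ) ≤ 1 - 4 * (2 ^ (j + 3))⁻¹ := by linarith
        positivity) (by
        have : (0 : ℝ) ≤ 1 - (2 ^ (j + 2))⁻¹ := by rw [g2]; linarith
        positivity) (by
        rw [g2, cast_outSize_succ]
        set y : ℝ := (2 ^ (j + 3))⁻¹
        -- One factor `1 - y` is the rate of the new layer, the other pays for its reruns; `1 - 4y ≤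
        -- (1 - y)²(1 - 2y)` leaves room for both.
        calc fanIn j * (6 * (1 - 4 * y) * outSize j) =
              (fanIn j * outSize j : ℝ) * (6 * (1 - 4 * y)) := by ring
          _ ≤ (fanIn j * outSize j : ℝ) * ((1 - y) * (6 * (1 - 2 * y) * (1 - y))) := by
              refine mul_le_mul_of_nonneg_left ?_ (by positivity)
              nlinarith [mul_nonneg hy0.le hy0.le]
          _ = _ := by ring)
    rw [h5] at h7
    simpa only [memorySize, Nat.cast_mul] using h7

end Scheme

end Distill

/-! ### The last layer, fitted to the target infidelity -/

namespace Distill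

open scoped ENNReal

lemma rpow_three_halves_sq {L : ℝ} (hL : 0 ≤ L) : (L ^ (3 / 2 : ℝ)) ^ 2 = L ^ 3 := by
  rw [← Real.rpow_natCast, ← Real.rpow_mul hL, ← Real.rpow_natCast]
  norm_num

namespace Scheme

/-- A protocol whose output has infidelity at most `2⁻ˢ` with `s ≥ L`. -/
theorem exists_scheme {L : ℝ} (hL : 10 ≤ L) :
    ∃ (b k s j : ℕ) (S : Scheme b k) (x : ℝ≥0∞), 1 ≤ x ∧ x ≠ ⊤ ∧
      x ^ depthBound S.memory = 2 ∧ L ≤ s ∧ 1 ≤ k ∧ k ≤ S.memory ∧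
      (S.memory : ℝ) ≤ L ^ (3 / 2 : ℝ) ∧ S.layers ≤ j + 2 ∧ (tower j : ℝ) < L ∧
      S.Bounds (0.0006 * b) ((2 : ℝ) ^ s)⁻¹ (ENNReal.ofReal (24 * k))
        (ENNReal.ofReal (32320 * S.memory ^ 5)) x
        (ENNReal.ofReal (2 ^ (2 + 2 * Nat.clog 2 S.memory))) := by
  set R := L ^ (3 / 2 : ℝ)
  have hR0 : 0 ≤ R := by positivity
  have hR : R ^ 2 = L ^ 3 := rpow_three_halves_sq (by linarith)
  set s := ⌈L⌉₊
  have hs : L ≤ s := Nat.le_ceil L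
  have hs' : (s : ℝ) < L + 1 := Nat.ceil_lt_add_one (by linarith)
  have hs10 : 10 ≤ s := by exact_mod_cast hL.trans hs
  -- For moderate targets a single box from `2s` to `s` pairs suffices, since then `0.0006 * 2s <
  -- 1/2`.
  by_cases h : s ≤ 192
  · obtain ⟨x, hx, hx', hxd⟩ := exists_pow_eq_two (d := depthBound (2 * s))
      (by unfold depthBound; omega)
    obtain ⟨B, hB, hB'⟩ := exists_box_of_le (n := 2 * s) (k := s) (N := 2 * s) (by omega)
      (by omega) (by omega) le_rfl hx hxd
    have h1 : (s : ℝ) ≤ 192 := by exact_mod_cast h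
    have h2 : (10 : ℝ) ≤ s := by exact_mod_cast hs10
    refine ⟨2 * s, s, s, 0, first B, x, hx, hx', hxd, hs, by omega,
      show s ≤ 2 * s by omega, ?_, show 1 ≤ 2 by omega, by norm_num [tower]; linarith, ?_⟩
    · rw [show ((first B).memory : ℝ) = 2 * s by simp [memory]]
      refine le_trans (b := 2 * (L + 1)) (by linarith) (le_of_sq_le_sq ?_ hR0)
      rw [hR]
      nlinarith [mul_nonneg (sub_nonneg.2 hL) (sq_nonneg L)]
    · have h3 : 2 * s - s = s := by omega
      have h4 : (first B).memory = 2 * s := rfl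
      have h5 : (gateBound (2 * s) : ℝ) ≤ 2020 * ((2 * s : ℕ) : ℝ) ^ 3 := by
        exact_mod_cast gateBound_le (by omega)
      have h6 := bounds_first_ofReal (θ := 0.0006 * (2 * s : ℕ)) B (by positivity)
        (by push_cast; linarith) hB hB' (e := 24 * s) (g := 32320 * ((2 * s : ℕ) : ℝ) ^ 5)
        (φ := 2 ^ (2 + 2 * Nat.clog 2 (2 * s))) (by positivity) (by positivity) (by positivity)
        (by push_cast; nlinarith) (by
          have h7 : (1 : ℝ) ≤ ((2 * s : ℕ) : ℝ) := by push_cast; linarith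
          have h8 := pow_le_pow_right₀ h7 (show 3 ≤ 5 by norm_num)
          have h9 : 0.0006 * ((2 * s : ℕ) : ℝ) ≤ 1 / 2 := by push_cast; linarith
          have := mul_le_mul_of_nonneg_right h9 (show 0 ≤ 32320 * ((2 * s : ℕ) : ℝ) ^ 5 by
            positivity)
          linarith) (by
          have h7 : (2 : ℝ) ^ 4 ≤ 2 ^ (2 + 2 * Nat.clog 2 (2 * s)) := by
            refine pow_le_pow_right₀ (by norm_num) ?_
            have : 0 < Nat.clog 2 (2 * s) := Nat.clog_pos (by norm_num) (by omega)
            omega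
          have h9 : 0.0006 * ((2 * s : ℕ) : ℝ) * 2 ≤ 1 / 2 := by push_cast; linarith
          have := mul_le_mul_of_nonneg_right h9 (show 0 ≤ (2 : ℝ) ^ (2 + 2 * Nat.clog 2 (2 * s)) by
            positivity)
          linarith)
      rw [h3] at h6
      rwa [h4]
  -- Layer `j` is the last standard one with `syndrome j < s`; its outputs feed one further box that
  -- measures `s` pairs.
  · have hex : ∃ m, s ≤ syndrome m := ⟨s, by have := linear_le_syndrome s; omega⟩
    obtain ⟨j, hj⟩ : ∃ j, Nat.find hex = j + 1 := Nat.exists_eq_succ_of_ne_zero fun h0 => by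
      have := Nat.find_spec hex
      rw [h0] at this
      exact h this
    have hj1 : s ≤ syndrome (j + 1) := hj ▸ Nat.find_spec hex
    have hj2 : syndrome j < s := not_le.1 (Nat.find_min hex (by omega))
    have hj3 : (syndrome j : ℝ) < L := Nat.lt_ceil.1 hj2
    have hk0 := outSize_pos j
    -- The least multiple of `outSize j` above `2s`: at least half of the inputs of the last box are
    -- output, while the memory stays of order `s` plus that of one run of layer `j`.
    set c := 2 * s / outSize j + 1
    have hc1 : 2 * s ≤ c * outSize j := by
      have := Nat.lt_div_mul_add (a := 2 * s) hk0
      rw [Nat.add_mul, one_mul]; omega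
    have hc2 : c * outSize j ≤ 2 * s + outSize j := by
      rw [Nat.add_mul, one_mul]
      exact Nat.add_le_add_right (Nat.div_mul_le_self _ _) _
    -- Minimality of the next standard layer, `s ≤ syndrome (j + 1)`, keeps the fan-in in the range
    -- where rejections are rare.
    have hc : c ≤ fanIn j := by
      have h1 : 2 * s / outSize j ≤ 2 * 2 ^ (syndrome j / 8) := by
        refine Nat.div_le_of_le_mul ?_
        calc 2 * s ≤ 2 * syndrome (j + 1) := by omega
          _ = _ := by rw [syndrome_succ]; ring
      have h2 : 2 ^ 3 ≤ 2 ^ (j + 3) := Nat.pow_le_pow_right (by norm_num) (by omega)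
      calc c ≤ 2 ^ (syndrome j / 8) * 2 ^ 3 := by
            have : 1 ≤ 2 ^ (syndrome j / 8) := Nat.one_le_two_pow
            omega
        _ ≤ _ := Nat.mul_le_mul_left _ h2
    set M := c * memorySize j
    have hMj : memorySize j ≤ M := Nat.le_mul_of_pos_left _ (Nat.succ_pos _)
    have hnM : c * outSize j ≤ M := Nat.mul_le_mul_left _ (outSize_le_memorySize j)
    obtain ⟨x, hx, hx', hxd⟩ := exists_pow_eq_two (d := depthBound M)
      (by unfold depthBound; omega)
    obtain ⟨S, hS1, hS2, hS3⟩ := exists_scheme_outSize hx hxd j hMj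
    obtain ⟨B, hB, hB'⟩ := exists_box_of_le (n := c * outSize j) (k := c * outSize j - s) (N := M)
      (by omega) (by omega) (by omega) hnM hx hxd
    have hmem : (next S c B).memory = M := by rw [memory, hS1]
    refine ⟨768, c * outSize j - s, s, j, next S c B, x, hx, hx', hmem ▸ hxd, hs, by omega,
      by omega, ?_, by rw [layers, hS2], ?_, ?_⟩
    · have h1 : (M : ℝ) ≤ 6 * s + memorySize j := by
        have hk : (0 : ℝ) < outSize j := Nat.cast_pos.2 hk0
        have h2 : (c * outSize j : ℝ) ≤ 2 * s + outSize j := by exact_mod_cast hc2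
        have h3 := memorySize_le_three_mul j
        refine le_of_mul_le_mul_right ?_ hk
        calc (M : ℝ) * outSize j = (c * outSize j : ℝ) * memorySize j := by
              push_cast [M]; ring
          _ ≤ (2 * s + outSize j) * memorySize j := by gcongr
          _ = 2 * s * memorySize j + outSize j * memorySize j := by ring
          _ ≤ 2 * s * (3 * outSize j) + outSize j * memorySize j := by gcongr
          _ = _ := by ring
      have h192 : (192 : ℝ) ≤ L := by
        have : (192 : ℝ) ≤ syndrome j := by
          have := linear_le_syndrome j
          exact_mod_cast (show 192 ≤ syndrome j by omega)
        linarith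
      -- Together with `9 * (L + 1) ≤ R` this bounds `6 * s + memorySize j` by two thirds plus one
      -- third of `R`.
      have h2 : 3 * (memorySize j : ℝ) ≤ R := by
        refine le_of_sq_le_sq ?_ hR0
        rw [hR]
        calc (3 * (memorySize j : ℝ)) ^ 2 = 9 * (memorySize j : ℝ) ^ 2 := by ring
          _ ≤ (syndrome j : ℝ) ^ 3 := by exact_mod_cast memorySize_sq_le j
          _ ≤ L ^ 3 := by gcongr
      have h3 : 9 * (L + 1) ≤ R := by
        refine le_of_sq_le_sq ?_ hR0
        rw [hR]
        nlinarith [mul_nonneg (sub_nonneg.2 h192) (sq_nonneg L)]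
      rw [hmem]
      linarith
    · refine lt_of_le_of_lt ?_ hj3
      have := eight_mul_tower_le j
      exact_mod_cast (show tower j ≤ syndrome j by omega)
    · rw [hmem]
      have hy := inv_two_pow_le j
      have hy0 : (0 : ℝ) < (2 ^ (j + 3))⁻¹ := by positivity
      obtain ⟨g1, -⟩ := inv_two_pow_succ j
      rw [g1] at hS3
      have h1 : ((c * outSize j - s : ℕ) : ℝ) = c * outSize j - s := by
        rw [Nat.cast_sub (by omega)]; push_cast; ring
      have h2 : (2 * s : ℝ) ≤ c * outSize j := by exact_mod_cast hc1
      have h4 : 4 ^ j ≤ M := by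
        have := le_syndrome j
        have := syndrome_le_outSize j
        have := outSize_le_memorySize j
        omega
      have h4' : (4 : ℝ) ^ j ≤ M := by exact_mod_cast h4
      have hM1 : 1 ≤ M := le_trans (Nat.one_le_pow _ _ (by norm_num)) h4
      have h3 := hS3.next_of_le_fanIn (Nat.succ_pos _) hc B hB hB'
        (e' := 24 * (c * outSize j - s : ℕ)) (by
          have : (0 : ℝ) ≤ 1 - 4 * (2 ^ (j + 3))⁻¹ := by linarith
          positivity) (by positivity) (by
          rw [h1]
          set y : ℝ := (2 ^ (j + 3))⁻¹
          set n : ℝ := c * outSize j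
          have hn : 0 ≤ n := by positivity
          -- As `n ≥ 2s`, the output `n - s` is at least `n / 2`, so `24 * (n - s)` is at least `12
          -- * n`.
          calc c * (6 * (1 - 4 * y) * outSize j) = 6 * (n * (1 - 4 * y)) := by ring
            _ ≤ 6 * (n * (1 - y)) := by gcongr; linarith
            _ = (1 - y) * (6 * n) := by ring
            _ ≤ _ := mul_le_mul_of_nonneg_left (by linarith) (by linarith))
      have h5 : c * outSize j - (c * outSize j - s) = s := by omega
      rw [h5] at h3
      have h6 : (gateBound M : ℝ) ≤ 2020 * (M : ℝ) ^ 3 := by exact_mod_cast gateBound_le hM1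
      have h7 : (4 : ℝ) ^ (j + 2) * (c * memorySize j) * gateBound M ≤ 32320 * (M : ℝ) ^ 5 := by
        rw [show (c * memorySize j : ℝ) = M by push_cast [M]; ring, pow_add]
        calc (4 : ℝ) ^ j * 4 ^ 2 * M * gateBound M ≤ M * 4 ^ 2 * M * (2020 * (M : ℝ) ^ 3) := by
              gcongr
          _ = _ := by ring
      have h8 : (4 : ℝ) ^ (j + 1) * (c * memorySize j) ≤ 2 ^ (2 + 2 * Nat.clog 2 M) := by
        have h9 : (M : ℝ) ≤ 2 ^ Nat.clog 2 M := by
          exact_mod_cast Nat.le_pow_clog (by norm_num) M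
        rw [show (c * memorySize j : ℝ) = M by push_cast [M]; ring]
        calc (4 : ℝ) ^ (j + 1) * M = 4 ^ j * 4 * M := by ring
          _ ≤ M * 4 * M := by gcongr
          _ ≤ 2 ^ Nat.clog 2 M * 4 * 2 ^ Nat.clog 2 M := by gcongr
          _ = _ := by ring
      exact ⟨h3.regular, h3.total, h3.pairs,
        fun ρ hρ w => (h3.gates ρ hρ w).trans (ENNReal.ofReal_le_ofReal h7),
        fun ρ hρ w => (h3.depth ρ hρ w).trans (ENNReal.ofReal_le_ofReal h8)⟩

end Scheme

end Distill

/-! ### Numerical budgets and the main theorem -/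

namespace Distill

open scoped ENNReal

lemma ofReal_le_inv_mul_natCast {e : ℝ} {m n : ℕ} (hm : m ≠ 0) (he : 0 ≤ e) (h : e * m ≤ n) :
    ENNReal.ofReal e ≤ (m : ℝ≥0∞)⁻¹ * n := by
  rw [← ENNReal.div_eq_inv_mul, ENNReal.le_div_iff_mul_le (.inl (by simpa)) (.inl (by simp)),
    ← ENNReal.ofReal_natCast m, ← ENNReal.ofReal_mul he, ← ENNReal.ofReal_natCast n]
  exact ENNReal.ofReal_le_ofReal h

lemma logb_two_le {y : ℝ} (hy : 1 ≤ y) : Real.logb 2 y ≤ y := by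
  rw [Real.logb_le_iff_le_rpow (by norm_num) (by linarith)]
  have h := one_add_mul_self_le_rpow_one_add (s := 1) (p := y) (by norm_num) hy
  norm_num at h
  linarith

lemma IsState.regular_of_pow_le {b : ℕ} {ρ : Op b} (h : IsState ρ) {ε₀ : ℝ} (hε₀ : ε₀ ≤ 0.0006)
    (hρ : (1 - ε₀) ^ b ≤ bellOverlap ρ) : Regular ρ (0.0006 * b) := by
  refine h.regular (le_trans ?_ hρ)
  have h1 := one_add_mul_le_pow (a := -ε₀) (by linarith) b
  have h2 : ε₀ * b ≤ 0.0006 * b := by gcongr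
  calc 1 - 0.0006 * b ≤ 1 + b * -ε₀ := by linarith
    _ ≤ (1 + -ε₀) ^ b := h1
    _ = _ := by rw [← sub_eq_add_neg]

lemma half_pow_ceil_le {δ : ℝ} (hδ : 0 < δ) : (2⁻¹ : ℝ) ^ ⌈Real.logb 2 δ⁻¹⌉₊ ≤ δ := by
  rw [inv_pow, inv_le_comm₀ (by positivity) hδ, ← Real.rpow_natCast,
    ← Real.logb_le_iff_le_rpow (by norm_num) (by positivity)]
  exact Nat.le_ceil _

lemma inv_two_pow_le_of_logb_le {ε : ℝ} (hε : 0 < ε) {s : ℕ} (hs : Real.logb 2 ε⁻¹ ≤ s) :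
    ((2 : ℝ) ^ s)⁻¹ ≤ ε := by
  rw [inv_le_comm₀ (by positivity) hε, ← Real.rpow_natCast,
    ← Real.logb_le_iff_le_rpow (by norm_num) (by positivity)]
  exact hs

/-- The depth budget for a protocol of memory `M`. -/
def depthBudget (M : ℕ) : ℕ := depthBound M * (5 + 2 * Nat.clog 2 M)

lemma depthBudget_le {L : ℝ} (hL : 10 ≤ L) {M : ℕ} (hM : 1 ≤ M) (hML : (M : ℝ) ≤ L ^ 2) :
    (depthBudget M : ℝ) ≤ 686 * Real.logb 2 L ^ 2 := by
  have hℓ : 3 ≤ Real.logb 2 L := by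
    rw [Real.le_logb_iff_rpow_le (by norm_num) (by linarith)]
    norm_num; linarith
  have hM0 : (1 : ℝ) ≤ M := by exact_mod_cast hM
  have h1 : (Nat.clog 2 M : ℝ) ≤ 2 * Real.logb 2 L + 1 := by
    have h2 : (⌈Real.logb ((2 : ℕ) : ℝ) M⌉₊ : ℝ) < Real.logb ((2 : ℕ) : ℝ) M + 1 :=
      Nat.ceil_lt_add_one (Real.logb_nonneg (by norm_num) hM0)
    have h3 : Real.logb 2 M ≤ 2 * Real.logb 2 L := by
      calc Real.logb 2 M ≤ Real.logb 2 (L ^ 2) :=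
            Real.logb_le_logb_of_le (by norm_num) (by linarith) hML
        _ = _ := by rw [Real.logb_pow]; norm_num
    rw [Real.natCeil_logb_natCast] at h2
    push_cast at h2
    linarith
  set ℓ := Real.logb 2 L
  unfold depthBudget depthBound
  push_cast
  -- For `ℓ ≥ 3` one has `64ℓ + 101 ≤ 98ℓ` and `4ℓ + 7 ≤ 7ℓ`.
  calc (32 * (Nat.clog 2 M : ℝ) + 69) * (5 + 2 * Nat.clog 2 M) ≤
        (98 * ℓ) * (7 * ℓ) := by gcongr <;> linarith
    _ = _ := by ring

end Distill

theorem mainTheorem1 :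
    ∃ (C : ℝ) (a : ℕ), 0 < C ∧ ∀ ε₀ ε_f : ℝ, ε₀ ≤ 0.0006 → 0 < ε_f → ε_f < ε₀ →
      ∃ (b k : ℕ) (S : Distill.Scheme b k) (G D : ℕ),
        (S.memory : ℝ) ≤ (Real.logb 2 ε_f⁻¹) ^ (3 / 2 : ℝ) ∧
        (S.layers : ℝ) ≤ C * (Distill.logStar ε_f⁻¹ : ℝ) ∧
        (G : ℝ) ≤ C * (Real.logb 2 ε_f⁻¹) ^ a ∧
        (D : ℝ) ≤ C * (Real.logb 2 (Real.logb 2 ε_f⁻¹)) ^ a ∧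
        ∀ δ : ℝ, 0 < δ → δ ≤ 1 / 2 →
          ∃ A P : ℕ,
            A ≤ ⌈Real.logb 2 δ⁻¹⌉₊ ∧
            ((A * P : ℕ) : ℝ) / (k : ℝ) ≤ 411 * Real.logb 2 δ⁻¹ ∧
            ((A * P : ℕ) : ℝ) ≤ 411 * (Real.logb 2 ε_f⁻¹) ^ (3 / 2 : ℝ) * Real.logb 2 δ⁻¹ ∧
            ∀ ρ : List ℕ → Distill.Op b,
              (∀ w, Distill.IsState (ρ w) ∧ (1 - ε₀) ^ b ≤ Distill.bellOverlap (ρ w)) →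
                1 - δ ≤ S.successProb ρ A P G D ∧
                (1 - ε_f) ^ k * S.successProb ρ A P G D ≤ S.successBellProb ρ A P G D := by
  -- `258560 = 8 * 32320` is the expected gate count enlarged for Markov's inequality; the power 10
  -- arises from `M ^ 5` with `M ≤ L ^ 2`.
  refine ⟨258560, 10, by norm_num, fun ε₀ ε_f hε₀ hε hlt => ?_⟩
  have hinv : (1024 : ℝ) ≤ ε_f⁻¹ := by
    rw [le_inv_comm₀ (by norm_num) hε]; norm_num; linarith
  have hL : 10 ≤ Real.logb 2 ε_f⁻¹ := by
    rw [Real.le_logb_iff_rpow_le (by norm_num) (by positivity)]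
    norm_num; linarith
  have hLinv : Real.logb 2 ε_f⁻¹ ≤ ε_f⁻¹ := Distill.logb_two_le (by linarith)
  obtain ⟨b, k, s, j, S, x, hx, hx', hxd, hs, hk, hkM, hM, hlayers, hj, hB⟩ :=
    Distill.Scheme.exists_scheme hL
  have hηε := Distill.inv_two_pow_le_of_logb_le hε hs
  set L := Real.logb 2 ε_f⁻¹
  set M := S.memory
  have hM2 : (M : ℝ) ≤ L ^ 2 := by
    refine hM.trans ?_
    rw [← Real.rpow_natCast]
    exact Real.rpow_le_rpow_of_exponent_le (by linarith) (by norm_num)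
  have hℓ : 1 ≤ Real.logb 2 L := by
    rw [Real.le_logb_iff_rpow_le (by norm_num) (by linarith)]
    norm_num; linarith
  refine ⟨b, k, S, 258560 * M ^ 5, Distill.depthBudget M, hM, ?_, ?_, ?_, fun δ hδ hδ' => ?_⟩
  -- There are at most `j + 2` layers and `j < logStar ε_f⁻¹`, so twice the iterated logarithm is
  -- enough.
  · have h1 := Distill.lt_logStar (hj.trans_le hLinv)
    have h2 : (S.layers : ℝ) ≤ 2 * Distill.logStar ε_f⁻¹ := by exact_mod_cast (by omega)
    refine h2.trans ?_
    gcongr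
    norm_num
  · push_cast
    calc 258560 * (M : ℝ) ^ 5 ≤ 258560 * (L ^ 2) ^ 5 := by gcongr
      _ = _ := by ring
  · refine (Distill.depthBudget_le hL (hk.trans hkM) hM2).trans ?_
    gcongr
    · norm_num
    · norm_num
  · have hδ1 : 1 ≤ Real.logb 2 δ⁻¹ := by
      rw [Real.le_logb_iff_rpow_le (by norm_num) (by positivity), Real.rpow_one,
        le_inv_comm₀ (by norm_num) hδ]
      linarith
    have hA : (⌈Real.logb 2 δ⁻¹⌉₊ : ℝ) ≤ 2 * Real.logb 2 δ⁻¹ := by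
      have := Nat.ceil_lt_add_one (zero_le_one.trans hδ1)
      linarith
    have hk0 : (0 : ℝ) < k := by exact_mod_cast hk
    have hkR : (k : ℝ) ≤ L ^ (3 / 2 : ℝ) := le_trans (by exact_mod_cast hkM) hM
    -- Markov's inequality needs four times the expected `24 * k` pairs. Rounding the number of
    -- repetitions up costs at most a factor two, so the overhead is at most `200 * log₂ (1/δ)`.
    refine ⟨_, 100 * k, le_rfl, ?_, ?_, fun ρ hρ => ?_⟩
    · rw [div_le_iff₀ hk0]
      push_cast
      nlinarith
    · push_cast
      calc (⌈Real.logb 2 δ⁻¹⌉₊ : ℝ) * (100 * k) ≤ 2 * Real.logb 2 δ⁻¹ * (100 * L ^ (3 / 2 : ℝ)) := by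
            gcongr
        _ = 200 * (L ^ (3 / 2 : ℝ) * Real.logb 2 δ⁻¹) := by ring
        _ ≤ 411 * (L ^ (3 / 2 : ℝ) * Real.logb 2 δ⁻¹) := by gcongr; norm_num
        _ = _ := by ring
    · have hD : x ^ Distill.depthBudget M = ((2 ^ (5 + 2 * Nat.clog 2 M) : ℕ) : ENNReal) := by
        rw [Distill.depthBudget, pow_mul, hxd]; push_cast; rfl
      obtain ⟨h1, h2⟩ := hB.success hx hx' (P := 100 * k) (G := 258560 * M ^ 5)
        (D := Distill.depthBudget M)
        (Distill.ofReal_le_inv_mul_natCast (m := 4) (by norm_num) (by positivity)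
          (by push_cast; linarith))
        (Distill.ofReal_le_inv_mul_natCast (m := 8) (by norm_num) (by positivity)
          (by push_cast; linarith))
        (by omega) (by have : 0 < M := hk.trans hkM; positivity)
        (by
          rw [hD]
          refine Distill.ofReal_le_inv_mul_natCast (m := 8) (by norm_num) (by positivity) ?_
          push_cast
          rw [show 5 + 2 * Nat.clog 2 M = 2 + 2 * Nat.clog 2 M + 3 by ring, pow_add _ _ 3]
          norm_num)
        (fun w => ⟨(hρ w).1.regular_of_pow_le hε₀ (hρ w).2, (hρ w).1.2⟩) ⌈Real.logb 2 δ⁻¹⌉₊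
      have h3 := Distill.half_pow_ceil_le hδ
      have h4 : 0 ≤ S.successProb ρ ⌈Real.logb 2 δ⁻¹⌉₊ (100 * k) (258560 * M ^ 5)
          (Distill.depthBudget M) := by linarith
      refine ⟨by linarith, le_trans (mul_le_mul_of_nonneg_right ?_ h4) h2⟩
      -- The joint infidelity of all `k` output pairs is already at most `ε_f`, which is stronger
      -- than required since `1 ≤ k`.
      calc (1 - ε_f) ^ k ≤ (1 - ε_f) ^ 1 :=
            pow_le_pow_of_le_one (by linarith) (by linarith) hk
        _ ≤ _ := by rw [pow_one]; linarith
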